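/- Let $\mathcal T$ be the topological $N=2$ superconformal algebra: the complex Lie superalgebra with even basis $\mathcal L_m,\mathcal H_m$ ($m\in\mathbb Z$) and $C$ (central), odd basis $\mathcal G_m,\mathcal Q_m$ ($m\in\mathbb Z$), and relations $$[\mathcal L_m,\mathcal L_n]=(m-n)\mathcal L_{m+n},\quad [\mathcal H_m,\mathcal H_n]=\tfrac C3 m\,\delta_{m+n,0},\quad [\mathcal L_m,\mathcal G_n]=(m-n)\mathcal G_{m+n},\quad [\mathcal H_m,\mathcal G_n]=\mathcal G_{m+n},$$ $$[\mathcal L_m,\mathcal Q_n]=-n\mathcal Q_{m+n},\quad [\mathcal H_m,\mathcal Q_n]=-\mathcal Q_{m+n},\quad [\mathcal L_m,\mathcal H_n]=-n\mathcal H_{m+n}+\tfrac C6(m^2+m)\delta_{m+n,0},$$ $$\{\mathcal G_m,\mathcal Q_n\}=2\mathcal L_{m+n}-2n\mathcal H_{m+n}+\tfrac C3(m^2+m)\delta_{m+n,0},\quad \{\mathcal G_m,\mathcal G_n\}=\{\mathcal Q_m,\mathcal Q_n\}=0 .$$ For $\Delta,q,c\in\mathbb C$, let $V^G_{\Delta,q}$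 (resp. $V^Q_{\Delta,q}$) be the Verma module generated by a highest weight vector $v$ subject to $\mathcal L_0v=\Delta v$, $\mathcal H_0v=qv$, $Cv=cv$, the vanishing of the action on $v$ of all $\mathcal L_k,\mathcal H_k,\mathcal G_k,\mathcal Q_k$ with $k>0$, and $\mathcal G_0v=0$ (resp. $\mathcal Q_0v=0$). A vector $\psi$ has level $m$ and charge $n$ if $\mathcal L_0\psi=(\Delta+m)\psi$ and $\mathcal H_0\psi=(q+n)\psi$. It is a singular vector (at level $m$ and charge $n$) if moreover it is not proportional to $v$ and is annihilated by all $\mathcal L_k,\mathcal H_k,\mathcal G_k,\mathcal Q_k$ with $k>0$; it is a no-label singular vector if in addition $\mathcal G_0\psi\ne0$, $\mathcal Q_0\psi\neq0$ and $\Delta+m=0$. A no-label singular vector space at level $m$ and charge $n$ is a linear subspace of vectors of level $m$ and charge $n$ all of whose nonzero elements are no-label singular vectors. Write $(\mathcal A,\mathcal B)=(\mathcal G,\mathcal Q)$ for $V^G$ and $(\mathcal A,\mathcal B)=(\mathcal Q,\mathcal G)$ for $V^Q$. The normal form of a vector is its expansion in the standard basis, which consists of the vectors $Xv$ with $$X=\mathcal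 L_{-l_L}\cdots\mathcal L_{-l_1}\,\mathcal H_{-h_H}\cdots\mathcal H_{-h_1}\,\mathcal A_{-a_A}\cdots\mathcal A_{-a_1}\,\mathcal B_{-b_B}\cdots\mathcal B_{-b_1}\,\mathcal L_{-1}^{k}\mathcal A_{-1}^{r_1}\mathcal B_{-1}^{r_2}\mathcal B_0^{r_3},$$ $l_L\ge\dots\ge l_1\ge2$, $h_H\ge\dots\ge h_1\ge1$, $a_A>\dots>a_1\ge2$, $b_B>\dots>b_1\ge2$, $k\ge0$, $r_i\in\{0,1\}$. **Theorem.** Let $c\neq3$, $\Delta,q\in\mathbb C$, $m\ge1$ an integer and $n\in\mathbb Z$. (1) A no-label singular vector space at level $m$ and charge $n$ in $V^G_{\Delta,q}$ has dimension at most $1$ if $n\in\{-1,0\}$ and is $0$ otherwise; in $V^Q_{\Delta,q}$ it has dimension at most $1$ if $n\in\{0,1\}$ and is $0$ otherwise. (2) If $\psi$ is a no-label singular vector at level $m$ and charge $n$ in $V^G_{\Delta,q}$ (resp. $V^Q_{\Delta,q}$), then $\Delta=-m$ and $n\in\{-1,0\}$ (resp. $n\in\{0,1\}$). Moreover $\psi$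 has a unique normal form, and this normal form contains with a nonzero coefficient at least one of the following terms: if $n=0$, one of $$\mathcal L_{-1}^m,\quad \mathcal H_{-1}\mathcal L_{-1}^{m-1},\quad \mathcal L_{-1}^{m-1}\mathcal A_{-1}\mathcal B_0;$$ if $n=-1$ for $V^G$, or $n=1$ for $V^Q$, one of $$\mathcal L_{-1}^m\mathcal B_0,\quad \mathcal H_{-1}\mathcal L_{-1}^{m-1}\mathcal B_0,\quad \mathcal L_{-1}^{m-1}\mathcal B_{-1}.$$ -/

import Mathlib

noncomputable section

namespace TopN2

/-- Basis of the topological `N = 2` superconformal algebra: the bosonic modes `L m`, `H m`,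
the fermionic modes `G m`, `Q m` (`m : ℤ`), and the central element `C`. -/
inductive Gen : Type
  | L (m : ℤ) : Gen
  | H (m : ℤ) : Gen
  | G (m : ℤ) : Gen
  | Q (m : ℤ) : Gen
  | C : Gen

/-- The free associative complex algebra on the basis of the superalgebra. -/
abbrev Free : Type := FreeAlgebra ℂ Gen

namespace Free

def L (m : ℤ) : Free := FreeAlgebra.ι ℂ (Gen.L m)
def H (m : ℤ) : Free := FreeAlgebra.ι ℂ (Gen.H m)
def G (m : ℤ) : Free := FreeAlgebra.ι ℂ (Gen.G m)
def Q (m : ℤ) : Free := FreeAlgebra.ι ℂ (Gen.Q m)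
def C : Free := FreeAlgebra.ι ℂ Gen.C

end Free

open Free in
/-- The (anti-)commutation relations of the topological `N = 2` superconformal algebra. -/
inductive Rel : Free → Free → Prop
  | LL (m n : ℤ) : Rel (L m * L n - L n * L m) (((m : ℂ) - n) • L (m + n))
  | HH (m n : ℤ) : Rel (H m * H n - H n * H m)
      ((if m + n = 0 then (m : ℂ) / 3 else 0) • C)
  | LG (m n : ℤ) : Rel (L m * G n - G n * L m) (((m : ℂ) - n) • G (m + n))
  | HG (m n : ℤ) : Rel (H m * G n - G n * H m) (G (m + n))
  | LQ (m n : ℤ) : Rel (L m * Q n - Q n * L m) ((-(n : ℂ)) • Q (m + n))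
  | HQ (m n : ℤ) : Rel (H m * Q n - Q n * H m) (-Q (m + n))
  | LH (m n : ℤ) : Rel (L m * H n - H n * L m)
      ((-(n : ℂ)) • H (m + n) + (if m + n = 0 then ((m : ℂ) ^ 2 + m) / 6 else 0) • C)
  | GQ (m n : ℤ) : Rel (G m * Q n + Q n * G m)
      ((2 : ℂ) • L (m + n) - (2 * (n : ℂ)) • H (m + n)
        + (if m + n = 0 then ((m : ℂ) ^ 2 + m) / 3 else 0) • C)
  | GG (m n : ℤ) : Rel (G m * G n + G n * G m) 0
  | QQ (m n : ℤ) : Rel (Q m * Q n + Q n * Q m) 0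
  | central (x : Gen) : Rel (C * FreeAlgebra.ι ℂ x) (FreeAlgebra.ι ℂ x * C)

/-- The universal enveloping algebra of the topological `N = 2` superconformal algebra. -/
abbrev U : Type := RingQuot Rel

/-- The image of a basis element of the superalgebra in the enveloping algebra. -/
def gen (x : Gen) : U := RingQuot.mkAlgHom ℂ Rel (FreeAlgebra.ι ℂ x)

def L (m : ℤ) : U := gen (Gen.L m)
def H (m : ℤ) : U := gen (Gen.H m)
def G (m : ℤ) : U := gen (Gen.G m)
def Q (m : ℤ) : U := gen (Gen.Q m)
def C : U := gen Gen.C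

/-- The positive operators: the modes of strictly positive index. -/
def positive : Set U := {x | ∃ k : ℤ, 0 < k ∧ (x = L k ∨ x = H k ∨ x = G k ∨ x = Q k)}

/-- The two kinds of generic Verma modules: built on a `G₀`-closed or on a `Q₀`-closed
highest weight vector. -/
inductive Kind : Type
  | G : Kind
  | Q : Kind

namespace Kind

/-- The fermionic field whose zero mode annihilates the highest weight vector. -/
def closed : Kind → ℤ → U
  | .G => TopN2.G
  | .Q => TopN2.Q

/-- The other fermionic field. -/
def other : Kind → ℤ → U
  | .G => TopN2.Q
  | .Q => TopN2.G

end Kind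

/-- The left ideal of the enveloping algebra generated by the highest weight conditions. -/
def hwIdeal (t : Kind) (Δ q c : ℂ) : Submodule U U :=
  Submodule.span U
    (positive ∪ {L 0 - algebraMap ℂ U Δ, H 0 - algebraMap ℂ U q, C - algebraMap ℂ U c,
      t.closed 0})

/-- The generic Verma modules `V^G_{Δ,q}` (for `t = .G`) and `V^Q_{Δ,q}` (for `t = .Q`) of
central charge `c`: the module induced from the one-dimensional module spanned by the
highest weight vector, i.e. the enveloping algebra modulo the highest weight conditions. -/
abbrev Verma (t : Kind) (Δ q c : ℂ) : Type := U ⧸ hwIdeal t Δ q c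

/-- The highest weight vector. -/
def hw (t : Kind) (Δ q c : ℂ) : Verma t Δ q c := Submodule.Quotient.mk 1

section Singular

variable {t : Kind} {Δ q c : ℂ}

/-- `ψ` has level `m` and charge `n` relative to the highest weight vector. -/
def HasGrade (ψ : Verma t Δ q c) (m : ℕ) (n : ℤ) : Prop :=
  L 0 • ψ = (Δ + m) • ψ ∧ H 0 • ψ = (q + n) • ψ

/-- Singular vectors at level `m` and with charge `n`: eigenvectors not proportional to the
highest weight vector that are annihilated by all positive operators. -/
structure IsSingular (ψ : Verma t Δ q c) (m : ℕ) (n : ℤ) : Prop where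
  grade : HasGrade ψ m n
  not_prop : ψ ∉ Submodule.span ℂ {hw t Δ q c}
  annihilated : ∀ x ∈ positive, x • ψ = 0

/-- No-label singular vectors: singular vectors annihilated neither by `G₀` nor by `Q₀`,
of vanishing conformal weight. -/
structure IsNoLabel (ψ : Verma t Δ q c) (m : ℕ) (n : ℤ) : Prop extends IsSingular ψ m n where
  G_ne : G 0 • ψ ≠ 0
  Q_ne : Q 0 • ψ ≠ 0
  weight_zero : (m : ℂ) + Δ = 0

/-- No-label singular vector spaces at level `m` and with charge `n`: subspaces of vectors of
that level and charge all of whose nonzero elements are no-label singular vectors. -/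
def IsNoLabelSpace (N : Submodule ℂ (Verma t Δ q c)) (m : ℕ) (n : ℤ) : Prop :=
  (∀ ψ ∈ N, HasGrade ψ m n) ∧ ∀ ψ ∈ N, ψ ≠ 0 → IsNoLabel ψ m n

end Singular

/-- The labels of the standard basis. With `(A, B) = (G, Q)` for `V^G` and `(A, B) = (Q, G)` for
`V^Q`, such a label stands for the ordered monomial
`L_{-l_1} L_{-l_2} ⋯ H_{-h_1} H_{-h_2} ⋯ A_{-a_1} A_{-a_2} ⋯ B_{-b_1} B_{-b_2} ⋯
  L_{-1}^k A_{-1}^{r₁} B_{-1}^{r₂} B_0^{r₃}`. -/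
@[ext]
structure StdTerm : Type where
  l : List ℕ
  h : List ℕ
  a : List ℕ
  b : List ℕ
  k : ℕ
  r₁ : Bool
  r₂ : Bool
  r₃ : Bool
  l_sorted : l.Pairwise (· ≥ ·)
  h_sorted : h.Pairwise (· ≥ ·)
  a_sorted : a.Pairwise (· > ·)
  b_sorted : b.Pairwise (· > ·)
  l_ge : ∀ j ∈ l, 2 ≤ j
  h_ge : ∀ j ∈ h, 1 ≤ j
  a_ge : ∀ j ∈ a, 2 ≤ j
  b_ge : ∀ j ∈ b, 2 ≤ j

namespace StdTerm

/-- The monomial in the enveloping algebra. -/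
def op (t : Kind) (X : StdTerm) : U :=
  (X.l.map fun j => L (-(j : ℤ))).prod * (X.h.map fun j => H (-(j : ℤ))).prod *
    (X.a.map fun j => t.closed (-(j : ℤ))).prod * (X.b.map fun j => t.other (-(j : ℤ))).prod *
    L (-1) ^ X.k * t.closed (-1) ^ X.r₁.toNat * t.other (-1) ^ X.r₂.toNat *
    t.other 0 ^ X.r₃.toNat

/-- The monomial `L_{-1}^k A_{-1}^{r₁} B_{-1}^{r₂} B_0^{r₃}`. -/
def low (k : ℕ) (r₁ r₂ r₃ : Bool) : StdTerm where
  l := []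
  h := []
  a := []
  b := []
  k := k
  r₁ := r₁
  r₂ := r₂
  r₃ := r₃
  l_sorted := by simp
  h_sorted := by simp
  a_sorted := by simp
  b_sorted := by simp
  l_ge := by simp
  h_ge := by simp
  a_ge := by simp
  b_ge := by simp

/-- The monomial `H_{-1} L_{-1}^k B_0^{r₃}`. -/
def lowH (k : ℕ) (r₃ : Bool) : StdTerm :=
  { low k false false r₃ with
    h := [1]
    h_sorted := by simp
    h_ge := by simp }

end StdTerm

/-- `f` is a family of coefficients of `ψ` with respect to the standard basis: the normal form
of `ψ`. -/
def IsNormalForm {t : Kind} {Δ q c : ℂ} (f : StdTerm →₀ ℂ) (ψ : Verma t Δ q c) : Prop :=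
  ψ = f.sum fun X z => z • (X.op t • hw t Δ q c)

open StdTerm in
/-- The ordering kernels at level `m` and charge `n` of the adapted orderings on the standard
bases, the annihilation operators being the positive operators. Elements that would need a
negative power of `L_{-1}` are left out. -/
def orderingKernel : Kind → ℕ → ℤ → Set StdTerm
  | .G, m, n => {X |
      (n = 1 ∧ ∃ k, k + 1 = m ∧ X = low k true false false) ∨
      (n = 0 ∧ (X = low m false false false ∨
        ∃ k, k + 1 = m ∧ (X = lowH k false ∨ X = low k true false true))) ∨
      (n = -1 ∧ (X = low m false false true ∨
        ∃ k, k + 1 = m ∧ (X = lowH k true ∨ X = low k false true false))) ∨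
      (n = -2 ∧ ∃ k, k + 1 = m ∧ X = low k false true true)}
  | .Q, m, n => {X |
      (n = 2 ∧ ∃ k, k + 1 = m ∧ X = low k false true true) ∨
      (n = 1 ∧ (X = low m false false true ∨
        ∃ k, k + 1 = m ∧ (X = lowH k true ∨ X = low k false true false))) ∨
      (n = 0 ∧ (X = low m false false false ∨
        ∃ k, k + 1 = m ∧ (X = lowH k false ∨ X = low k true false true))) ∨
      (n = -1 ∧ ∃ k, k + 1 = m ∧ X = low k true false false)}

/-- The charges at which no-label singular vectors are not excluded. -/
def allowedCharges : Kind → Finset ℤ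
  | .G => {-1, 0}
  | .Q => {0, 1}

/-- The upper limits for the dimensions of no-label singular vector spaces of charge `n`. -/
def noLabelBound (t : Kind) (n : ℤ) : ℕ := if n ∈ allowedCharges t then 1 else 0

end TopN2

end

/-! Everything rests on one kernel statement (`exists_kernel_term`): for c ≠ 3, a nonzero vector of
level m and charge n killed by all positive modes has a nonzero coefficient on some term of the
ordering kernel. The claim on normal forms is this statement itself. For the charges, the bracket of
a positive mode with G_0 or Q_0 is again a combination of positive modes, so G_0 ψ and Q_0 ψ are
nonzero vectors of the same type at charges n ± 1; the ordering kernels are empty outside four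
consecutive charges, which leaves the two middle ones for n. For the dimension, one of the two zero
modes moves the space to an extremal charge, where the kernel has at most one term; the coefficient
there is an injective linear functional.

To prove the kernel statement, filter by degree: L_{-1} has degree 2, the other L's and the fermions
degree 1, H and C degree 0. In the graded algebra L_{-1} becomes central; it acts injectively, call
it λ. Modes whose indices add up to -1 become conjugate: [L_p, L_{-1-p}] = (2p+1) λ for p ≥ 1 and
{G_i, Q_{-1-i}} = 2 λ. The leading term of a vector killed by the positive modes is killed by their
graded versions (`gr_T_filter`). A creation letter times its conjugate mode counts the occurrences
of that letter, up to a nonzero multiple of λ, so a letter conjugate to a positive mode cannot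
occur.

The modes of H need a bosonization step, because they act on the fermions. With s = ±1 the charge of
the closed field, K_p = λ H_p - (s/2) Σ_i G_i Q_{p-1-i} (`decoupled`) commutes with the L's and the
fermions, and [K_p, H_{-p}] = p (c/3 - 1) λ. This is where c ≠ 3 enters. On the vectors v in
question K_p vanishes for p ≥ 2, but K_1 v = (s/2) Q_0 G_0 v need not; `gr_kernel` analyses u = Q_0
G_0 v to conclude.

Coefficients make sense by a Poincaré–Birkhoff–Witt theorem for the Verma module, proved by
rewriting words: `conf` is confluence, and the ambiguities are resolved by the Jacobi identity. The
same rewriting system serves the algebra and its graded version. Both kinds of Verma module are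
treated at once, by letting `Gen.G` stand for the field whose zero mode kills the highest weight
vector. -/

noncomputable section

namespace TopN2

/-! ### Formal linear combinations. -/

/-- The value on a formal linear combination of the linear extension of `f`. -/
def bsum {I E : Type*} [AddCommMonoid E] [Module ℂ E] (l : List (ℂ × I)) (f : I → E) : E :=
  (l.map fun p => p.1 • f p.2).sum

section bsum

variable {I J E F : Type*} [AddCommGroup E] [Module ℂ E] [AddCommGroup F] [Module ℂ F]

@[simp] theorem bsum_nil (f : I → E) : bsum [] f = 0 := rfl

@[simp] theorem bsum_cons (p : ℂ × I) (l : List (ℂ × I)) (f : I → E) :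
    bsum (p :: l) f = p.1 • f p.2 + bsum l f := rfl

theorem bsum_congr {l : List (ℂ × I)} {f g : I → E} (h : ∀ p ∈ l, f p.2 = g p.2) :
    bsum l f = bsum l g := by
  unfold bsum
  congr 1
  exact List.map_congr_left fun p hp => by rw [h p hp]

theorem bsum_add (l : List (ℂ × I)) (f g : I → E) :
    bsum l (fun z => f z + g z) = bsum l f + bsum l g := by
  induction l with
  | nil => simp
  | cons p l ih => simp only [bsum_cons, ih, smul_add]; abel

theorem bsum_smul (l : List (ℂ × I)) (a : ℂ) (f : I → E) :
    bsum l (fun z => a • f z) = a • bsum l f := by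
  induction l with
  | nil => simp
  | cons p l ih => simp only [bsum_cons, ih, smul_add, smul_comm a]

theorem bsum_zero (l : List (ℂ × I)) : bsum l (fun _ => (0 : E)) = 0 := by
  induction l with
  | nil => simp
  | cons p l ih => simp [ih]

theorem map_bsum (T : E →ₗ[ℂ] F) (l : List (ℂ × I)) (f : I → E) :
    T (bsum l f) = bsum l (fun z => T (f z)) := by
  induction l with
  | nil => simp
  | cons p l ih => simp [ih]

theorem bsum_apply (l : List (ℂ × I)) (f : I → J →₀ ℂ) (w : J) :
    bsum l f w = bsum l (fun z => f z w) := by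
  induction l with
  | nil => simp
  | cons p l ih => simp [ih]

theorem bsum_smul_right (l : List (ℂ × I)) (f : I → ℂ) (x : E) :
    bsum l (fun z => f z • x) = bsum l f • x := by
  induction l with
  | nil => simp
  | cons p l ih => simp [ih, add_smul, mul_smul]

theorem bsum_filter (l : List (ℂ × I)) (P : I → Prop) [DecidablePred P] (f : I → E) :
    bsum (l.filter fun p => P p.2) f = bsum l (fun z => if P z then f z else 0) := by
  induction l with
  | nil => simp
  | cons p l ih => by_cases h : P p.2 <;> simp [h, ih]

end bsum

/-! ### Lie superalgebras by structure constants, and the rewriting of words. -/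

/-- The sign in the exchange of two homogeneous elements of given parities. -/
def sgn (a b : Bool) : ℂ := if a && b then -1 else 1

/-- The structure constants of a Lie superalgebra with basis `I`, together with a subalgebra
spanned by a final segment of the basis and a character of this subalgebra. -/
structure SuperData (I : Type) [LinearOrder I] where
  odd : I → Bool
  br : I → I → List (ℂ × I)
  hwt : I → Prop
  chi : I → ℂ
  odd_br : ∀ x y, ∀ p ∈ br x y, odd p.2 = (odd x ^^ odd y)
  br_self : ∀ x, odd x = true → br x x = []
  skew : ∀ x y (f : I → ℂ), bsum (br x y) f = -sgn (odd x) (odd y) * bsum (br y x) f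
  jacobi : ∀ x y z (f : I → ℂ), bsum (br y z) (fun w => bsum (br x w) f) =
    bsum (br x y) (fun w => bsum (br w z) f) +
      sgn (odd x) (odd y) * bsum (br x z) (fun w => bsum (br y w) f)
  hwt_mono : ∀ x y, hwt x → x ≤ y → hwt y
  hwt_br : ∀ x y, hwt x → hwt y → ∀ p ∈ br x y, hwt p.2
  chi_br : ∀ x y, hwt x → hwt y → bsum (br x y) chi = 0
  chi_odd : ∀ x, hwt x → odd x = true → chi x = 0

/-- The number of inversions of a word. -/
def inversions {I : Type} [LinearOrder I] : List I → ℕ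
  | [] => 0
  | a :: l => l.countP (· < a) + inversions l

theorem inversions_swap {I : Type} [LinearOrder I] (u v : List I) {x y : I} (h : x < y) :
    inversions (u ++ x :: y :: v) < inversions (u ++ y :: x :: v) := by
  induction u with
  | nil => simp [inversions, h, h.not_gt]; omega
  | cons a u ih =>
    have : (u ++ x :: y :: v).Perm (u ++ y :: x :: v) :=
      List.Perm.append_left _ (List.Perm.swap _ _ _)
    simp only [List.cons_append, inversions, this.countP_eq]
    omega

namespace SuperData

variable {I : Type} [LinearOrder I] (D : SuperData I)

/-- The well-founded measure on words for the reduction to normal form. -/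
def meas (w : List I) : ℕ ×ₗ ℕ := toLex (w.length, inversions w)

theorem meas_lt_of_length {w w' : List I} (h : w.length < w'.length) : meas w < meas w' :=
  Prod.Lex.toLex_lt_toLex.2 (Or.inl h)

theorem meas_swap (u v : List I) {x y : I} (h : x < y) :
    meas (u ++ x :: y :: v) < meas (u ++ y :: x :: v) :=
  Prod.Lex.toLex_lt_toLex.2 (Or.inr ⟨by simp, inversions_swap u v h⟩)

/-- `m` is obtained from the word `w` by one reduction step, when shorter or less disordered
words are evaluated by `τ`. -/
def Red (τ : List I → List I →₀ ℂ) (w : List I) (m : List I →₀ ℂ) : Prop :=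
  (∃ u y x v, w = u ++ y :: x :: v ∧ x < y ∧
    m = sgn (D.odd y) (D.odd x) • τ (u ++ x :: y :: v) +
      bsum (D.br y x) (fun z => τ (u ++ z :: v))) ∨
  (∃ u y v, w = u ++ y :: y :: v ∧ D.odd y = true ∧ m = 0) ∨
  (∃ u y, w = u ++ [y] ∧ D.hwt y ∧ m = D.chi y • τ u)

theorem Red.congr {τ τ' : List I → List I →₀ ℂ} {w : List I} {m : List I →₀ ℂ}
    (h : ∀ w', meas w' < meas w → τ w' = τ' w') (hr : D.Red τ w m) : D.Red τ' w m := by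
  rcases hr with ⟨u, y, x, v, rfl, hxy, rfl⟩ | ⟨u, y, v, rfl, hy, rfl⟩ | ⟨u, y, rfl, hy, rfl⟩
  · refine Or.inl ⟨u, y, x, v, rfl, hxy, ?_⟩
    rw [h _ (meas_swap u v hxy)]
    congr 1
    exact bsum_congr fun p _ => h _ (meas_lt_of_length (by simp))
  · exact Or.inr (Or.inl ⟨u, y, v, rfl, hy, rfl⟩)
  · exact Or.inr (Or.inr ⟨u, y, rfl, hy, by rw [h _ (meas_lt_of_length (by simp))]⟩)

open Classical in
/-- The normal form of a word applied to the highest weight vector. -/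
def sigma (w : List I) : List I →₀ ℂ :=
  -- An arbitrary reduction is chosen; `conf` shows later that the choice is immaterial. The value 0
  -- on words that are not smaller is never reached, since a reduction evaluates smaller words only
  -- (`Red.congr`).
  if h : ∃ m, D.Red (fun w' => if _ : meas w' < meas w then sigma w' else 0) w m then h.choose
  else Finsupp.single w 1
termination_by meas w
decreasing_by all_goals assumption

theorem sigma_red {w : List I} {m : List I →₀ ℂ} (h : D.Red D.sigma w m) :
    D.Red D.sigma w (D.sigma w) := by
  have hm : ∃ m, D.Red (fun w' => if _ : meas w' < meas w then D.sigma w' else 0) w m :=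
    ⟨m, h.congr D fun w' hw' => by simp [hw']⟩
  have e : D.sigma w = hm.choose := by rw [sigma, dif_pos hm]
  rw [e]
  exact hm.choose_spec.congr D fun w' hw' => by simp [hw']

theorem sigma_irred {w : List I} (h : ¬ ∃ m, D.Red D.sigma w m) :
    D.sigma w = Finsupp.single w 1 := by
  rw [sigma, dif_neg]
  rintro ⟨m, hm⟩
  exact h ⟨m, hm.congr D fun w' hw' => by simp [hw']⟩

/-- Scalar identities for structure constants pass to vector-valued functions coordinate by
coordinate. -/
theorem skew' {J : Type} (x y : I) (f : I → J →₀ ℂ) :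
    bsum (D.br x y) f = (-sgn (D.odd x) (D.odd y)) • bsum (D.br y x) f := by
  ext w
  simp only [bsum_apply, Finsupp.smul_apply, D.skew x y, smul_eq_mul]

theorem jacobi' {J : Type} (x y z : I) (f : I → J →₀ ℂ) :
    bsum (D.br y z) (fun w => bsum (D.br x w) f) =
    bsum (D.br x y) (fun w => bsum (D.br w z) f) +
      sgn (D.odd x) (D.odd y) • bsum (D.br x z) (fun w => bsum (D.br y w) f) := by
  ext w
  simp only [bsum_apply, Finsupp.smul_apply, Finsupp.add_apply, smul_eq_mul]
  exact D.jacobi x y z _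

theorem sgn_mul_self (a b : Bool) : sgn a b * sgn a b = 1 := by
  cases a <;> cases b <;> simp [sgn]

theorem sgn_comm (a b : Bool) : sgn a b = sgn b a := by
  cases a <;> cases b <;> simp [sgn]

theorem br_self_even {J : Type} {x : I} (hx : D.odd x = false) (f : I → J →₀ ℂ) :
    bsum (D.br x x) f = 0 := by
  have := D.skew' x x f
  simp only [hx, sgn, Bool.and_self, Bool.false_eq_true, if_false, neg_smul, one_smul] at this
  exact self_eq_neg.1 this

/-- The reductions of `w` are compatible with `sigma`. -/
def Conf (w : List I) : Prop := ∀ m, D.Red D.sigma w m → D.sigma w = m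

variable {D}

theorem Conf.swap {u v : List I} {x y : I} (h : D.Conf (u ++ y :: x :: v)) (hxy : x < y) :
    D.sigma (u ++ y :: x :: v) = sgn (D.odd y) (D.odd x) • D.sigma (u ++ x :: y :: v) +
      bsum (D.br y x) (fun z => D.sigma (u ++ z :: v)) :=
  h _ (Or.inl ⟨u, y, x, v, rfl, hxy, rfl⟩)

theorem Conf.sq {u v : List I} {y : I} (h : D.Conf (u ++ y :: y :: v)) (hy : D.odd y = true) :
    D.sigma (u ++ y :: y :: v) = 0 :=
  h _ (Or.inr (Or.inl ⟨u, y, v, rfl, hy, rfl⟩))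

theorem Conf.hw {u : List I} {y : I} (h : D.Conf (u ++ [y])) (hy : D.hwt y) :
    D.sigma (u ++ [y]) = D.chi y • D.sigma u :=
  h _ (Or.inr (Or.inr ⟨u, y, rfl, hy, rfl⟩))

/-- The swap rule freed from the condition `x < y`. In the opposite order, skew-symmetry turns the
rule around; for equal letters either the square rule applies or the self-bracket of an even letter
vanishes. -/
theorem Conf.exchange {u v : List I} {x y : I} (h : D.Conf (u ++ y :: x :: v))
    (h' : D.Conf (u ++ x :: y :: v)) :
    D.sigma (u ++ y :: x :: v) = sgn (D.odd y) (D.odd x) • D.sigma (u ++ x :: y :: v) +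
      bsum (D.br y x) (fun z => D.sigma (u ++ z :: v)) := by
  rcases lt_trichotomy x y with hxy | rfl | hxy
  · exact h.swap hxy
  · cases hx : D.odd x
    · rw [D.br_self_even hx]; simp [sgn]
    · rw [h.sq hx, D.br_self x hx]; simp
  · rw [h'.swap hxy, D.skew' y x, smul_add, smul_smul, sgn_comm (D.odd x), sgn_mul_self, one_smul]
    simp

/-- The relative positions of two redexes, hence the list of ambiguities: the same pair, a shared
letter, or disjoint pairs. -/
theorem List.two_split {α : Type*} {u u' v v' : List α} {x y x' y' : α}
    (h : u ++ y :: x :: v = u' ++ y' :: x' :: v') (hl : u.length ≤ u'.length) :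
    (u = u' ∧ y = y' ∧ x = x' ∧ v = v') ∨ (u' = u ++ [y] ∧ y' = x ∧ v = x' :: v') ∨
      ∃ a, u' = u ++ y :: x :: a ∧ v = a ++ y' :: x' :: v' := by
  rcases List.append_eq_append_iff.1 h with ⟨a, h1, h2⟩ | ⟨a, h1, h2⟩
  · match a with
    | [] => left; simp at h1 h2; simp_all
    | [p] => right; left; simp at h2; simp_all
    | p :: q :: a => right; right; exact ⟨a, by simp_all, by simp_all⟩
  · subst h1
    have : a = [] := by simpa using hl
    subst this; left; simp at h2; simp_all

end SuperData
end TopN2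
end

/-! ### Critical pairs with a shared letter. -/

noncomputable section

namespace TopN2
namespace SuperData

variable {I : Type} [LinearOrder I] {D : SuperData I}

theorem exchange_below {n : ℕ} (IH : ∀ w : List I, w.length < n → D.Conf w)
    (u : List I) (y x : I) (v : List I) (h : (u ++ y :: x :: v).length < n) :
    D.sigma (u ++ y :: x :: v) = sgn (D.odd y) (D.odd x) • D.sigma (u ++ x :: y :: v) +
      bsum (D.br y x) (fun z => D.sigma (u ++ z :: v)) :=
  (IH _ h).exchange (IH _ (by simpa using h))

/-- All terms of a bracket have the same parity, so a single sign comes out of the sum. The words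
involved are shorter than the bound, so the exchange is available in either order. -/
theorem exchange_bracket {n : ℕ} (IH : ∀ w : List I, w.length < n → D.Conf w)
    (u : List I) (z y x : I) (v : List I) (h : (u ++ y :: x :: v).length < n) :
    bsum (D.br y x) (fun t => D.sigma (u ++ z :: t :: v)) =
      sgn (D.odd z) (D.odd y ^^ D.odd x) •
        bsum (D.br y x) (fun t => D.sigma (u ++ t :: z :: v)) +
      bsum (D.br y x) (fun t => bsum (D.br z t) (fun s => D.sigma (u ++ s :: v))) := by
  rw [← bsum_smul, ← bsum_add]
  refine bsum_congr fun p hp => ?_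
  rw [exchange_below IH u z p.2 v (by simpa using h), D.odd_br y x p hp]

theorem bracket_exchange {n : ℕ} (IH : ∀ w : List I, w.length < n → D.Conf w)
    (u : List I) (z y x : I) (v : List I) (h : (u ++ y :: x :: v).length < n) :
    bsum (D.br z y) (fun t => D.sigma (u ++ t :: x :: v)) =
      sgn (D.odd z ^^ D.odd y) (D.odd x) •
        bsum (D.br z y) (fun t => D.sigma (u ++ x :: t :: v)) +
      bsum (D.br z y) (fun t => bsum (D.br t x) (fun s => D.sigma (u ++ s :: v))) := by
  rw [← bsum_smul, ← bsum_add]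
  refine bsum_congr fun p hp => ?_
  rw [exchange_below IH u p.2 x v (by simpa using h), D.odd_br z y p hp]

/-- Both sides are sorted down to the word with `x, y, z` in order. The double brackets left over
differ by the Jacobi identity. -/
theorem overlap_swap_swap {u v : List I} {x y z : I} (hyz : y < z) (hxy : x < y)
    (IH : ∀ w, meas w < meas (u ++ z :: y :: x :: v) → D.Conf w) :
    sgn (D.odd z) (D.odd y) • D.sigma (u ++ y :: z :: x :: v) +
      bsum (D.br z y) (fun t => D.sigma (u ++ t :: x :: v)) =
    sgn (D.odd y) (D.odd x) • D.sigma (u ++ z :: x :: y :: v) +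
      bsum (D.br y x) (fun t => D.sigma (u ++ z :: t :: v)) := by
  have IHl : ∀ w : List I, w.length < (u ++ z :: y :: x :: v).length → D.Conf w :=
    fun w hw => IH w (meas_lt_of_length hw)
  have hxz := hxy.trans hyz
  have m1 : meas (u ++ y :: z :: x :: v) < meas (u ++ z :: y :: x :: v) := meas_swap _ _ hyz
  have m2 : meas (u ++ y :: x :: z :: v) < meas (u ++ y :: z :: x :: v) := by
    simpa using meas_swap (u ++ [y]) v hxz
  have m3 : meas (u ++ z :: x :: y :: v) < meas (u ++ z :: y :: x :: v) := by
    simpa using meas_swap (u ++ [z]) v hxy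
  have m4 : meas (u ++ x :: z :: y :: v) < meas (u ++ z :: x :: y :: v) := meas_swap _ _ hxz
  have e1 := Conf.swap (u := u ++ [y]) (v := v) (x := x) (y := z)
    (by simpa using IH _ m1) hxz
  have e2 := (IH _ (m2.trans m1)).swap hxy
  have e3 := (IH _ m3).swap hxz
  have e4 := Conf.swap (u := u ++ [x]) (v := v) (x := y) (y := z)
    (by simpa using IH _ (m4.trans m3)) hyz
  have e5 := exchange_bracket IHl u z y x v (by simp)
  have e6 := exchange_bracket IHl u y z x v (by simp)
  have e7 := bracket_exchange IHl u z y x v (by simp)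
  have e8 := D.jacobi' z y x (fun s => D.sigma (u ++ s :: v))
  simp only [List.append_assoc, List.singleton_append] at e1 e4
  rw [e1, e2, e3, e4, e5, e6, e7, e8]
  cases D.odd x <;> cases D.odd y <;> cases D.odd z <;> simp [sgn] <;> abel

/-- Since [x, x] = 0, the Jacobi identity for `y, x, x` makes [[y, x], x] equal to its own negative,
so it vanishes in characteristic zero. -/
theorem overlap_swap_sq {u v : List I} {x y : I} (hxy : x < y) (hx : D.odd x = true)
    (IH : ∀ w, meas w < meas (u ++ y :: x :: x :: v) → D.Conf w) :
    sgn (D.odd y) (D.odd x) • D.sigma (u ++ x :: y :: x :: v) +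
      bsum (D.br y x) (fun t => D.sigma (u ++ t :: x :: v)) = 0 := by
  have IHl : ∀ w : List I, w.length < (u ++ y :: x :: x :: v).length → D.Conf w :=
    fun w hw => IH w (meas_lt_of_length hw)
  have m1 : meas (u ++ x :: y :: x :: v) < meas (u ++ y :: x :: x :: v) := meas_swap _ _ hxy
  have m2 : meas (u ++ x :: x :: y :: v) < meas (u ++ x :: y :: x :: v) := by
    simpa using meas_swap (u ++ [x]) v hxy
  have e1 := Conf.swap (u := u ++ [x]) (v := v) (x := x) (y := y)
    (by simpa using IH _ m1) hxy
  have e2 := (IH _ (m2.trans m1)).sq hx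
  have e3 := bracket_exchange IHl u y x x v (by simp)
  have e4 := D.jacobi' y x x (fun s => D.sigma (u ++ s :: v))
  simp only [List.append_assoc, List.singleton_append] at e1
  rw [D.br_self x hx, bsum_nil] at e4
  have e5 : bsum (D.br y x) (fun w => bsum (D.br x w) fun s => D.sigma (u ++ s :: v)) =
      (-sgn (D.odd x) (D.odd y ^^ D.odd x)) •
        bsum (D.br y x) (fun w => bsum (D.br w x) fun s => D.sigma (u ++ s :: v)) := by
    rw [← bsum_smul]
    refine bsum_congr fun p hp => ?_
    rw [D.skew' x p.2, D.odd_br _ _ p hp]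
  rw [e5] at e4
  rw [e1, e2, e3]
  generalize bsum (D.br y x) (fun w => bsum (D.br w x) fun s => D.sigma (u ++ s :: v)) = B at *
  generalize bsum (D.br y x) (fun t => D.sigma (u ++ x :: t :: v)) = A at *
  cases hy : D.odd y <;> simp [hx, hy, sgn] at e4 ⊢
  · exact self_eq_neg.1 (eq_neg_of_add_eq_zero_left e4.symm)
  · exact self_eq_neg.1 (eq_neg_of_add_eq_zero_left e4.symm)

theorem overlap_sq_swap {u v : List I} {x y : I} (hxy : x < y) (hy : D.odd y = true)
    (IH : ∀ w, meas w < meas (u ++ y :: y :: x :: v) → D.Conf w) :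
    sgn (D.odd y) (D.odd x) • D.sigma (u ++ y :: x :: y :: v) +
      bsum (D.br y x) (fun t => D.sigma (u ++ y :: t :: v)) = 0 := by
  have IHl : ∀ w : List I, w.length < (u ++ y :: y :: x :: v).length → D.Conf w :=
    fun w hw => IH w (meas_lt_of_length hw)
  have m1 : meas (u ++ y :: x :: y :: v) < meas (u ++ y :: y :: x :: v) := by
    simpa using meas_swap (u ++ [y]) v hxy
  have m2 : meas (u ++ x :: y :: y :: v) < meas (u ++ y :: x :: y :: v) := meas_swap _ _ hxy
  have e1 := (IH _ m1).swap hxy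
  have e2 : D.sigma (u ++ x :: y :: y :: v) = 0 := by
    have := Conf.sq (u := u ++ [x]) (v := v) (y := y) (by simpa using IH _ (m2.trans m1)) hy
    simpa using this
  have e3 := exchange_bracket IHl u y y x v (by simp)
  have e4 := D.jacobi' y y x (fun s => D.sigma (u ++ s :: v))
  rw [D.br_self y hy, bsum_nil] at e4
  rw [e1, e2, e3]
  generalize bsum (D.br y x) (fun w => bsum (D.br y w) fun s => D.sigma (u ++ s :: v)) = B at *
  cases hx : D.odd x <;> simp [hy, sgn] at e4 ⊢
  · exact self_eq_neg.1 e4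
  · exact self_eq_neg.1 e4

end SuperData
end TopN2
end

/-! ### Confluence, words in normal form and the induced module. -/

noncomputable section

namespace TopN2

theorem bsum_comm {I E : Type*} [AddCommGroup E] [Module ℂ E] (l l' : List (ℂ × I))
    (f : I → I → E) :
    bsum l (fun z => bsum l' (fun t => f z t)) = bsum l' (fun t => bsum l (fun z => f z t)) := by
  induction l with
  | nil => simp [bsum_zero]
  | cons p l ih => simp [bsum_add, bsum_smul, ih]

namespace SuperData

variable {I : Type} [LinearOrder I] {D : SuperData I}

/-- Reductions at disjoint places commute: after performing the other one, both sides are the same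
double expansion. -/
theorem disjoint_swap_swap {u a v : List I} {x y x' y' : I} (hxy : x < y) (hxy' : x' < y')
    (IH : ∀ w, meas w < meas (u ++ y :: x :: (a ++ y' :: x' :: v)) → D.Conf w) :
    sgn (D.odd y) (D.odd x) • D.sigma (u ++ x :: y :: (a ++ y' :: x' :: v)) +
      bsum (D.br y x) (fun z => D.sigma (u ++ z :: (a ++ y' :: x' :: v))) =
    sgn (D.odd y') (D.odd x') • D.sigma (u ++ y :: x :: (a ++ x' :: y' :: v)) +
      bsum (D.br y' x') (fun z => D.sigma (u ++ y :: x :: (a ++ z :: v))) := by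
  have IHl : ∀ w : List I, w.length < (u ++ y :: x :: (a ++ y' :: x' :: v)).length → D.Conf w :=
    fun w hw => IH w (meas_lt_of_length hw)
  have e1 := Conf.swap (u := u ++ x :: y :: a) (v := v)
    (by simpa using IH _ (meas_swap _ _ hxy)) hxy'
  have e2 : ∀ z, _ := fun z => exchange_below IHl (u ++ z :: a) y' x' v (by simp)
  have m3 : meas (u ++ y :: x :: (a ++ x' :: y' :: v)) <
      meas (u ++ y :: x :: (a ++ y' :: x' :: v)) := by
    simpa using meas_swap (u ++ y :: x :: a) v hxy'
  have e3 := (IH _ m3).swap hxy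
  have e4 : ∀ z, _ := fun z => exchange_below IHl u y x (a ++ z :: v) (by simp)
  simp only [List.append_assoc, List.cons_append] at e1 e2
  rw [e1, e3]
  simp only [e2, e4, bsum_add, bsum_smul, smul_add]
  rw [bsum_comm (D.br y x), smul_comm (sgn (D.odd y) (D.odd x))]
  abel

theorem swap_unique {u v u' v' : List I} {x y x' y' : I} (hxy : x < y) (hxy' : x' < y')
    (h : u ++ y :: x :: v = u' ++ y' :: x' :: v')
    (IH : ∀ w, meas w < meas (u ++ y :: x :: v) → D.Conf w)
    (hl : u.length ≤ u'.length) :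
    sgn (D.odd y) (D.odd x) • D.sigma (u ++ x :: y :: v) +
      bsum (D.br y x) (fun z => D.sigma (u ++ z :: v)) =
    sgn (D.odd y') (D.odd x') • D.sigma (u' ++ x' :: y' :: v') +
      bsum (D.br y' x') (fun z => D.sigma (u' ++ z :: v')) := by
  rcases List.two_split h hl with ⟨rfl, rfl, rfl, rfl⟩ | ⟨rfl, rfl, rfl⟩ | ⟨a, rfl, rfl⟩
  · rfl
  · simpa using overlap_swap_swap hxy hxy' IH
  · simpa using disjoint_swap_swap hxy hxy' IH

theorem swap_eq_sq {u v u' v' : List I} {x y y' : I} (hxy : x < y) (hy' : D.odd y' = true)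
    (h : u ++ y :: x :: v = u' ++ y' :: y' :: v')
    (IH : ∀ w, meas w < meas (u ++ y :: x :: v) → D.Conf w) :
    sgn (D.odd y) (D.odd x) • D.sigma (u ++ x :: y :: v) +
      bsum (D.br y x) (fun z => D.sigma (u ++ z :: v)) = 0 := by
  rcases le_total u.length u'.length with hl | hl
  · rcases List.two_split h hl with ⟨rfl, rfl, rfl, rfl⟩ | ⟨rfl, rfl, rfl⟩ | ⟨a, rfl, rfl⟩
    · exact absurd hxy (lt_irrefl _)
    · exact overlap_swap_sq hxy hy' IH
    · have e1 := Conf.sq (u := u ++ x :: y :: a) (v := v') (y := y')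
        (by simpa using IH _ (meas_swap _ _ hxy)) hy'
      have e2 : ∀ z, _ := fun z => Conf.sq (u := u ++ z :: a) (v := v') (y := y')
        (IH _ (meas_lt_of_length (by simp))) hy'
      simp only [List.append_assoc, List.cons_append] at e1 e2
      simp [e1, e2, bsum_zero]
  · rcases List.two_split h.symm hl with ⟨rfl, rfl, rfl, rfl⟩ | ⟨rfl, rfl, rfl⟩ | ⟨a, rfl, rfl⟩
    · exact absurd hxy (lt_irrefl _)
    · simpa using overlap_sq_swap hxy hy' (by simpa using IH)
    · have m1 : meas (u' ++ y' :: y' :: (a ++ x :: y :: v)) <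
        meas (u' ++ y' :: y' :: a ++ y :: x :: v) := by
        simpa using meas_swap (u' ++ y' :: y' :: a) v hxy
      have e1 := (IH _ m1).sq hy'
      have e2 : ∀ z, _ := fun z => Conf.sq (u := u') (v := a ++ z :: v) (y := y')
        (IH _ (meas_lt_of_length (by simp))) hy'
      simp [e1, e2, bsum_zero]

theorem swap_eq_hw {u v u' : List I} {x y y' : I} (hxy : x < y) (hy' : D.hwt y')
    (h : u ++ y :: x :: v = u' ++ [y'])
    (IH : ∀ w, meas w < meas (u ++ y :: x :: v) → D.Conf w) :
    sgn (D.odd y) (D.odd x) • D.sigma (u ++ x :: y :: v) +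
      bsum (D.br y x) (fun z => D.sigma (u ++ z :: v)) = D.chi y' • D.sigma u' := by
  have IHl : ∀ w : List I, w.length < (u ++ y :: x :: v).length → D.Conf w :=
    fun w hw => IH w (meas_lt_of_length hw)
  rcases List.eq_nil_or_concat v with rfl | ⟨a, t, rfl⟩
  · have h1 : u ++ [y] ++ [x] = u' ++ [y'] := by simpa using h
    obtain ⟨rfl, h2⟩ := List.append_inj' h1 rfl
    obtain rfl : x = y' := by simpa using h2
    -- The subalgebra is spanned by a final segment, so both letters act on the highest weight line
    -- by the character. The character kills brackets and odd letters, so the order of the two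
    -- letters does not matter.
    have hy : D.hwt y := D.hwt_mono _ _ hy' hxy.le
    have e1 := Conf.hw (u := u ++ [x]) (y := y)
      (by simpa using IH _ (meas_swap _ _ hxy)) hy
    have e2 := Conf.hw (u := u) (y := x) (IHl _ (by simp)) hy'
    have e3 := Conf.hw (u := u) (y := y) (IHl _ (by simp)) hy
    have e4 : bsum (D.br y x) (fun z => D.sigma (u ++ [z])) = 0 := by
      rw [bsum_congr (g := fun z => D.chi z • D.sigma u), bsum_smul_right, D.chi_br y x hy hy',
        zero_smul]
      exact fun p hp => Conf.hw (IHl _ (by simp)) (D.hwt_br y x hy hy' p hp)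
    simp only [List.append_assoc, List.singleton_append] at e1
    rw [e1, e2, e3, e4]
    cases ho : D.odd x
    · simp [sgn, smul_smul, mul_comm]
    · simp [D.chi_odd x hy' ho]
  · simp only [List.concat_eq_append] at *
    have h1 : u ++ y :: x :: a ++ [t] = u' ++ [y'] := by simpa using h
    obtain ⟨rfl, h2⟩ := List.append_inj' h1 rfl
    obtain rfl : t = y' := by simpa using h2
    have e1 := Conf.hw (u := u ++ x :: y :: a) (y := t)
      (by simpa using IH _ (meas_swap _ _ hxy)) hy'
    have e2 : ∀ z, _ := fun z => Conf.hw (u := u ++ z :: a) (y := t) (IHl _ (by simp)) hy'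
    have e3 := (IHl (u ++ y :: x :: a) (by simp)).swap hxy
    simp only [List.append_assoc, List.cons_append] at e1 e2
    rw [e1, e3]
    simp only [e2, bsum_smul, smul_add, smul_comm (D.chi t)]

theorem sq_eq_hw {u v u' : List I} {y y' : I} (hy : D.odd y = true) (hy' : D.hwt y')
    (h : u ++ y :: y :: v = u' ++ [y'])
    (IH : ∀ w, meas w < meas (u ++ y :: y :: v) → D.Conf w) :
    D.chi y' • D.sigma u' = 0 := by
  have IHl : ∀ w : List I, w.length < (u ++ y :: y :: v).length → D.Conf w :=
    fun w hw => IH w (meas_lt_of_length hw)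
  rcases List.eq_nil_or_concat v with rfl | ⟨a, t, rfl⟩
  · have h1 : u ++ [y] ++ [y] = u' ++ [y'] := by simpa using h
    obtain ⟨rfl, h2⟩ := List.append_inj' h1 rfl
    obtain rfl : y = y' := by simpa using h2
    simp [D.chi_odd y hy' hy]
  · simp only [List.concat_eq_append] at *
    have h1 : u ++ y :: y :: a ++ [t] = u' ++ [y'] := by simpa using h
    obtain ⟨rfl, h2⟩ := List.append_inj' h1 rfl
    have := (IHl (u ++ y :: y :: a) (by simp)).sq hy
    simp [this]

variable (D)

theorem meas_induction {P : List I → Prop} (h : ∀ w, (∀ w', meas w' < meas w → P w') → P w)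
    (w : List I) : P w :=
  (InvImage.wf meas (wellFounded_lt (α := ℕ ×ₗ ℕ))).induction w h

/-- The diamond lemma. The value of `sigma` is itself given by some reduction, so it is enough that
any two reductions of the same word agree, given confluence for all smaller words. -/
theorem conf (w : List I) : D.Conf w := by
  induction w using meas_induction with
  | h w IH =>
    suffices h : ∀ m m', D.Red D.sigma w m → D.Red D.sigma w m' → m = m' from
      fun m hm => h _ _ (D.sigma_red hm) hm
    rintro m m' (⟨u, y, x, v, rfl, hxy, rfl⟩ | ⟨u, y, v, rfl, hy, rfl⟩ | ⟨u, y, rfl, hy, rfl⟩)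
      (⟨u', y', x', v', h', hxy', rfl⟩ | ⟨u', y', v', h', hy', rfl⟩ | ⟨u', y', h', hy', rfl⟩)
    · rcases le_total u.length u'.length with hl | hl
      · exact swap_unique hxy hxy' h' IH hl
      · exact (swap_unique hxy' hxy h'.symm (by rwa [h'] at IH) hl).symm
    · exact swap_eq_sq hxy hy' h' IH
    · exact swap_eq_hw hxy hy' h' IH
    · exact (swap_eq_sq hxy' hy h'.symm (by rwa [h'] at IH)).symm
    · rfl
    · exact (sq_eq_hw hy hy' h' IH).symm
    · exact (swap_eq_hw hxy' hy h'.symm (by rwa [h'] at IH)).symm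
    · exact sq_eq_hw hy' hy h'.symm (by rwa [h'] at IH)
    · obtain ⟨rfl, h2⟩ := List.append_inj' h' rfl
      obtain rfl : y = y' := by simpa using h2
      rfl

theorem sigma_exchange (u v : List I) (y x : I) :
    D.sigma (u ++ y :: x :: v) = sgn (D.odd y) (D.odd x) • D.sigma (u ++ x :: y :: v) +
      bsum (D.br y x) (fun z => D.sigma (u ++ z :: v)) :=
  (D.conf _).exchange (D.conf _)

theorem sigma_exchange_cons (v : List I) (y x : I) :
    D.sigma (y :: x :: v) = sgn (D.odd y) (D.odd x) • D.sigma (x :: y :: v) +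
      bsum (D.br y x) (fun z => D.sigma (z :: v)) :=
  D.sigma_exchange [] v y x

theorem sigma_sq (u v : List I) (y : I) (hy : D.odd y = true) :
    D.sigma (u ++ y :: y :: v) = 0 := (D.conf _).sq hy

theorem sigma_hw (u : List I) (y : I) (hy : D.hwt y) :
    D.sigma (u ++ [y]) = D.chi y • D.sigma u := (D.conf _).hw hy

/-- The words in normal form. -/
structure Good (w : List I) : Prop where
  sorted : w.Pairwise (· ≤ ·)
  nodup : ∀ x ∈ w, D.odd x = true → w.count x ≤ 1
  lower : ∀ x ∈ w, ¬ D.hwt x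

variable {D}

theorem Good.irred {w : List I} (hw : D.Good w) : ¬ ∃ m, D.Red D.sigma w m := by
  rintro ⟨m, ⟨u, y, x, v, rfl, hxy, rfl⟩ | ⟨u, y, v, rfl, hy, rfl⟩ | ⟨u, y, rfl, hy, rfl⟩⟩
  · have := hw.sorted
    rw [List.pairwise_append] at this
    exact hxy.not_ge ((List.pairwise_cons.1 this.2.1).1 x (by simp))
  · have := hw.nodup y (by simp) hy
    simp at this; omega
  · exact hw.lower y (by simp) hy

theorem Good.sigma {w : List I} (hw : D.Good w) : D.sigma w = Finsupp.single w 1 :=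
  D.sigma_irred hw.irred

theorem Good.sublist {w w' : List I} (hw : D.Good w) (h : w'.Sublist w) : D.Good w' where
  sorted := hw.sorted.sublist h
  nodup x hx ho := (h.count_le x).trans (hw.nodup x (h.subset hx) ho)
  lower x hx := hw.lower x (h.subset hx)

theorem Good.eq_of_perm {w w' : List I} (hw : D.Good w) (hw' : D.Good w') (h : w.Perm w') :
    w = w' :=
  h.eq_of_pairwise (fun _ _ _ _ => le_antisymm) hw.sorted hw'.sorted

variable (D)

theorem good_nil : D.Good [] := ⟨by simp, by simp, by simp⟩

theorem good_or_red (w : List I) : D.Good w ∨ ∃ m, D.Red D.sigma w m := by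
  by_cases h : ∃ m, D.Red D.sigma w m
  · exact Or.inr h
  left
  have hs : w.Pairwise (· ≤ ·) := by
    rw [← List.isChain_iff_pairwise]
    by_contra hc
    rw [List.isChain_iff_forall_rel_of_append_cons_cons] at hc
    push Not at hc
    obtain ⟨y, x, u, v, rfl, hxy⟩ := hc
    exact h ⟨_, Or.inl ⟨u, y, x, v, rfl, hxy, rfl⟩⟩
  refine ⟨hs, fun x hx ho => ?_, fun x hx hh => ?_⟩
  · by_contra hc
    push Not at hc
    have h2 : [x, x].Sublist w := by
      have := List.replicate_sublist_iff.2 (show 2 ≤ w.count x from hc)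
      simpa [List.replicate] using this
    obtain ⟨r₁, r₂, rfl, h3, h4⟩ := List.cons_sublist_iff.1 h2
    obtain ⟨u, a, rfl⟩ := List.append_of_mem h3
    have h5 : x ∈ r₂ := by simpa using h4
    obtain ⟨b, v, rfl⟩ := List.append_of_mem h5
    have e : u ++ x :: a ++ (b ++ x :: v) = u ++ x :: ((a ++ b) ++ x :: v) := by simp
    rw [e] at hs h
    -- In a sorted word, everything between two occurrences of `x` equals `x`; a repeated odd letter
    -- therefore occurs as an adjacent square, which is reducible.
    have h6 : ∀ z ∈ a ++ b, z = x := by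
      intro z hz
      have h7 := (List.pairwise_append.1 hs).2.1
      rw [List.pairwise_cons, List.pairwise_append] at h7
      exact le_antisymm (h7.2.2.2 z hz x (by simp)) (h7.1 z (by simp at hz ⊢; tauto))
    rcases hab : a ++ b with _ | ⟨z, l⟩
    · rw [hab] at h
      exact h ⟨_, Or.inr (Or.inl ⟨u, x, v, rfl, ho, rfl⟩)⟩
    · obtain rfl := h6 z (by simp [hab])
      rw [hab] at h
      exact h ⟨_, Or.inr (Or.inl ⟨u, z, l ++ z :: v, by simp, ho, rfl⟩)⟩
  · obtain ⟨u, v, rfl⟩ := List.append_of_mem hx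
    rcases List.eq_nil_or_concat v with rfl | ⟨a, t, rfl⟩
    · exact h ⟨_, Or.inr (Or.inr ⟨u, x, rfl, hh, rfl⟩)⟩
    · refine h ⟨_, Or.inr (Or.inr ⟨u ++ x :: a, t, by simp, ?_, rfl⟩)⟩
      refine D.hwt_mono _ _ hh ?_
      have h7 := (List.pairwise_append.1 hs).2.1
      exact (List.pairwise_cons.1 h7).1 t (by simp)

/-- Induction principle for properties of normal forms. -/
theorem sigma_induction {P : List I → (List I →₀ ℂ) → Prop}
    (good : ∀ w, D.Good w → P w (Finsupp.single w 1))
    (swap : ∀ u y x v, P (u ++ x :: y :: v) (D.sigma (u ++ x :: y :: v)) →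
      (∀ z, P (u ++ z :: v) (D.sigma (u ++ z :: v))) → P (u ++ y :: x :: v)
        (sgn (D.odd y) (D.odd x) • D.sigma (u ++ x :: y :: v) +
      bsum (D.br y x) (fun z => D.sigma (u ++ z :: v))))
    (sq : ∀ u y v, D.odd y = true → P (u ++ y :: y :: v) 0)
    (hw : ∀ u y, D.hwt y → P u (D.sigma u) → P (u ++ [y]) (D.chi y • D.sigma u))
    (w : List I) : P w (D.sigma w) := by
  induction w using meas_induction with
  | h w IH =>
    rcases D.good_or_red w with hg | ⟨m, hm⟩
    · rw [hg.sigma]; exact good w hg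
    · rw [D.conf w m hm]
      rcases hm with ⟨u, y, x, v, rfl, hxy, rfl⟩ | ⟨u, y, v, rfl, hy, rfl⟩ | ⟨u, y, rfl, hy, rfl⟩
      · exact swap u y x v (IH _ (meas_swap _ _ hxy))
          fun z => IH _ (meas_lt_of_length (by simp))
      · exact sq u y v hy
      · exact hw u y hy (IH _ (meas_lt_of_length (by simp)))

/-- The action of a basis element of the superalgebra on the induced module. -/
def T (x : I) : (List I →₀ ℂ) →ₗ[ℂ] (List I →₀ ℂ) :=
  Finsupp.linearCombination ℂ fun w => D.sigma (x :: w)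

@[simp] theorem T_single (x : I) (w : List I) : D.T x (Finsupp.single w 1) = D.sigma (x :: w) := by
  simp [T]

-- A reduction of `w` is also a reduction of `x :: w`, so left multiplication by a letter descends
-- to normal forms. The supercommutation relations of the operators `T` follow from this.
@[simp] theorem T_sigma (x : I) (w : List I) : D.T x (D.sigma w) = D.sigma (x :: w) := by
  refine D.sigma_induction (P := fun w m => D.T x m = D.sigma (x :: w)) ?_ ?_ ?_ ?_ w
  · intro w _
    exact D.T_single x w
  · intro u y z v h1 h2
    rw [map_add, map_smul, h1, map_bsum]
    simp only [h2]
    exact (D.sigma_exchange (x :: u) v y z).symm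
  · intro u y v hy
    rw [map_zero]
    exact (D.sigma_sq (x :: u) v y hy).symm
  · intro u y hy h
    rw [map_smul, h]
    exact (D.sigma_hw (x :: u) y hy).symm

theorem T_comm (y x : I) (m : List I →₀ ℂ) :
    D.T y (D.T x m) = sgn (D.odd y) (D.odd x) • D.T x (D.T y m) +
      bsum (D.br y x) (fun z => D.T z m) := by
  induction m using Finsupp.induction_linear with
  | zero => simp [bsum_zero]
  | add f g hf hg => simp only [map_add, hf, hg, smul_add, bsum_add]; abel
  | single w a =>
    rw [← mul_one a, ← smul_eq_mul, ← Finsupp.smul_single]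
    simp only [map_smul, T_single, T_sigma, bsum_smul, ← smul_add,
      smul_comm (sgn (D.odd y) (D.odd x))]
    rw [D.sigma_exchange_cons]

/-- The span of the words in normal form. -/
def normal : Submodule ℂ (List I →₀ ℂ) := Finsupp.supported ℂ ℂ {w | D.Good w}

theorem bsum_mem {E J : Type*} [AddCommGroup E] [Module ℂ E] (S : Submodule ℂ E)
    (l : List (ℂ × J)) (f : J → E) (h : ∀ z, f z ∈ S) : bsum l f ∈ S := by
  induction l with
  | nil => simp
  | cons p l ih => exact S.add_mem (S.smul_mem _ (h _)) ih

theorem sigma_mem_normal (w : List I) : D.sigma w ∈ D.normal := by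
  refine D.sigma_induction (P := fun w m => m ∈ D.normal) ?_ ?_ ?_ ?_ w
  · exact fun w hw => Finsupp.single_mem_supported _ _ hw
  · exact fun u y x v h1 h2 => Submodule.add_mem _ (Submodule.smul_mem _ _ h1)
      (bsum_mem _ _ _ h2)
  · exact fun _ _ _ _ => Submodule.zero_mem _
  · exact fun u y _ h => Submodule.smul_mem _ _ h

theorem T_mem_normal (x : I) (m : List I →₀ ℂ) : D.T x m ∈ D.normal := by
  rw [T, Finsupp.linearCombination_apply, Finsupp.sum]
  exact Submodule.sum_mem _ fun w _ => Submodule.smul_mem _ _ (D.sigma_mem_normal _)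

end SuperData
end TopN2
end

/-! ### The associated graded algebra of a filtration by degree. -/

noncomputable section

namespace TopN2
namespace SuperData

variable {I : Type} [LinearOrder I] (D : SuperData I) {deg : I → ℕ}
  (hdeg : ∀ x y, ∀ p ∈ D.br x y, deg p.2 ≤ deg x + deg y)

/-- Degrees can only drop in a bracket. A term of a double bracket has the full degree only if no
degree was lost in either step, so truncating twice amounts to truncating once at the end. -/
theorem bsum_graded_left (x y z : I) (f : I → ℂ)
    (hdeg : ∀ x y, ∀ p ∈ D.br x y, deg p.2 ≤ deg x + deg y) :
    bsum ((D.br y z).filter fun p => deg p.2 = deg y + deg z)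
      (fun w => bsum ((D.br x w).filter fun p => deg p.2 = deg x + deg w) f) =
    bsum (D.br y z) (fun w => bsum (D.br x w)
      fun s => if deg s = deg x + deg y + deg z then f s else 0) := by
  rw [bsum_filter _ (fun s => deg s = deg y + deg z)]
  refine bsum_congr fun p hp => ?_
  rw [bsum_filter _ (fun s => deg s = deg x + deg p.2)]
  have h1 := hdeg y z p hp
  split_ifs with h
  · simp only [h, add_assoc]
  · rw [bsum_congr (g := fun _ => (0 : ℂ)), bsum_zero]
    intro s hs
    have h2 := hdeg _ _ s hs
    rw [if_neg]
    omega

theorem bsum_graded_right (x y z : I) (f : I → ℂ)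
    (hdeg : ∀ x y, ∀ p ∈ D.br x y, deg p.2 ≤ deg x + deg y) :
    bsum ((D.br x y).filter fun p => deg p.2 = deg x + deg y)
      (fun w => bsum ((D.br w z).filter fun p => deg p.2 = deg w + deg z) f) =
    bsum (D.br x y) (fun w => bsum (D.br w z)
      fun s => if deg s = deg x + deg y + deg z then f s else 0) := by
  rw [bsum_filter _ (fun s => deg s = deg x + deg y)]
  refine bsum_congr fun p hp => ?_
  rw [bsum_filter _ (fun s => deg s = deg p.2 + deg z)]
  have h1 := hdeg x y p hp
  split_ifs with h
  · simp only [h]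
  · rw [bsum_congr (g := fun _ => (0 : ℂ)), bsum_zero]
    intro s hs
    have h2 := hdeg _ _ s hs
    rw [if_neg]
    omega

/-- The associated graded structure constants of a filtered Lie superalgebra. -/
def gr : SuperData I where
  odd := D.odd
  br x y := (D.br x y).filter fun p => deg p.2 = deg x + deg y
  hwt := D.hwt
  chi x := if deg x = 0 then D.chi x else 0
  odd_br x y p hp := D.odd_br x y p (List.mem_of_mem_filter hp)
  br_self x hx := by simp [D.br_self x hx]
  skew x y f := by
    rw [bsum_filter _ (fun s => deg s = deg x + deg y), D.skew,
      bsum_filter _ (fun s => deg s = deg y + deg x), add_comm (deg x)]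
  jacobi x y z f := by
    rw [D.bsum_graded_left _ _ _ _ hdeg, D.bsum_graded_right _ _ _ _ hdeg,
      D.bsum_graded_left _ _ _ _ hdeg, D.jacobi x y z, add_comm (deg y) (deg x)]
  hwt_mono := D.hwt_mono
  hwt_br x y hx hy p hp := D.hwt_br x y hx hy p (List.mem_of_mem_filter hp)
  chi_br x y hx hy := by
    rw [bsum_filter _ (fun s => deg s = deg x + deg y)]
    by_cases h : deg x + deg y = 0
    · rw [← D.chi_br x y hx hy]
      refine bsum_congr fun p hp => ?_
      have := hdeg x y p hp
      have h0 : deg p.2 = 0 := by omega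
      simp [h, h0]
    · rw [bsum_congr (g := fun _ => (0 : ℂ)), bsum_zero]
      intro p hp
      split_ifs <;> first | rfl | omega
  chi_odd x hx ho := by simp [D.chi_odd x hx ho]

variable {D}

theorem Good.gr {w : List I} (hw : D.Good w) : (D.gr hdeg).Good w :=
  ⟨hw.sorted, hw.nodup, hw.lower⟩

variable (D)

/-- Reduction never raises the degree, and the part of top degree reduces by the graded rules. The
two claims are proved together because a lower term of the bracket must be seen not to contribute in
top degree. -/
theorem gr_sigma_apply (w : List I) :
    (∀ g, (w.map deg).sum < (g.map deg).sum → D.sigma w g = 0) ∧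
      ∀ g, (D.gr hdeg).sigma w g = if (g.map deg).sum = (w.map deg).sum then D.sigma w g else 0 := by
  refine D.sigma_induction (P := fun w m => (∀ g, (w.map deg).sum < (g.map deg).sum → m g = 0) ∧
      ∀ g, (D.gr hdeg).sigma w g = if (g.map deg).sum = (w.map deg).sum then m g else 0)
      ?_ ?_ ?_ ?_ w
  · intro w hw
    refine ⟨fun g hg => ?_, fun g => ?_⟩
    · rw [Finsupp.single_apply, if_neg]
      rintro rfl
      exact hg.false
    · rw [(hw.gr hdeg).sigma, Finsupp.single_apply]
      split_ifs with h1 h2 h2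
      · rfl
      · subst h1; exact absurd rfl h2
      · rfl
      · rfl
  · intro u y x v h1 h2
    have e : ((u ++ x :: y :: v).map deg).sum = ((u ++ y :: x :: v).map deg).sum := by
      simp; omega
    have e' : ∀ z, ((u ++ z :: v).map deg).sum + deg y + deg x =
        ((u ++ y :: x :: v).map deg).sum + deg z := by
      intro z; simp; omega
    rw [e] at h1
    generalize ((u ++ y :: x :: v).map deg).sum = d at *
    refine ⟨fun g hg => ?_, fun g => ?_⟩
    · rw [Finsupp.add_apply, Finsupp.smul_apply, h1.1 g hg, bsum_apply,
        bsum_congr (g := fun _ => (0 : ℂ)), bsum_zero]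
      · simp
      · intro p hp
        refine (h2 p.2).1 g ?_
        have := hdeg y x p hp
        have := e' p.2
        omega
    · rw [sigma_exchange, Finsupp.add_apply, Finsupp.add_apply, Finsupp.smul_apply,
        Finsupp.smul_apply, h1.2 g, bsum_apply, bsum_apply]
      change _ + bsum ((D.br y x).filter fun p => deg p.2 = deg y + deg x) _ = _
      rw [bsum_filter _ (fun s => deg s = deg y + deg x)]
      have e3 : bsum (D.br y x) (fun z => if deg z = deg y + deg x then
            (D.gr hdeg).sigma (u ++ z :: v) g else 0) =
          if (g.map deg).sum = d then bsum (D.br y x) (fun z => D.sigma (u ++ z :: v) g) else 0 := by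
        rw [show (if (g.map deg).sum = d then bsum (D.br y x) (fun z => D.sigma (u ++ z :: v) g)
            else 0) = bsum (D.br y x) (fun z => if (g.map deg).sum = d then
              D.sigma (u ++ z :: v) g else 0) by split_ifs <;> simp [bsum_zero]]
        refine bsum_congr fun p hp => ?_
        have := hdeg y x p hp
        have := e' p.2
        rw [(h2 p.2).2 g]
        split_ifs with h3 h4 h5 h5 h6
        · rfl
        · omega
        · omega
        · rfl
        · rw [(h2 p.2).1]; omega
        · rfl
      rw [e3]
      split_ifs
      · rfl
      · simp
  · intro u y v hy
    rw [(D.gr hdeg).sigma_sq u v y hy]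
    simp
  · intro u y hy h
    have e' : ((u ++ [y]).map deg).sum = (u.map deg).sum + deg y := by simp
    rw [e']
    refine ⟨fun g hg => ?_, fun g => ?_⟩
    · rw [Finsupp.smul_apply, h.1 g (by omega), smul_zero]
    · rw [(D.gr hdeg).sigma_hw u y hy, Finsupp.smul_apply, Finsupp.smul_apply, h.2 g]
      change (if deg y = 0 then D.chi y else 0) • _ = _
      by_cases hd : deg y = 0
      · simp [hd]
      · by_cases hg : (g.map deg).sum = (u.map deg).sum + deg y
        · rw [h.1 g (by omega)]; simp [hd]
        · simp [hd, hg]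

/-- The leading term of `D.T x φ` is determined by the leading term of `φ`. -/
theorem gr_T_filter (x : I) (φ : List I →₀ ℂ) (d : ℕ)
    (hφ : ∀ w ∈ φ.support, (w.map deg).sum ≤ d) :
    (D.gr hdeg).T x (φ.filter fun w => (w.map deg).sum = d) =
      (D.T x φ).filter fun w => (w.map deg).sum = deg x + d := by
  ext g
  have hs : (φ.filter fun w => (w.map deg).sum = d).support ⊆ φ.support := by
    intro w hw
    simp only [Finsupp.mem_support_iff, Finsupp.filter_apply] at hw ⊢
    exact fun h => hw (by simp [h])
  rw [Finsupp.filter_apply, T, T, Finsupp.linearCombination_apply, Finsupp.linearCombination_apply,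
    Finsupp.sum_of_support_subset _ hs _ (by simp), Finsupp.sum, Finsupp.finsetSum_apply,
    Finsupp.finsetSum_apply]
  have key : ∀ w ∈ φ.support, ((φ.filter fun w => (w.map deg).sum = d) w •
      (D.gr hdeg).sigma (x :: w)) g =
      if (g.map deg).sum = deg x + d then (φ w • D.sigma (x :: w)) g else 0 := by
    intro w hw
    have h1 := hφ w hw
    have h2 := D.gr_sigma_apply hdeg (x :: w)
    have h3 : ((x :: w).map deg).sum = deg x + (w.map deg).sum := by simp
    rw [h3] at h2
    rw [Finsupp.smul_apply, Finsupp.smul_apply, h2.2 g, Finsupp.filter_apply]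
    by_cases hw' : (w.map deg).sum = d
    · simp [hw']
    · by_cases hg : (g.map deg).sum = deg x + d
      · rw [h2.1 g (by omega)]; simp [hw', hg]
      · simp [hw', hg]
  rw [Finset.sum_congr rfl key]
  split_ifs
  · rfl
  · simp

end SuperData
end TopN2
end

/-! ### The topological N = 2 algebra as structure constants. -/

noncomputable section

namespace TopN2

namespace Gen

/-- The position of a basis element in the ordering which underlies the standard bases. The
elements of the subalgebra fixing the highest weight line are those in the classes `8` to `12`. -/
def key : Gen → ℕ ×ₗ ℤ
  | .L m => if m ≤ -2 then toLex (0, m) else if m = -1 then toLex (4, 0) else toLex (8, m)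
  | .H m => if m ≤ -1 then toLex (1, m) else toLex (9, m)
  | .G m => if m ≤ -2 then toLex (2, m) else if m = -1 then toLex (5, 0) else toLex (10, m)
  | .Q m => if m ≤ -2 then toLex (3, m) else if m = -1 then toLex (6, 0) else
      if m = 0 then toLex (7, 0) else toLex (11, m)
  | .C => toLex (12, 0)

theorem key_injective : Function.Injective key := by
  intro x y h
  cases x <;> cases y <;> simp only [key] at h <;>
    (try split_ifs at h) <;> simp_all

instance : LinearOrder Gen := LinearOrder.lift' key key_injective

theorem le_iff {x y : Gen} : x ≤ y ↔ key x ≤ key y := Iff.rfl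

/-- The parity of a basis element. -/
def odd : Gen → Bool
  | .G _ => true
  | .Q _ => true
  | _ => false

/-- The basis elements of the subalgebra fixing the highest weight line, where `G` stands for the
field whose zero mode annihilates the highest weight vector. -/
def hwt : Gen → Prop
  | .L m => 0 ≤ m
  | .H m => 0 ≤ m
  | .G m => 0 ≤ m
  | .Q m => 1 ≤ m
  | .C => True

theorem hwt_iff (x : Gen) : x.hwt ↔ toLex (8, 0) ≤ key x := by
  cases x <;> simp only [key, hwt] <;> (try split_ifs) <;> simp [Prod.Lex.toLex_le_toLex] <;> omega

/-- The character through which the subalgebra acts on the highest weight line. -/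
def chi (Δ q c : ℂ) : Gen → ℂ
  | .L m => if m = 0 then Δ else 0
  | .H m => if m = 0 then q else 0
  | .C => c
  | _ => 0

end Gen

namespace Kind

/-- The charge of the field annihilating the highest weight vector. -/
def sg : Kind → ℂ
  | .G => 1
  | .Q => -1

/-- The conformal weight, minus one, of the field annihilating the highest weight vector. -/
def wt : Kind → ℂ
  | .G => 1
  | .Q => 0

/-- The brackets of the basis elements, where `G` stands for `t.closed` and `Q` for `t.other`. -/
def br (t : Kind) : Gen → Gen → List (ℂ × Gen)
  | .L m, .L n => [((m : ℂ) - n, .L (m + n))]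
  | .L m, .H n => [(-(n : ℂ), .H (m + n)), (if m + n = 0 then ((m : ℂ) ^ 2 + m) / 6 else 0, .C)]
  | .H m, .L n => [((m : ℂ), .H (m + n)), (if m + n = 0 then -((n : ℂ) ^ 2 + n) / 6 else 0, .C)]
  | .L m, .G n => [(t.wt * m - n, .G (m + n))]
  | .G m, .L n => [(m - t.wt * n, .G (m + n))]
  | .L m, .Q n => [((1 - t.wt) * m - n, .Q (m + n))]
  | .Q m, .L n => [(m - (1 - t.wt) * n, .Q (m + n))]
  | .H m, .H n => [(if m + n = 0 then (m : ℂ) / 3 else 0, .C)]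
  | .H m, .G n => [(t.sg, .G (m + n))]
  | .G m, .H n => [(-t.sg, .G (m + n))]
  | .H m, .Q n => [(-t.sg, .Q (m + n))]
  | .Q m, .H n => [(t.sg, .Q (m + n))]
  | .G m, .Q n => [(2, .L (m + n)), (-2 * (t.wt * n + (1 - t.wt) * m), .H (m + n)),
      (if m + n = 0 then ((m : ℂ) ^ 2 + t.sg * m) / 3 else 0, .C)]
  | .Q n, .G m => [(2, .L (m + n)), (-2 * (t.wt * n + (1 - t.wt) * m), .H (m + n)),
      (if m + n = 0 then ((m : ℂ) ^ 2 + t.sg * m) / 3 else 0, .C)]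
  | .G _, .G _ => []
  | .Q _, .Q _ => []
  | .C, _ => []
  | _, .C => []

theorem br_skew (t : Kind) (x y : Gen) (f : Gen → ℂ) :
    bsum (t.br x y) f = -sgn x.odd y.odd * bsum (t.br y x) f := by
  cases x with
  | C => cases y <;> simp [br]
  | L m | H m | G m | Q m =>
    cases y with
    | C => simp [br]
    | L n | H n | G n | Q n =>
      simp only [br, bsum_cons, bsum_nil, sgn, Gen.odd, smul_eq_mul, add_comm n m, Bool.and_self,
        Bool.and_false, Bool.false_and, Bool.false_eq_true, if_false, if_true]
      try split_ifs with h
      all_goals try ring1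
      all_goals
        have hn : (n : ℂ) = -m := by
          rw [eq_neg_iff_add_eq_zero, add_comm]; exact_mod_cast h
        rw [hn]; ring

set_option maxHeartbeats 1000000 in
-- Away from the central components this is a polynomial identity in the modes. The central
-- components are the cocycle condition, supported on modes with sum zero, where `k` can be
-- eliminated.
theorem br_jacobi (t : Kind) (x y z : Gen) (f : Gen → ℂ) :
    bsum (t.br y z) (fun w => bsum (t.br x w) f) =
    bsum (t.br x y) (fun w => bsum (t.br w z) f) +
      sgn x.odd y.odd * bsum (t.br x z) (fun w => bsum (t.br y w) f) := by
  cases x with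
  | C => cases y <;> cases z <;> simp [br]
  | L m | H m | G m | Q m =>
    cases y with
    | C => cases z <;> simp [br]
    | L n | H n | G n | Q n =>
      cases z with
      | C => simp [br]
      | L k | H k | G k | Q k =>
        simp only [br, bsum_cons, bsum_nil, sgn, Gen.odd, smul_eq_mul, Int.add_comm, Int.add_left_comm,
          Bool.and_self, Bool.and_false, Bool.false_and, Bool.false_eq_true, if_false, if_true,
          mul_zero, add_zero, zero_add]
        all_goals cases t <;> (try simp only [Kind.sg, Kind.wt, Int.cast_add]) <;> try ring1
        all_goals
          split_ifs with h
          · have hk : (k : ℂ) = -m - n := by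
              have : ((m + (n + k) : ℤ) : ℂ) = 0 := by
                rw [show m + (n + k) = 0 by omega]; simp
              push_cast at this; linear_combination this
            try rw [hk]
            ring1
          · ring1

/-- The Lie superalgebra with the data defining the Verma module. -/
def data (t : Kind) (Δ q c : ℂ) : SuperData Gen where
  odd := Gen.odd
  br := t.br
  hwt := Gen.hwt
  chi := Gen.chi Δ q c
  odd_br x y p hp := by
    cases x <;> cases y <;> simp only [br, List.mem_cons, List.not_mem_nil, or_false] at hp <;>
      first
      | exact hp.elim
      | (rcases hp with rfl | rfl | rfl <;> rfl)
  br_self x hx := by cases x <;> simp_all [br, Gen.odd]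
  skew := t.br_skew
  jacobi := t.br_jacobi
  hwt_mono x y hx h := by
    rw [Gen.hwt_iff] at hx ⊢
    exact hx.trans h
  hwt_br x y hx hy p hp := by
    cases x <;> cases y <;> simp only [br, List.mem_cons, List.not_mem_nil, or_false] at hp <;>
      simp only [Gen.hwt] at hx hy <;>
      first
      | exact hp.elim
      | (rcases hp with rfl | rfl | rfl <;> simp only [Gen.hwt] <;> omega)
  chi_br x y hx hy := by
    cases x <;> cases y <;> simp only [br, bsum_cons, bsum_nil, Gen.chi, Gen.hwt] at hx hy ⊢ <;>
      (try split_ifs) <;> simp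
    all_goals
      rename_i m n h
      first
      | (exfalso; omega)
      | (obtain rfl : m = 0 := by omega
         obtain rfl : n = 0 := by omega
         simp)
  chi_odd x _ ho := by cases x <;> simp_all [Gen.odd, Gen.chi]

end Kind
end TopN2
end

/-! ### The enveloping algebra acting on words. -/

noncomputable section

namespace TopN2

theorem bsum_eq_linearCombination {I E : Type*} [AddCommGroup E] [Module ℂ E] (l : List (ℂ × I))
    (f : I → E) : bsum l f =
      Finsupp.linearCombination ℂ f (bsum l fun z => Finsupp.single z 1) := by
  rw [map_bsum]
  simp

theorem SuperData.skew_module {I E : Type} [LinearOrder I] [AddCommGroup E] [Module ℂ E]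
    (D : SuperData I) (x y : I) (f : I → E) :
    bsum (D.br x y) f = (-sgn (D.odd x) (D.odd y)) • bsum (D.br y x) f := by
  rw [bsum_eq_linearCombination, D.skew', map_smul, ← bsum_eq_linearCombination]

namespace Kind

variable (t : Kind) (Δ q c : ℂ)

/-- The exchange of the two fermionic fields for Verma modules on `Q₀`-closed vectors. -/
def relabel : Kind → Gen → Gen
  | .Q, .G m => .Q m
  | .Q, .Q m => .G m
  | _, x => x

/-- The basis element of the superalgebra, where `G` stands for `t.closed` and `Q` for
`t.other`. -/
def gn (x : Gen) : U := gen (t.relabel x)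

theorem gn_L (m : ℤ) : t.gn (.L m) = TopN2.L m := by cases t <;> rfl
theorem gn_H (m : ℤ) : t.gn (.H m) = TopN2.H m := by cases t <;> rfl
theorem gn_G (m : ℤ) : t.gn (.G m) = t.closed m := by cases t <;> rfl
theorem gn_Q (m : ℤ) : t.gn (.Q m) = t.other m := by cases t <;> rfl
theorem gn_C : t.gn .C = TopN2.C := by cases t <;> rfl

theorem relabel_relabel (x : Gen) : t.relabel (t.relabel x) = x := by
  cases t <;> cases x <;> rfl

theorem data_odd : (t.data Δ q c).odd = Gen.odd := rfl
theorem data_br : (t.data Δ q c).br = t.br := rfl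
theorem data_chi : (t.data Δ q c).chi = Gen.chi Δ q c := rfl

/-- The underlying vector space of the induced module. -/
abbrev Words : Type := List Gen →₀ ℂ

theorem lift_T_rel {a b : Free} (h : Rel a b) :
    FreeAlgebra.lift ℂ (fun x => (t.data Δ q c).T (t.relabel x)) a =
      FreeAlgebra.lift ℂ (fun x => (t.data Δ q c).T (t.relabel x)) b := by
  have key : ∀ (y x : Gen) (v : Words), _ := (t.data Δ q c).T_comm
  refine LinearMap.ext fun v => ?_
  cases h with
  | central x =>
    simp only [Free.C, map_mul, FreeAlgebra.lift_ι_apply, Module.End.mul_apply]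
    rw [key]
    cases t <;> cases x <;> simp [relabel, data_odd, data_br, br, sgn, Gen.odd]
  | LL m n | HH m n | LG m n | HG m n | LQ m n | HQ m n | LH m n | GQ m n | GG m n | QQ m n =>
    simp only [Free.L, Free.H, Free.G, Free.Q, Free.C, map_sub, map_add, map_mul, map_smul,
      map_neg, map_zero, FreeAlgebra.lift_ι_apply, LinearMap.sub_apply, LinearMap.add_apply,
      Module.End.mul_apply, LinearMap.smul_apply, LinearMap.neg_apply, LinearMap.zero_apply]
    rw [key]
    cases t <;> simp [relabel, data_odd, data_br, br, sgn, Gen.odd, Kind.sg, Kind.wt]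
    all_goals
      try rw [Int.add_comm n m]
      split_ifs with h
      · have hn : (n : ℂ) = -m := by
          rw [eq_neg_iff_add_eq_zero, add_comm]; exact_mod_cast h
        rw [hn]; module
      · module

/-- The representation of the enveloping algebra on the induced module. -/
def rho : U →ₐ[ℂ] Module.End ℂ Words :=
  RingQuot.liftAlgHom ℂ ⟨FreeAlgebra.lift ℂ fun x => (t.data Δ q c).T (t.relabel x),
    fun _ _ h => t.lift_T_rel Δ q c h⟩

theorem rho_gn (x : Gen) : t.rho Δ q c (t.gn x) = (t.data Δ q c).T x := by
  simp [rho, gn, gen, relabel_relabel]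

end Kind
end TopN2
end

/-! ### The Verma module identified with its model on words. -/

noncomputable section

namespace TopN2

namespace Kind

section CommRel

variable {A : Type} [Ring A] [Algebra ℂ A] (t : Kind)

/-- The relation for the product of the images of two basis elements in an algebra. -/
def CommRel (f : Gen → A) (y x : Gen) : Prop :=
  f y * f x = sgn y.odd x.odd • (f x * f y) + bsum (t.br y x) f

variable {t}

theorem CommRel.symm {f : Gen → A} {y x : Gen} (h : t.CommRel f y x) : t.CommRel f x y := by
  have hs := (t.data 0 0 0).skew_module x y f
  simp only [data_odd, data_br] at hs
  rw [CommRel] at h ⊢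
  rw [h, hs, smul_add, smul_smul, SuperData.sgn_comm, SuperData.sgn_mul_self]
  simp

theorem CommRel.sq {f : Gen → A} {y : Gen} (h : t.CommRel f y y) (hy : y.odd = true) :
    f y * f y = 0 := by
  rw [CommRel, show t.br y y = [] from (t.data 0 0 0).br_self y hy] at h
  simp only [sgn, hy, Bool.and_self, if_true, neg_smul, one_smul, bsum_nil, add_zero] at h
  have h2 : (2 : ℂ) • (f y * f y) = 0 := by
    rw [two_smul]
    nth_rw 1 [h]
    simp
  simpa using h2

/-- The relations give each pair of families in one order only; the other order comes from
`CommRel.symm`. For the kind `.Q` the two fermionic fields trade places, so each relation is used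
for the opposite field. -/
theorem commRel_of_hom (t : Kind) (φ : Free →ₐ[ℂ] A) (hφ : ∀ a b, Rel a b → φ a = φ b) (y x : Gen) :
    t.CommRel (fun x => φ (FreeAlgebra.ι ℂ (t.relabel x))) y x := by
  have hC : ∀ x, t.CommRel (fun x => φ (FreeAlgebra.ι ℂ (t.relabel x))) .C x := by
    intro x
    have := hφ _ _ (Rel.central (t.relabel x))
    simp only [Free.C, map_mul] at this
    cases t <;> cases x <;> simp_all [CommRel, br, sgn, Gen.odd, relabel]
  have h1 : ∀ m n, t.CommRel (fun x => φ (FreeAlgebra.ι ℂ (t.relabel x))) (.L m) (.L n) := fun m n => by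
    simpa [CommRel, br, sgn, Gen.odd, relabel, Free.L, Free.H, Free.G, Free.Q, Free.C, sg, wt,
        sub_eq_iff_eq_add', add_eq_zero_iff_eq_neg, apply_ite φ]
        using hφ _ _ (Rel.LL m n)
  have h2 : ∀ m n, t.CommRel (fun x => φ (FreeAlgebra.ι ℂ (t.relabel x))) (.L m) (.H n) := fun m n => by
    simpa [CommRel, br, sgn, Gen.odd, relabel, Free.L, Free.H, Free.G, Free.Q, Free.C, sg, wt,
        sub_eq_iff_eq_add', add_eq_zero_iff_eq_neg, apply_ite φ]
        using hφ _ _ (Rel.LH m n)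
  have h3 : ∀ m n, t.CommRel (fun x => φ (FreeAlgebra.ι ℂ (t.relabel x))) (.H m) (.H n) := fun m n => by
    simpa [CommRel, br, sgn, Gen.odd, relabel, Free.L, Free.H, Free.G, Free.Q, Free.C, sg, wt,
        sub_eq_iff_eq_add', add_eq_zero_iff_eq_neg, apply_ite φ]
        using hφ _ _ (Rel.HH m n)
  have h4 : ∀ m n, t.CommRel (fun x => φ (FreeAlgebra.ι ℂ (t.relabel x))) (.L m) (.G n) := fun m n => by
    cases t
    · simpa [CommRel, br, sgn, Gen.odd, relabel, Free.L, Free.H, Free.G, Free.Q, Free.C, sg, wt,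
        sub_eq_iff_eq_add', add_eq_zero_iff_eq_neg, apply_ite φ]
        using hφ _ _ (Rel.LG m n)
    · simpa [CommRel, br, sgn, Gen.odd, relabel, Free.L, Free.H, Free.G, Free.Q, Free.C, sg, wt,
        sub_eq_iff_eq_add', add_eq_zero_iff_eq_neg, apply_ite φ]
        using hφ _ _ (Rel.LQ m n)
  have h5 : ∀ m n, t.CommRel (fun x => φ (FreeAlgebra.ι ℂ (t.relabel x))) (.L m) (.Q n) := fun m n => by
    cases t
    · simpa [CommRel, br, sgn, Gen.odd, relabel, Free.L, Free.H, Free.G, Free.Q, Free.C, sg, wt,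
        sub_eq_iff_eq_add', add_eq_zero_iff_eq_neg, apply_ite φ]
        using hφ _ _ (Rel.LQ m n)
    · simpa [CommRel, br, sgn, Gen.odd, relabel, Free.L, Free.H, Free.G, Free.Q, Free.C, sg, wt,
        sub_eq_iff_eq_add', add_eq_zero_iff_eq_neg, apply_ite φ]
        using hφ _ _ (Rel.LG m n)
  have h6 : ∀ m n, t.CommRel (fun x => φ (FreeAlgebra.ι ℂ (t.relabel x))) (.H m) (.G n) := fun m n => by
    cases t
    · simpa [CommRel, br, sgn, Gen.odd, relabel, Free.L, Free.H, Free.G, Free.Q, Free.C, sg, wt,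
        sub_eq_iff_eq_add', add_eq_zero_iff_eq_neg, apply_ite φ]
        using hφ _ _ (Rel.HG m n)
    · simpa [CommRel, br, sgn, Gen.odd, relabel, Free.L, Free.H, Free.G, Free.Q, Free.C, sg, wt,
        sub_eq_iff_eq_add', add_eq_zero_iff_eq_neg, apply_ite φ]
        using hφ _ _ (Rel.HQ m n)
  have h7 : ∀ m n, t.CommRel (fun x => φ (FreeAlgebra.ι ℂ (t.relabel x))) (.H m) (.Q n) := fun m n => by
    cases t
    · simpa [CommRel, br, sgn, Gen.odd, relabel, Free.L, Free.H, Free.G, Free.Q, Free.C, sg, wt,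
        sub_eq_iff_eq_add', add_eq_zero_iff_eq_neg, apply_ite φ]
        using hφ _ _ (Rel.HQ m n)
    · simpa [CommRel, br, sgn, Gen.odd, relabel, Free.L, Free.H, Free.G, Free.Q, Free.C, sg, wt,
        sub_eq_iff_eq_add', add_eq_zero_iff_eq_neg, apply_ite φ]
        using hφ _ _ (Rel.HG m n)
  have h8 : ∀ m n, t.CommRel (fun x => φ (FreeAlgebra.ι ℂ (t.relabel x))) (.G m) (.G n) := fun m n => by
    cases t
    · simpa [CommRel, br, sgn, Gen.odd, relabel, Free.L, Free.H, Free.G, Free.Q, Free.C, sg, wt,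
        sub_eq_iff_eq_add', add_eq_zero_iff_eq_neg, apply_ite φ]
        using hφ _ _ (Rel.GG m n)
    · simpa [CommRel, br, sgn, Gen.odd, relabel, Free.L, Free.H, Free.G, Free.Q, Free.C, sg, wt,
        sub_eq_iff_eq_add', add_eq_zero_iff_eq_neg, apply_ite φ]
        using hφ _ _ (Rel.QQ m n)
  have h9 : ∀ m n, t.CommRel (fun x => φ (FreeAlgebra.ι ℂ (t.relabel x))) (.Q m) (.Q n) := fun m n => by
    cases t
    · simpa [CommRel, br, sgn, Gen.odd, relabel, Free.L, Free.H, Free.G, Free.Q, Free.C, sg, wt,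
        sub_eq_iff_eq_add', add_eq_zero_iff_eq_neg, apply_ite φ]
        using hφ _ _ (Rel.QQ m n)
    · simpa [CommRel, br, sgn, Gen.odd, relabel, Free.L, Free.H, Free.G, Free.Q, Free.C, sg, wt,
        sub_eq_iff_eq_add', add_eq_zero_iff_eq_neg, apply_ite φ]
        using hφ _ _ (Rel.GG m n)
  have h10 : ∀ m n, t.CommRel (fun x => φ (FreeAlgebra.ι ℂ (t.relabel x))) (.G m) (.Q n) := fun m n => by
    have e1 := hφ _ _ (Rel.GQ m n)
    have e2 := hφ _ _ (Rel.GQ n m)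
    simp only [map_add, map_mul, map_sub, map_smul] at e1 e2
    replace e1 := eq_sub_of_add_eq e1
    replace e2 := eq_sub_of_add_eq e2
    cases t
    · simp only [CommRel, relabel, br, bsum_cons, bsum_nil, sgn, Gen.odd, sg, wt]
      refine e1.trans ?_
      simp only [Free.L, Free.H, Free.G, Free.Q, Free.C, Bool.and_self, if_true,
        one_mul]
      module
    · refine CommRel.symm ?_
      simp only [CommRel, relabel, br, bsum_cons, bsum_nil, sgn, Gen.odd, sg, wt]
      refine e2.trans ?_
      simp only [Free.L, Free.H, Free.G, Free.Q, Free.C, Bool.and_self, if_true, Int.add_comm n m]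
      split_ifs with h
      · have hn : (n : ℂ) = -m := by
          rw [eq_neg_iff_add_eq_zero, add_comm]; exact_mod_cast h
        rw [hn]; module
      · module
  cases y with
  | C => exact hC _
  | L m =>
    cases x with
    | C => exact (hC _).symm
    | L n => exact h1 m n
    | H n => exact h2 m n
    | G n => exact h4 m n
    | Q n => exact h5 m n
  | H m =>
    cases x with
    | C => exact (hC _).symm
    | L n => exact (h2 n m).symm
    | H n => exact h3 m n
    | G n => exact h6 m n
    | Q n => exact h7 m n
  | G m =>
    cases x with
    | C => exact (hC _).symm
    | L n => exact (h4 n m).symm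
    | H n => exact (h6 n m).symm
    | G n => exact h8 m n
    | Q n => exact h10 m n
  | Q m =>
    cases x with
    | C => exact (hC _).symm
    | L n => exact (h5 n m).symm
    | H n => exact (h7 n m).symm
    | G n => exact (h10 n m).symm
    | Q n => exact h9 m n

end CommRel

variable (t : Kind) (Δ q c : ℂ)

theorem commRel (y x : Gen) : t.CommRel t.gn y x :=
  t.commRel_of_hom (RingQuot.mkAlgHom ℂ Rel) (fun _ _ h => RingQuot.mkAlgHom_rel ℂ h) y x

theorem gn_smul_hw {x : Gen} (hx : x.hwt) :
    t.gn x • hw t Δ q c = Gen.chi Δ q c x • hw t Δ q c := by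
  have key : ∀ (u : U) (a : ℂ), u - algebraMap ℂ U a ∈ hwIdeal t Δ q c →
      u • hw t Δ q c = a • hw t Δ q c := by
    intro u a h
    rw [hw, ← Submodule.Quotient.mk_smul, ← Submodule.Quotient.mk_smul,
      Submodule.Quotient.eq]
    simpa [Algebra.algebraMap_eq_smul_one] using h
  have hpos : ∀ u ∈ positive, u • hw t Δ q c = (0 : ℂ) • hw t Δ q c := fun u hu =>
    key u 0 (by rw [map_zero, sub_zero]; exact Submodule.subset_span (Set.mem_union_left _ hu))
  cases x with
  | L m =>
    rw [gn_L]
    rcases (show 0 ≤ m from hx).eq_or_lt with rfl | hm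
    · exact key _ _ (Submodule.subset_span (by simp [Gen.chi]))
    · simpa [Gen.chi, hm.ne'] using hpos (L m) ⟨m, hm, by simp⟩
  | H m =>
    rw [gn_H]
    rcases (show 0 ≤ m from hx).eq_or_lt with rfl | hm
    · exact key _ _ (Submodule.subset_span (by simp [Gen.chi]))
    · simpa [Gen.chi, hm.ne'] using hpos (H m) ⟨m, hm, by simp⟩
  | G m =>
    rw [gn_G]
    rcases (show 0 ≤ m from hx).eq_or_lt with rfl | hm
    · exact key _ _ (Submodule.subset_span (by simp [Gen.chi]))
    · exact hpos (t.closed m) ⟨m, hm, by cases t <;> simp [closed]⟩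
  | Q m =>
    rw [gn_Q]
    have hm : 1 ≤ m := hx
    exact hpos (t.other m) ⟨m, by omega, by cases t <;> simp [other]⟩
  | C =>
    rw [gn_C]
    exact key _ _ (Submodule.subset_span (by simp [Gen.chi]))

/-- The monomial in the enveloping algebra given by a word. -/
def mono (w : List Gen) : U := (w.map t.gn).prod

theorem mono_append (u v : List Gen) : t.mono (u ++ v) = t.mono u * t.mono v := by
  simp [mono]

theorem mono_cons (x : Gen) (v : List Gen) : t.mono (x :: v) = t.gn x * t.mono v := by
  simp [mono]

/-- The evaluation of formal linear combinations of words in the Verma module. -/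
def eval : Words →ₗ[ℂ] Verma t Δ q c :=
  Finsupp.linearCombination ℂ fun w => t.mono w • hw t Δ q c

/-- Each rewriting rule is an identity in the Verma module, so passing to the normal form does not
change the vector. -/
theorem eval_sigma (w : List Gen) :
    t.eval Δ q c ((t.data Δ q c).sigma w) = t.mono w • hw t Δ q c := by
  refine (t.data Δ q c).sigma_induction
    (P := fun w m => t.eval Δ q c m = t.mono w • hw t Δ q c) ?_ ?_ ?_ ?_ w
  · intro w _
    simp [eval]
  · intro u y x v h1 h2
    rw [map_add, map_smul, map_bsum, h1]
    simp only [h2]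
    have e := t.commRel y x
    rw [CommRel] at e
    have e2 : bsum ((t.data Δ q c).br y x) (fun z => t.mono (u ++ z :: v) • hw t Δ q c) =
        (t.mono u * bsum (t.br y x) t.gn * t.mono v) • hw t Δ q c := by
      have e3 := map_bsum ((LinearMap.toSpanSingleton U (Verma t Δ q c) (hw t Δ q c)).restrictScalars
        ℂ ∘ₗ LinearMap.mulRight ℂ (t.mono v) ∘ₗ LinearMap.mulLeft ℂ (t.mono u)) (t.br y x) t.gn
      simpa [mono_append, mono_cons, mul_assoc, data_br] using e3.symm
    rw [e2, mono_append, mono_append, mono_cons, mono_cons, mono_cons, mono_cons,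
      ← mul_assoc (t.gn y), e, ← smul_assoc, ← add_smul]
    congr 1
    simp [data_odd, mul_add, add_mul, mul_assoc]
  · intro u y v hy
    have e0 := (t.commRel y y).sq hy
    rw [map_zero, mono_append, mono_cons, mono_cons, ← mul_assoc (t.gn y), e0]
    simp
  · intro u y hy h
    rw [map_smul, h, mono_append, mul_smul, mono_cons, data_chi]
    simp only [mono, List.map_nil, List.prod_nil, mul_one]
    rw [t.gn_smul_hw Δ q c hy, smul_comm]

theorem eval_rho (u : U) (m : Words) :
    t.eval Δ q c (t.rho Δ q c u m) = u • t.eval Δ q c m := by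
  have hgn : ∀ x m, t.eval Δ q c ((t.data Δ q c).T x m) = t.gn x • t.eval Δ q c m := by
    intro x m
    induction m using Finsupp.induction_linear with
    | zero => simp
    | add f g hf hg => simp [hf, hg]
    | single w a =>
      rw [← mul_one a, ← smul_eq_mul, ← Finsupp.smul_single, map_smul, map_smul, map_smul,
        SuperData.T_single, eval_sigma, mono_cons, mul_smul, smul_comm (t.gn x) a]
      simp [eval]
  obtain ⟨a, rfl⟩ := RingQuot.mkAlgHom_surjective ℂ Rel u
  induction a using FreeAlgebra.induction generalizing m with
  | grade0 r => simp [Algebra.algebraMap_eq_smul_one]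
  | grade1 x =>
    have : RingQuot.mkAlgHom ℂ Rel (FreeAlgebra.ι ℂ x) = t.gn (t.relabel x) := by
      rw [gn, relabel_relabel]; rfl
    rw [this, rho_gn, hgn]
  | mul a b ha hb => simp [ha, hb, mul_smul]
  | add a b ha hb => simp [ha, hb, add_smul]

/-- The map from the Verma module to its model on words in normal form. -/
def toWords : Verma t Δ q c →ₗ[ℂ] Words :=
  ((hwIdeal t Δ q c).restrictScalars ℂ).liftQ
    ((LinearMap.applyₗ (Finsupp.single [] 1)).comp (t.rho Δ q c).toLinearMap) (by
      intro u hu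
      simp only [Submodule.restrictScalars_mem] at hu
      simp only [LinearMap.mem_ker, LinearMap.comp_apply, LinearMap.applyₗ_apply_apply,
        AlgHom.toLinearMap_apply]
      induction hu using Submodule.span_induction with
      | zero => simp
      | add x y _ _ hx hy => simp [hx, hy]
      | smul a x _ hx => simp [hx]
      | mem x hx =>
        -- The empty word satisfies the highest weight conditions by the rule for a final letter of
        -- the subalgebra, so the generators of the left ideal act on it by zero.
        have key : ∀ x : Gen, x.hwt → t.rho Δ q c (t.gn x) (Finsupp.single [] 1) =
            Gen.chi Δ q c x • Finsupp.single [] 1 := by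
          intro x hx
          rw [rho_gn, SuperData.T_single]
          have := (t.data Δ q c).sigma_hw [] x hx
          rwa [((t.data Δ q c).good_nil).sigma] at this
        rcases hx with ⟨k, hk, rfl | rfl | rfl | rfl⟩ | hx
        · simpa [gn_L, Gen.chi, hk.ne'] using key (.L k) hk.le
        · simpa [gn_H, Gen.chi, hk.ne'] using key (.H k) hk.le
        · cases t
          · exact (key (.G k) hk.le).trans (zero_smul _ _)
          · exact (key (.Q k) hk).trans (zero_smul _ _)
        · cases t
          · exact (key (.Q k) hk).trans (zero_smul _ _)
          · exact (key (.G k) hk.le).trans (zero_smul _ _)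
        · simp only [Set.mem_insert_iff, Set.mem_singleton_iff] at hx
          rcases hx with rfl | rfl | rfl | rfl
          · have := key (.L 0) le_rfl
            rw [gn_L] at this
            simp [this, Gen.chi, Algebra.algebraMap_eq_smul_one]
          · have := key (.H 0) le_rfl
            rw [gn_H] at this
            simp [this, Gen.chi, Algebra.algebraMap_eq_smul_one]
          · have := key .C trivial
            rw [gn_C] at this
            simp [this, Gen.chi, Algebra.algebraMap_eq_smul_one]
          · have := key (.G 0) le_rfl
            rw [gn_G] at this
            simp [this, Gen.chi]) ∘ₗ
    (Submodule.Quotient.restrictScalarsEquiv ℂ (hwIdeal t Δ q c)).symm.toLinearMap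

theorem toWords_mk (u : U) : t.toWords Δ q c (Submodule.Quotient.mk u) =
    t.rho Δ q c u (Finsupp.single [] 1) := rfl

theorem toWords_smul (u : U) (v : Verma t Δ q c) :
    t.toWords Δ q c (u • v) = t.rho Δ q c u (t.toWords Δ q c v) := by
  obtain ⟨a, rfl⟩ := Submodule.Quotient.mk_surjective _ v
  rw [← Submodule.Quotient.mk_smul, toWords_mk, toWords_mk]
  simp

theorem toWords_mono (w : List Gen) :
    t.toWords Δ q c (t.mono w • hw t Δ q c) = (t.data Δ q c).sigma w := by
  induction w with
  | nil =>
    rw [((t.data Δ q c).good_nil).sigma, toWords_smul, hw, toWords_mk]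
    simp [mono]
  | cons x w ih => rw [mono_cons, mul_smul, toWords_smul, ih, rho_gn, SuperData.T_sigma]

/-- This makes `toWords` injective. Together with `toWords_mono`, which sends the monomial of a
normal word to that word, it gives the basis theorem. -/
theorem eval_toWords (v : Verma t Δ q c) : t.eval Δ q c (t.toWords Δ q c v) = v := by
  obtain ⟨a, rfl⟩ := Submodule.Quotient.mk_surjective _ v
  rw [toWords_mk, eval_rho]
  have : t.eval Δ q c (Finsupp.single [] 1) = hw t Δ q c := by simp [eval, mono]
  rw [this, hw, ← Submodule.Quotient.mk_smul]
  simp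

theorem toWords_mem_normal (v : Verma t Δ q c) :
    t.toWords Δ q c v ∈ (t.data Δ q c).normal := by
  suffices h : ∀ m : Words, t.toWords Δ q c (t.eval Δ q c m) ∈ (t.data Δ q c).normal by
    rw [← t.eval_toWords Δ q c v]; exact h _
  intro m
  rw [eval, Finsupp.linearCombination_apply, Finsupp.sum, map_sum]
  refine Submodule.sum_mem _ fun w _ => ?_
  rw [map_smul, toWords_mono]
  exact Submodule.smul_mem _ _ (SuperData.sigma_mem_normal _ _)

end Kind
end TopN2
end

/-! ### Standard basis labels and words in normal form. -/

noncomputable section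

namespace TopN2

namespace Gen

/-- The class of a basis element in the ordering. -/
def cls (x : Gen) : ℕ := (ofLex (key x)).1

theorem lt_of_cls_lt {x y : Gen} (h : x.cls < y.cls) : x < y :=
  lt_of_not_ge fun hyx => by
    have h2 : key y ≤ key x := hyx
    rw [Prod.Lex.le_iff] at h2
    rcases h2 with h2 | h2
    · exact absurd (h.trans h2) (lt_irrefl _)
    · exact h.ne h2.1.symm

theorem cls_le_of_le {x y : Gen} (h : x ≤ y) : x.cls ≤ y.cls :=
  le_of_not_gt fun hyx => (lt_of_cls_lt hyx).not_ge h

theorem hwt_iff_cls (x : Gen) : x.hwt ↔ 8 ≤ x.cls := by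
  cases x <;> simp only [cls, key, hwt] <;> (try split_ifs) <;> simp <;> omega

end Gen

/-- The words in normal form, for the ordering of the basis defined above. -/
abbrev Good (w : List Gen) : Prop := (Kind.G.data 0 0 0).Good w

theorem good_iff (t : Kind) (Δ q c : ℂ) (w : List Gen) : (t.data Δ q c).Good w ↔ Good w :=
  ⟨fun h => ⟨h.sorted, h.nodup, h.lower⟩, fun h => ⟨h.sorted, h.nodup, h.lower⟩⟩

theorem Good.append {u v : List Gen} (hu : Good u) (hv : Good v) (n : ℕ)
    (h1 : ∀ x ∈ u, x.cls < n) (h2 : ∀ x ∈ v, n ≤ x.cls) : Good (u ++ v) where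
  sorted := List.pairwise_append.2 ⟨hu.sorted, hv.sorted, fun x hx y hy =>
    (Gen.lt_of_cls_lt ((h1 x hx).trans_le (h2 y hy))).le⟩
  nodup x hx ho := by
    rw [List.count_append]
    by_cases h : x ∈ u
    · have : x ∉ v := fun h' => (h1 x h).not_ge (h2 x h')
      rw [List.count_eq_zero_of_not_mem this]
      exact hu.nodup x h ho
    · rw [List.count_eq_zero_of_not_mem h, zero_add]
      exact hv.nodup x ((List.mem_append.1 hx).resolve_left h) ho
  lower x hx := (List.mem_append.1 hx).elim (hu.lower x) (hv.lower x)

/-- The part of a word consisting of the elements of a given class. -/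
def clsPart (n : ℕ) (w : List Gen) : List Gen := w.filter fun x => x.cls = n

theorem Good.part {w : List Gen} (hw : Good w) (n : ℕ) : Good (clsPart n w) :=
  hw.sublist List.filter_sublist

theorem mem_clsPart {n : ℕ} {w : List Gen} {x : Gen} : x ∈ clsPart n w ↔ x ∈ w ∧ x.cls = n := by
  simp [clsPart]

/-- The concatenation of eight words. -/
def concat8 (p : ℕ → List Gen) : List Gen :=
  p 0 ++ (p 1 ++ (p 2 ++ (p 3 ++ (p 4 ++ (p 5 ++ (p 6 ++ p 7))))))

theorem part_concat8 (p : ℕ → List Gen) (hp : ∀ n, ∀ x ∈ p n, x.cls = n) (n : ℕ) (hn : n < 8) :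
    clsPart n (concat8 p) = p n := by
  have h1 : ∀ k, clsPart n (p k) = if k = n then p k else [] := by
    intro k
    split_ifs with h
    · exact List.filter_eq_self.2 fun x hx => by simp [hp k x hx, h]
    · exact List.filter_eq_nil_iff.2 fun x hx => by simp [hp k x hx, h]
  have h2 : ∀ u v : List Gen, clsPart n (u ++ v) = clsPart n u ++ clsPart n v := fun u v => by simp [clsPart]
  simp only [concat8, h2, h1]
  interval_cases n <;> simp

theorem good_concat8 (p : ℕ → List Gen) (hp : ∀ n, ∀ x ∈ p n, x.cls = n)
    (hg : ∀ n < 8, Good (p n)) : Good (concat8 p) := by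
  have h : ∀ n (v : List Gen), n < 8 → (Good v ∧ ∀ x ∈ v, n + 1 ≤ x.cls) →
      Good (p n ++ v) ∧ ∀ x ∈ p n ++ v, n ≤ x.cls := by
    rintro n v hn ⟨h1, h2⟩
    refine ⟨(hg n hn).append h1 (n + 1) (fun x hx => by rw [hp n x hx]; omega) h2, ?_⟩
    intro x hx
    rcases List.mem_append.1 hx with hx | hx
    · exact (hp n x hx).ge
    · exact (Nat.le_succ n).trans (h2 x hx)
  exact (h 0 _ (by omega) <| h 1 _ (by omega) <| h 2 _ (by omega) <| h 3 _ (by omega) <|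
    h 4 _ (by omega) <| h 5 _ (by omega) <| h 6 _ (by omega)
      ⟨hg 7 (by omega), fun x hx => (hp 7 x hx).ge⟩).1

/-- Both sides are sorted and have the same letters with multiplicity, and a sorted word is
determined by its letters. -/
theorem Good.eq_concat8 {w : List Gen} (hw : Good w) : w = concat8 fun n => clsPart n w := by
  refine hw.eq_of_perm (good_concat8 _ (fun n x hx => (mem_clsPart.1 hx).2) fun n _ => hw.part n) ?_
  have hlt : ∀ x ∈ w, x.cls < 8 := fun x hx => by
    have := hw.lower x hx
    rw [show (Kind.G.data 0 0 0).hwt = Gen.hwt from rfl, Gen.hwt_iff_cls] at this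
    omega
  rw [List.perm_iff_count]
  intro a
  have hc : ∀ n, (clsPart n w).count a = if a.cls = n then w.count a else 0 := by
    intro n
    split_ifs with h
    · rw [clsPart, List.count_filter (by simpa using h)]
    · exact List.count_eq_zero_of_not_mem fun h' => h (mem_clsPart.1 h').2
  simp only [concat8, List.count_append, hc]
  by_cases ha : a ∈ w
  · have := hlt a ha
    generalize a.cls = n at *
    interval_cases n <;> simp
  · simp [List.count_eq_zero_of_not_mem ha]

namespace StdTerm

/-- The blocks of a label. -/
def block (X : StdTerm) : ℕ → List Gen
  | 0 => X.l.map fun j : ℕ => .L (-(j : ℤ))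
  | 1 => X.h.map fun j : ℕ => .H (-(j : ℤ))
  | 2 => X.a.map fun j : ℕ => .G (-(j : ℤ))
  | 3 => X.b.map fun j : ℕ => .Q (-(j : ℤ))
  | 4 => List.replicate X.k (.L (-1))
  | 5 => List.replicate X.r₁.toNat (.G (-1))
  | 6 => List.replicate X.r₂.toNat (.Q (-1))
  | 7 => List.replicate X.r₃.toNat (.Q 0)
  | _ => []

/-- The word of a label. -/
def word (X : StdTerm) : List Gen := concat8 X.block

theorem op_eq (t : Kind) (X : StdTerm) : X.op t = t.mono X.word := by
  have hcast : ∀ l : List ℕ, l.flatMap (fun a : ℕ => [(a : ℤ)]) = l.map fun a : ℕ => (a : ℤ) :=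
    fun l => by induction l <;> simp_all
  simp [hcast, op, word, concat8, block, Kind.mono, List.map_map, Function.comp_def, Kind.gn_L,
    Kind.gn_H, Kind.gn_G, Kind.gn_Q, mul_assoc]

theorem cls_of_mem_block (X : StdTerm) (n : ℕ) : ∀ x ∈ X.block n, x.cls = n := by
  intro x hx
  match n, hx with
  | 0, hx =>
    obtain ⟨j, hj, rfl⟩ := List.mem_map.1 hx
    have := X.l_ge j hj
    simp [Gen.cls, Gen.key, show -(j : ℤ) ≤ -2 by omega]
  | 1, hx =>
    obtain ⟨j, hj, rfl⟩ := List.mem_map.1 hx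
    have := X.h_ge j hj
    simp [Gen.cls, Gen.key, show -(j : ℤ) ≤ -1 by omega]
  | 2, hx =>
    obtain ⟨j, hj, rfl⟩ := List.mem_map.1 hx
    have := X.a_ge j hj
    simp [Gen.cls, Gen.key, show -(j : ℤ) ≤ -2 by omega]
  | 3, hx =>
    obtain ⟨j, hj, rfl⟩ := List.mem_map.1 hx
    have := X.b_ge j hj
    simp [Gen.cls, Gen.key, show -(j : ℤ) ≤ -2 by omega]
  | 4, hx => rw [List.eq_of_mem_replicate hx]; rfl
  | 5, hx => rw [List.eq_of_mem_replicate hx]; rfl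
  | 6, hx => rw [List.eq_of_mem_replicate hx]; rfl
  | 7, hx => rw [List.eq_of_mem_replicate hx]; rfl

theorem part_word (X : StdTerm) (n : ℕ) (hn : n < 8) : clsPart n X.word = X.block n :=
  part_concat8 _ X.cls_of_mem_block n hn

theorem good_block (X : StdTerm) (n : ℕ) (hn : n < 8) : Good (X.block n) := by
  have hlow : ∀ x ∈ X.block n, ¬ x.hwt := fun x hx => by
    rw [Gen.hwt_iff_cls, X.cls_of_mem_block n x hx]; omega
  have hrep : ∀ k x, (x.odd = true → k ≤ 1) → (∀ y ∈ List.replicate k x, ¬ Gen.hwt y) →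
      Good (List.replicate k x) := fun k x hk hl =>
    ⟨List.pairwise_replicate.2 (Or.inr le_rfl), fun y hy ho => by
      obtain rfl := List.eq_of_mem_replicate hy
      simpa using hk ho, hl⟩
  have hle1 : ∀ b : Bool, b.toNat ≤ 1 := Bool.toNat_le
  match n, hlow with
  | 0, hlow =>
    refine ⟨?_, fun x hx ho => ?_, hlow⟩
    · rw [block, List.pairwise_map]
      refine X.l_sorted.imp_of_mem fun {i j} hi hj hij => ?_
      have := X.l_ge i hi
      have := X.l_ge j hj
      simp [Gen.le_iff, Gen.key, show -(j : ℤ) ≤ -2 by omega, show -(i : ℤ) ≤ -2 by omega,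
        Prod.Lex.toLex_le_toLex]
      omega
    · obtain ⟨j, hj, rfl⟩ := List.mem_map.1 hx
      cases ho
  | 1, hlow =>
    refine ⟨?_, fun x hx ho => ?_, hlow⟩
    · rw [block, List.pairwise_map]
      refine X.h_sorted.imp_of_mem fun {i j} hi hj hij => ?_
      have := X.h_ge i hi
      have := X.h_ge j hj
      simp [Gen.le_iff, Gen.key, show -(j : ℤ) ≤ -1 by omega, show -(i : ℤ) ≤ -1 by omega,
        Prod.Lex.toLex_le_toLex]
      omega
    · obtain ⟨j, hj, rfl⟩ := List.mem_map.1 hx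
      cases ho
  | 2, hlow =>
    refine ⟨?_, fun x hx ho => List.nodup_iff_count_le_one.1 ?_ x, hlow⟩
    · rw [block, List.pairwise_map]
      refine X.a_sorted.imp_of_mem fun {i j} hi hj hij => ?_
      have := X.a_ge i hi
      have := X.a_ge j hj
      simp [Gen.le_iff, Gen.key, show -(j : ℤ) ≤ -2 by omega, show -(i : ℤ) ≤ -2 by omega,
        Prod.Lex.toLex_le_toLex]
      omega
    · refine List.Nodup.map (fun i j h => ?_) (X.a_sorted.imp fun h => h.ne')
      simpa using h
  | 3, hlow =>
    refine ⟨?_, fun x hx ho => List.nodup_iff_count_le_one.1 ?_ x, hlow⟩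
    · rw [block, List.pairwise_map]
      refine X.b_sorted.imp_of_mem fun {i j} hi hj hij => ?_
      have := X.b_ge i hi
      have := X.b_ge j hj
      simp [Gen.le_iff, Gen.key, show -(j : ℤ) ≤ -2 by omega, show -(i : ℤ) ≤ -2 by omega,
        Prod.Lex.toLex_le_toLex]
      omega
    · refine List.Nodup.map (fun i j h => ?_) (X.b_sorted.imp fun h => h.ne')
      simpa using h
  | 4, hlow => exact hrep _ _ (by simp [Gen.odd]) hlow
  | 5, hlow => exact hrep _ _ (fun _ => hle1 _) hlow
  | 6, hlow => exact hrep _ _ (fun _ => hle1 _) hlow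
  | 7, hlow => exact hrep _ _ (fun _ => hle1 _) hlow

theorem good_word (X : StdTerm) : Good X.word :=
  good_concat8 _ X.cls_of_mem_block X.good_block

theorem word_injective : Function.Injective word := by
  intro X Y h
  have hb : ∀ n < 8, X.block n = Y.block n := fun n hn => by
    rw [← part_word _ _ hn, ← part_word _ _ hn, h]
  have hinj : ∀ f : ℤ → Gen, Function.Injective f →
      Function.Injective (List.map fun j : ℕ => f (-(j : ℤ))) := fun f hf =>
    List.map_injective_iff.2 fun i j hij => by simpa using hf hij
  have hbool : ∀ {a b : Bool} {x : Gen}, List.replicate a.toNat x = List.replicate b.toNat x →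
      a = b := fun {a b x} h => by
    have := congrArg List.length h
    cases a <;> cases b <;> simp_all
  ext1
  · exact hinj _ (fun _ _ => Gen.L.inj) (hb 0 (by omega))
  · exact hinj _ (fun _ _ => Gen.H.inj) (hb 1 (by omega))
  · exact hinj _ (fun _ _ => Gen.G.inj) (hb 2 (by omega))
  · exact hinj _ (fun _ _ => Gen.Q.inj) (hb 3 (by omega))
  · simpa [block] using congrArg List.length (hb 4 (by omega))
  · exact hbool (hb 5 (by omega))
  · exact hbool (hb 6 (by omega))
  · exact hbool (hb 7 (by omega))

end StdTerm

namespace Gen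

/-- The mode of a basis element. -/
def mode : Gen → ℤ
  | .L m => m
  | .H m => m
  | .G m => m
  | .Q m => m
  | .C => 0

theorem eq_of_cls {x : Gen} {n : ℕ} (h : x.cls = n) (hn : n < 8) :
    (n = 0 ∧ x = .L (-(x.mode.natAbs : ℤ)) ∧ 2 ≤ x.mode.natAbs) ∨
    (n = 1 ∧ x = .H (-(x.mode.natAbs : ℤ)) ∧ 1 ≤ x.mode.natAbs) ∨
    (n = 2 ∧ x = .G (-(x.mode.natAbs : ℤ)) ∧ 2 ≤ x.mode.natAbs) ∨
    (n = 3 ∧ x = .Q (-(x.mode.natAbs : ℤ)) ∧ 2 ≤ x.mode.natAbs) ∨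
    (n = 4 ∧ x = .L (-1)) ∨ (n = 5 ∧ x = .G (-1)) ∨ (n = 6 ∧ x = .Q (-1)) ∨
    (n = 7 ∧ x = .Q 0) := by
  obtain ⟨k, hk⟩ : ∃ k, k = x.mode.natAbs := ⟨_, rfl⟩
  rw [← hk]
  cases x <;> simp only [cls, key] at h <;> (try split_ifs at h) <;> subst h <;>
    simp at hn ⊢ <;> simp only [mode] at hk <;> omega

theorem natAbs_mode_le {x y : Gen} (h : x ≤ y) (hxy : x.cls = y.cls) (hy : y.cls < 4) :
    y.mode.natAbs ≤ x.mode.natAbs := by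
  rw [le_iff, Prod.Lex.le_iff] at h
  have h2 : (ofLex (key x)).2 ≤ (ofLex (key y)).2 :=
    h.elim (fun h => absurd hxy h.ne) fun h => h.2
  cases x <;> cases y <;> simp only [cls, key] at hxy hy h2 <;>
    (try split_ifs at hxy hy h2) <;> simp at hxy hy h2 <;> simp only [mode] <;> omega

end Gen

theorem Good.exists_word {w : List Gen} (hw : Good w) : ∃ X : StdTerm, X.word = w := by
  have hge : ∀ n < 4, ((clsPart n w).map fun x => x.mode.natAbs).Pairwise (· ≥ ·) := by
    intro n hn
    rw [List.pairwise_map]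
    refine (hw.part n).sorted.imp_of_mem fun {x y} hx hy hxy => ?_
    have h1 := (mem_clsPart.1 hx).2
    have h2 := (mem_clsPart.1 hy).2
    exact Gen.natAbs_mode_le hxy (h1.trans h2.symm) (by omega)
  have hgt : ∀ n, n = 2 ∨ n = 3 →
      ((clsPart n w).map fun x => x.mode.natAbs).Pairwise (· > ·) := by
    intro n hn
    have hnd : (clsPart n w).Nodup := by
      rw [List.nodup_iff_count_le_one]
      intro x
      by_cases hx : x ∈ clsPart n w
      · refine (hw.part n).nodup x hx ?_
        rcases Gen.eq_of_cls (mem_clsPart.1 hx).2 (by omega) with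
          h | h | h | h | h | h | h | h <;> first | omega | (rw [h.2.1]; rfl)
      · simp [List.count_eq_zero_of_not_mem hx]
    have h1 := hge n (by omega)
    rw [List.pairwise_map] at h1 ⊢
    refine (h1.and hnd).imp_of_mem fun {x y} hx hy hxy => lt_of_le_of_ne hxy.1 fun h => hxy.2 ?_
    rcases Gen.eq_of_cls (mem_clsPart.1 hx).2 (by omega) with
      h1 | h1 | h1 | h1 | h1 | h1 | h1 | h1 <;>
    rcases Gen.eq_of_cls (mem_clsPart.1 hy).2 (by omega) with
      h2 | h2 | h2 | h2 | h2 | h2 | h2 | h2 <;>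
      first | omega | (rw [h1.2.1, h2.2.1, h])
  have hmin : ∀ n < 4, ∀ j ∈ (clsPart n w).map (fun x => x.mode.natAbs), 1 ≤ j ∧ (n ≠ 1 → 2 ≤ j) := by
    intro n hn j hj
    obtain ⟨x, hx, rfl⟩ := List.mem_map.1 hj
    rcases Gen.eq_of_cls (mem_clsPart.1 hx).2 (by omega) with
      h1 | h1 | h1 | h1 | h1 | h1 | h1 | h1 <;> omega
  have hmap : ∀ n < 4, ∀ f : ℤ → Gen, (∀ x : Gen, x.cls = n → x = f (-(x.mode.natAbs : ℤ))) →
      ((clsPart n w).map fun x => x.mode.natAbs).map (fun j : ℕ => f (-(j : ℤ))) =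
        clsPart n w := by
    intro n hn f hf
    rw [List.map_map]
    conv_rhs => rw [← List.map_id (clsPart n w)]
    refine List.map_congr_left fun x hx => ?_
    exact (hf x (mem_clsPart.1 hx).2).symm
  -- A class consisting of one odd letter contributes that letter at most once, so a Boolean records
  -- its block.
  have hrep : ∀ n x, x.odd = true → (∀ y : Gen, y.cls = n → y = x) →
      List.replicate (decide (clsPart n w ≠ [])).toNat x = clsPart n w := by
    intro n x ho hx
    have h1 : clsPart n w = List.replicate (clsPart n w).length x :=
      List.eq_replicate_of_mem fun y hy => hx y (mem_clsPart.1 hy).2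
    rcases h2 : clsPart n w with _ | ⟨y, l⟩
    · simp
    · have h3 : y = x := hx y (mem_clsPart.1 (h2 ▸ List.mem_cons_self)).2
      have h4 := (hw.part n).nodup x (by rw [h2, h3]; simp) ho
      rw [h1, List.count_replicate_self, h2] at h4
      have h5 : l = [] := List.length_eq_zero_iff.1 (by simp at h4 ⊢; omega)
      simp [h5, h3]
  refine ⟨⟨(clsPart 0 w).map fun x => x.mode.natAbs, (clsPart 1 w).map fun x => x.mode.natAbs,
    (clsPart 2 w).map fun x => x.mode.natAbs, (clsPart 3 w).map fun x => x.mode.natAbs,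
    (clsPart 4 w).length, decide (clsPart 5 w ≠ []), decide (clsPart 6 w ≠ []),
    decide (clsPart 7 w ≠ []), hge 0 (by omega), hge 1 (by omega), hgt 2 (by omega),
    hgt 3 (by omega), fun j hj => (hmin 0 (by omega) j hj).2 (by omega),
    fun j hj => (hmin 1 (by omega) j hj).1, fun j hj => (hmin 2 (by omega) j hj).2 (by omega),
    fun j hj => (hmin 3 (by omega) j hj).2 (by omega)⟩, ?_⟩
  conv_rhs => rw [hw.eq_concat8]
  rw [StdTerm.word, concat8, concat8]
  simp only [StdTerm.block]
  rw [hmap 0 (by omega) Gen.L, hmap 1 (by omega) Gen.H, hmap 2 (by omega) Gen.G,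
    hmap 3 (by omega) Gen.Q, hrep 5 _ rfl, hrep 6 _ rfl, hrep 7 _ rfl,
    ← List.eq_replicate_of_mem (a := Gen.L (-1)) (l := clsPart 4 w)]
  · intro x hx
    have := Gen.eq_of_cls (mem_clsPart.1 hx).2 (by omega)
    simpa using this
  all_goals
    intro x hx
    rcases Gen.eq_of_cls hx (by omega) with h | h | h | h | h | h | h | h <;>
      first | omega | exact h.2.1 | exact h.2

end TopN2
end

/-! ### Level, charge and normal forms. -/

noncomputable section

namespace TopN2

namespace Gen

/-- The charge of a basis element, in units of the charge of `G`. -/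
def charge : Gen → ℤ
  | .G _ => 1
  | .Q _ => -1
  | _ => 0

end Gen

/-- The level of a word. -/
def level (w : List Gen) : ℤ := -(w.map Gen.mode).sum

/-- The charge of a word, in units of the charge of `G`. -/
def charge (w : List Gen) : ℤ := (w.map Gen.charge).sum

namespace Kind

variable (t : Kind) (Δ q c : ℂ)

theorem sigma_L_zero (w : List Gen) : (t.data Δ q c).sigma (.L 0 :: w) =
    (Δ + level w) • (t.data Δ q c).sigma w := by
  induction w with
  | nil => simpa [level, data_chi, Gen.chi] using (t.data Δ q c).sigma_hw [] (.L 0) le_rfl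
  | cons y w ih =>
    rw [SuperData.sigma_exchange_cons, ← SuperData.T_sigma _ y, ih, map_smul, SuperData.T_sigma]
    have h : bsum (t.br (.L 0) y) (fun z => (t.data Δ q c).sigma (z :: w)) =
        (-(y.mode : ℂ)) • (t.data Δ q c).sigma (y :: w) := by
      cases y <;> simp [br, Gen.mode]
    rw [data_br, h]
    simp only [data_odd, sgn, Gen.odd, Bool.false_and, level, List.map_cons, List.sum_cons,
      neg_add, Int.cast_add, Int.cast_neg]
    simp only [Bool.false_eq_true, if_false]
    module

theorem sigma_H_zero (w : List Gen) : (t.data Δ q c).sigma (.H 0 :: w) =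
    (q + t.sg * charge w) • (t.data Δ q c).sigma w := by
  induction w with
  | nil => simpa [charge, data_chi, Gen.chi] using (t.data Δ q c).sigma_hw [] (.H 0) le_rfl
  | cons y w ih =>
    rw [SuperData.sigma_exchange_cons, ← SuperData.T_sigma _ y, ih, map_smul, SuperData.T_sigma]
    have h : bsum (t.br (.H 0) y) (fun z => (t.data Δ q c).sigma (z :: w)) =
        (t.sg * (y.charge : ℂ)) • (t.data Δ q c).sigma (y :: w) := by
      cases y <;> simp [br, Gen.charge]
      rintro rfl
      simp
    rw [data_br, h]
    simp only [data_odd, sgn, Gen.odd, Bool.false_and, charge, List.map_cons, List.sum_cons,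
      Int.cast_add]
    simp only [Bool.false_eq_true, if_false]
    module

/-- The sign of the charge of the field annihilating the highest weight vector. -/
def sgi : Kind → ℤ
  | .G => 1
  | .Q => -1

theorem sgi_cast : ((t.sgi : ℤ) : ℂ) = t.sg := by cases t <;> simp [sgi, sg]

theorem sg_mul_self : t.sg * t.sg = 1 := by cases t <;> simp [sg]

variable {t Δ q c}

theorem good_of_mem_support {v : Verma t Δ q c} {w : List Gen}
    (hw : w ∈ (t.toWords Δ q c v).support) : Good w :=
  (good_iff t Δ q c w).1 ((Finsupp.mem_supported ℂ _).1 (t.toWords_mem_normal Δ q c v) hw)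

theorem eigen_support (φ : Words) (x : Gen) (f : List Gen → ℂ) (a : ℂ)
    (hf : ∀ w ∈ φ.support, (t.data Δ q c).sigma (x :: w) = f w • Finsupp.single w 1)
    (h : (t.data Δ q c).T x φ = a • φ) : ∀ w ∈ φ.support, f w = a := by
  intro w hw
  have h1 : (t.data Δ q c).T x φ = φ.sum fun w z => Finsupp.single w (z * f w) := by
    rw [SuperData.T, Finsupp.linearCombination_apply]
    refine Finsupp.sum_congr fun w hw => ?_
    rw [hf w hw]; simp
  have h2 : (φ.sum fun w z => Finsupp.single w (z * f w)) w = φ w * f w := by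
    rw [Finsupp.sum, Finsupp.finsetSum_apply, Finset.sum_eq_single w]
    · simp
    · intro b _ hb; simp [hb]
    · intro h; exact absurd hw h
  rw [← h1, h, Finsupp.smul_apply, smul_eq_mul, mul_comm] at h2
  exact (mul_left_cancel₀ (Finsupp.mem_support_iff.1 hw) h2).symm

/-- The zero modes of L and H are diagonal on normal words, so an eigenvector is supported on words
with its own eigenvalue. -/
theorem grade_of_mem_support {v : Verma t Δ q c} {m : ℕ} {n : ℤ} (hv : HasGrade v m n)
    {w : List Gen} (hw : w ∈ (t.toWords Δ q c v).support) :
    level w = m ∧ charge w = t.sgi * n := by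
  have e1 := congrArg (t.toWords Δ q c) hv.1
  have e2 := congrArg (t.toWords Δ q c) hv.2
  rw [← t.gn_L, toWords_smul, rho_gn, map_smul] at e1
  rw [← t.gn_H, toWords_smul, rho_gn, map_smul] at e2
  have hσ : ∀ w ∈ (t.toWords Δ q c v).support,
      (t.data Δ q c).sigma w = Finsupp.single w 1 := fun w hw =>
    SuperData.Good.sigma ((good_iff t Δ q c w).2 (good_of_mem_support hw))
  have h1 := eigen_support _ _ _ _ (fun w hw => by rw [sigma_L_zero, hσ w hw]) e1 w hw
  have h2 := eigen_support _ _ _ _ (fun w hw => by rw [sigma_H_zero, hσ w hw]) e2 w hw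
  refine ⟨by exact_mod_cast add_left_cancel h1, ?_⟩
  have h3 := add_left_cancel h2
  rw [← sgi_cast] at h3
  have h4 : t.sgi * charge w = n := by exact_mod_cast h3
  rw [← h4]
  cases t <;> simp [sgi]

/-- A family of coefficients is a normal form if and only if it is the family of coefficients in
the model of the Verma module on words. -/
theorem isNormalForm_iff {f : StdTerm →₀ ℂ} {v : Verma t Δ q c} :
    IsNormalForm f v ↔ f.mapDomain StdTerm.word = t.toWords Δ q c v := by
  have h : t.eval Δ q c (f.mapDomain StdTerm.word) =
      f.sum fun X z => z • (X.op t • hw t Δ q c) := by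
    rw [eval, Finsupp.linearCombination_mapDomain, Finsupp.linearCombination_apply]
    simp only [Function.comp_apply, StdTerm.op_eq]
  constructor
  · intro hf
    rw [hf, Finsupp.mapDomain, Finsupp.sum, Finsupp.sum, map_sum]
    refine Finset.sum_congr rfl fun X _ => ?_
    rw [map_smul, StdTerm.op_eq, toWords_mono,
      SuperData.Good.sigma ((good_iff t Δ q c _).2 X.good_word)]
    simp
  · intro hf
    rw [IsNormalForm, ← h, hf, eval_toWords]

theorem existsUnique_normalForm (v : Verma t Δ q c) : ∃! f : StdTerm →₀ ℂ, IsNormalForm f v := by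
  have hsupp : ((t.toWords Δ q c v).support : Set (List Gen)) ⊆ Set.range StdTerm.word :=
    fun w hw => (good_of_mem_support hw).exists_word
  refine ⟨(t.toWords Δ q c v).comapDomain StdTerm.word StdTerm.word_injective.injOn, ?_, ?_⟩
  · exact isNormalForm_iff.2 (Finsupp.mapDomain_comapDomain _ StdTerm.word_injective _ hsupp)
  · intro f hf
    rw [← isNormalForm_iff.1 hf]
    exact (Finsupp.comapDomain_mapDomain _ StdTerm.word_injective _).symm

theorem normalForm_apply {f : StdTerm →₀ ℂ} {v : Verma t Δ q c} (hf : IsNormalForm f v)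
    (X : StdTerm) : f X = t.toWords Δ q c v X.word := by
  rw [← isNormalForm_iff.1 hf, Finsupp.mapDomain_apply StdTerm.word_injective]

end Kind
end TopN2
end

/-! ### The graded algebra, with `L (-1)` as a central element. -/

noncomputable section

namespace TopN2

namespace Gen

/-- The degree of a basis element in the filtration for which the leading terms of the fermions
form a Clifford algebra over the polynomials in `L (-1)`. -/
def deg : Gen → ℕ
  | .L m => if m = -1 then 2 else 1
  | .G _ => 1
  | .Q _ => 1
  | _ => 0

theorem deg_L_le (m : ℤ) : 1 ≤ deg (.L m) ∧ deg (.L m) ≤ 2 := by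
  simp only [deg]; split_ifs <;> simp

end Gen

namespace Kind

variable (t : Kind) (Δ q c : ℂ)

/-- A bracket has a component of degree 2 only when it lands on `L (-1)`, which happens for two L's
or for two opposite fermions, each of degree at least 1. -/
theorem deg_br (x y : Gen) : ∀ p ∈ (t.data Δ q c).br x y, p.2.deg ≤ x.deg + y.deg := by
  rw [data_br]
  have h := Gen.deg_L_le
  cases x <;> cases y <;> simp only [br, List.mem_cons, List.not_mem_nil, or_false,
    IsEmpty.forall_iff, implies_true, forall_eq_or_imp, forall_eq] <;>
    simp only [Gen.deg] <;> (try refine And.intro ?_ ?_) <;>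
    (try refine And.intro ?_ ?_) <;> (try split_ifs) <;> omega

/-- The associated graded structure constants. -/
def gdata : SuperData Gen := (t.data Δ q c).gr (deg := Gen.deg) (t.deg_br Δ q c)

theorem gdata_good {w : List Gen} : (t.gdata Δ q c).Good w ↔ Good w :=
  ⟨fun h => ⟨h.sorted, h.nodup, h.lower⟩, fun h => ⟨h.sorted, h.nodup, h.lower⟩⟩

/-- The action of a basis element on the associated graded module. -/
def grT (x : Gen) : Words →ₗ[ℂ] Words := (t.gdata Δ q c).T x

/-- The leading term of the translation operator. -/
abbrev lam : Words →ₗ[ℂ] Words := t.grT Δ q c (.L (-1))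

variable {t Δ q c}

theorem grT_comm (y x : Gen) (v : Words) : t.grT Δ q c y (t.grT Δ q c x v) =
    sgn y.odd x.odd • t.grT Δ q c x (t.grT Δ q c y v) +
      bsum (t.br y x) (fun z => if z.deg = y.deg + x.deg then t.grT Δ q c z v else 0) := by
  rw [← bsum_filter _ (fun z : Gen => z.deg = y.deg + x.deg)]
  exact (t.gdata Δ q c).T_comm y x v

/-- No bracket with `L (-1)` reaches degree 2 more than the other letter, so all of them vanish in
the graded algebra. -/
theorem lam_comm (x : Gen) (v : Words) :
    t.lam Δ q c (t.grT Δ q c x v) = t.grT Δ q c x (t.lam Δ q c v) := by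
  rw [lam, grT_comm]
  cases x <;> simp [br, Gen.odd, sgn, Gen.deg] <;> (try split_ifs) <;> simp

/-- Only a bracket landing on `L (-1)` keeps the full degree, and then p - n = 2p + 1. Each positive
mode of L is thus conjugate to exactly one creation letter. -/
theorem L_L (p n : ℤ) (hp : 1 ≤ p) (v : Words) :
    t.grT Δ q c (.L p) (t.grT Δ q c (.L n) v) = t.grT Δ q c (.L n) (t.grT Δ q c (.L p) v) +
      if Gen.L n = .L (-1 - p) then (2 * p + 1 : ℂ) • t.lam Δ q c v else 0 := by
  rw [grT_comm]
  have hp' : p ≠ -1 := by omega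
  simp only [Gen.odd, sgn, Bool.false_and, Bool.false_eq_true, if_false, one_smul, br, bsum_cons,
    bsum_nil, add_zero, Gen.deg, hp', Gen.L.injEq]
  by_cases h : n = -1 - p
  · subst h
    have e : p + (-1 - p) = -1 := by ring
    have e2 : -1 - p ≠ -1 := by omega
    rw [e]
    simp [e2]
    congr 1
    ring
  · have e2 : p + n ≠ -1 := by omega
    simp only [e2, h, if_false]
    split_ifs <;> simp at *

theorem L_comm (p : ℤ) (x : Gen) (hx : ∀ n, x ≠ .L n) (v : Words) :
    t.grT Δ q c (.L p) (t.grT Δ q c x v) = t.grT Δ q c x (t.grT Δ q c (.L p) v) := by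
  rw [grT_comm]
  cases x <;> simp [br, Gen.odd, sgn, Gen.deg] <;> (try split_ifs) <;> simp at *

theorem H_H (p n : ℤ) (v : Words) :
    t.grT Δ q c (.H p) (t.grT Δ q c (.H n) v) = t.grT Δ q c (.H n) (t.grT Δ q c (.H p) v) +
      (if p + n = 0 then (p : ℂ) / 3 else 0) • t.grT Δ q c .C v := by
  rw [grT_comm]
  simp [br, Gen.odd, sgn, Gen.deg]

theorem H_L (p n : ℤ) (v : Words) :
    t.grT Δ q c (.H p) (t.grT Δ q c (.L n) v) = t.grT Δ q c (.L n) (t.grT Δ q c (.H p) v) :=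
  (L_comm n (.H p) (by simp) v).symm

theorem H_G (p n : ℤ) (v : Words) :
    t.grT Δ q c (.H p) (t.grT Δ q c (.G n) v) = t.grT Δ q c (.G n) (t.grT Δ q c (.H p) v) +
      t.sg • t.grT Δ q c (.G (p + n)) v := by
  rw [grT_comm]
  simp [br, Gen.odd, sgn, Gen.deg]

theorem H_Q (p n : ℤ) (v : Words) :
    t.grT Δ q c (.H p) (t.grT Δ q c (.Q n) v) = t.grT Δ q c (.Q n) (t.grT Δ q c (.H p) v) -
      t.sg • t.grT Δ q c (.Q (p + n)) v := by
  rw [grT_comm]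
  simp [br, Gen.odd, sgn, Gen.deg, sub_eq_add_neg]

theorem G_Q (i k : ℤ) (v : Words) :
    t.grT Δ q c (.G i) (t.grT Δ q c (.Q k) v) = -t.grT Δ q c (.Q k) (t.grT Δ q c (.G i) v) +
      if i + k = -1 then (2 : ℂ) • t.lam Δ q c v else 0 := by
  rw [grT_comm]
  simp only [Gen.odd, sgn, Bool.and_true, if_true, neg_smul, one_smul, br, bsum_cons,
    bsum_nil, add_zero, Gen.deg]
  by_cases h : i + k = -1 <;> simp [h]

theorem G_G (i k : ℤ) (v : Words) :
    t.grT Δ q c (.G i) (t.grT Δ q c (.G k) v) = -t.grT Δ q c (.G k) (t.grT Δ q c (.G i) v) := by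
  rw [grT_comm]
  simp [br, Gen.odd, sgn]

theorem Q_Q (i k : ℤ) (v : Words) :
    t.grT Δ q c (.Q i) (t.grT Δ q c (.Q k) v) = -t.grT Δ q c (.Q k) (t.grT Δ q c (.Q i) v) := by
  rw [grT_comm]
  simp [br, Gen.odd, sgn]

theorem C_comm (x : Gen) (v : Words) :
    t.grT Δ q c .C (t.grT Δ q c x v) = t.grT Δ q c x (t.grT Δ q c .C v) := by
  rw [grT_comm, show t.br .C x = [] by cases x <;> rfl, bsum_nil, add_zero]
  exact one_smul _ _

variable (t Δ q c)

/-- The normal form of a word in the associated graded module. -/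
def gw (w : List Gen) : Words := (t.gdata Δ q c).sigma w

variable {t Δ q c}

theorem grT_gw (x : Gen) (w : List Gen) : t.grT Δ q c x (t.gw Δ q c w) = t.gw Δ q c (x :: w) :=
  (t.gdata Δ q c).T_sigma x w

theorem grT_single (x : Gen) (w : List Gen) :
    t.grT Δ q c x (Finsupp.single w 1) = t.gw Δ q c (x :: w) :=
  (t.gdata Δ q c).T_single x w

theorem gw_good {w : List Gen} (hw : Good w) : t.gw Δ q c w = Finsupp.single w 1 :=
  SuperData.Good.sigma (t.gdata_good Δ q c |>.2 hw)

theorem grT_vac {x : Gen} (hx : x.hwt) (h0 : x.deg = 0 → Gen.chi Δ q c x = 0) :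
    t.grT Δ q c x (t.gw Δ q c []) = 0 := by
  rw [grT_gw]
  refine ((t.gdata Δ q c).sigma_hw [] x hx).trans ?_
  change (if x.deg = 0 then Gen.chi Δ q c x else 0) • _ = _
  split_ifs with h
  · rw [h0 h, zero_smul]
  · rw [zero_smul]

theorem C_gw (w : List Gen) : t.grT Δ q c .C (t.gw Δ q c w) = c • t.gw Δ q c w := by
  induction w with
  | nil =>
    rw [grT_gw]
    exact (t.gdata Δ q c).sigma_hw [] .C trivial
  | cons x w ih => rw [← grT_gw, C_comm, ih, map_smul]

/-- Vectors which are combinations of words in normal form. -/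
def Normal (v : Words) : Prop := ∀ w ∈ v.support, Good w

theorem normal_iff (v : Words) : Normal v ↔ v ∈ (t.gdata Δ q c).normal := by
  rw [SuperData.normal, Finsupp.mem_supported]
  exact forall₂_congr fun w _ => (t.gdata_good Δ q c).symm

theorem normal_grT (x : Gen) (v : Words) : Normal (t.grT Δ q c x v) :=
  (normal_iff (t := t) (Δ := Δ) (q := q) (c := c) _).2 ((t.gdata Δ q c).T_mem_normal x v)

/-- A word in normal form with one more letter `L (-1)`. -/
def ins (w : List Gen) : List Gen := w.orderedInsert (· ≤ ·) (.L (-1))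

theorem ins_perm (w : List Gen) : (ins w).Perm (.L (-1) :: w) := List.perm_orderedInsert _ _ _

/-- The central letter can be carried to its sorted place without corrections. Hence `lam` sends
normal words injectively to normal words, so it is injective on normal vectors and can be cancelled
(`eq_zero_of_lam`). -/
theorem lam_gw {w : List Gen} (hw : Good w) :
    Good (ins w) ∧ t.lam Δ q c (Finsupp.single w 1) = Finsupp.single (ins w) 1 := by
  have hg : Good (ins w) := by
    refine ⟨?_, ?_, ?_⟩
    · exact List.Pairwise.orderedInsert _ _ hw.sorted
    · intro x hx ho
      rw [(ins_perm w).mem_iff, List.mem_cons] at hx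
      rcases hx with rfl | hx
      · cases ho
      · rw [(ins_perm w).count_eq, List.count_cons_of_ne]
        · exact hw.nodup x hx ho
        · rintro rfl; cases ho
    · intro x hx
      rw [(ins_perm w).mem_iff, List.mem_cons] at hx
      rcases hx with rfl | hx
      · change ¬ (0 ≤ (-1 : ℤ)); omega
      · exact hw.lower x hx
  refine ⟨hg, ?_⟩
  rw [← gw_good hw, grT_gw, ← gw_good (t := t) (Δ := Δ) (q := q) (c := c) hg]
  clear hg hw
  induction w with
  | nil => rfl
  | cons x w ih =>
    rw [ins, List.orderedInsert]
    split_ifs with h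
    · rfl
    · rw [← grT_gw _ (x :: w), ← grT_gw x w, lam_comm, grT_gw _ w, ih, grT_gw]
      rfl

theorem ins_injOn {w w' : List Gen} (hw : Good w) (hw' : Good w') (h : ins w = ins w') :
    w = w' := by
  refine SuperData.Good.eq_of_perm hw hw' ?_
  have h1 := (ins_perm w).symm.trans (h ▸ ins_perm w')
  exact (List.perm_cons _).1 h1

theorem lam_eq {v : Words} (hv : Normal v) :
    t.lam Δ q c v = v.mapDomain ins := by
  conv_lhs => rw [← v.sum_single]
  rw [Finsupp.mapDomain, Finsupp.sum, Finsupp.sum, map_sum]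
  refine Finset.sum_congr rfl fun w hw => ?_
  rw [← mul_one (v w), ← smul_eq_mul, ← Finsupp.smul_single, map_smul, (lam_gw (hv w hw)).2]
  simp

theorem lam_apply {v : Words} (hv : Normal v) {w : List Gen} (hw : Good w) :
    t.lam Δ q c v (ins w) = v w := by
  by_cases h : w ∈ v.support
  · rw [lam_eq hv]
    refine Finsupp.mapDomain_apply' {w | Good w} v (fun w hw => hv w hw) ?_ hw
    exact fun w hw w' hw' h => ins_injOn hw hw' h
  · rw [lam_eq hv, Finsupp.mapDomain_apply' {w | Good w} v (fun w hw => hv w hw) 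
      (fun w hw w' hw' h => ins_injOn hw hw' h) hw]

theorem eq_zero_of_lam {v : Words} (hv : Normal v) (h : t.lam Δ q c v = 0) : v = 0 := by
  ext w
  by_cases hw : w ∈ v.support
  · rw [← lam_apply (t := t) (Δ := Δ) (q := q) (c := c) hv (hv w hw), h]; rfl
  · simpa using hw

theorem exists_of_lam_apply_ne {v : Words} (hv : Normal v) {w : List Gen}
    (h : t.lam Δ q c v w ≠ 0) : ∃ w' ∈ v.support, ins w' = w := by
  rw [lam_eq hv] at h
  have := Finsupp.mapDomain_support (Finsupp.mem_support_iff.2 h)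
  simpa using this

end Kind
end TopN2
end

/-! ### Fermion bilinears and the decoupled current. -/

noncomputable section

namespace TopN2
namespace Kind

variable {t : Kind} {Δ q c : ℂ}

theorem Q_G (k i : ℤ) (v : Words) :
    t.grT Δ q c (.Q k) (t.grT Δ q c (.G i) v) = -t.grT Δ q c (.G i) (t.grT Δ q c (.Q k) v) +
      if i + k = -1 then (2 : ℂ) • t.lam Δ q c v else 0 := by
  rw [G_Q]; abel

theorem L_L_neg {p n : ℤ} (hp : p ≤ -1) (hn : n ≤ -1) (v : Words) :
    t.grT Δ q c (.L p) (t.grT Δ q c (.L n) v) = t.grT Δ q c (.L n) (t.grT Δ q c (.L p) v) := by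
  rw [grT_comm]
  have h : p + n ≠ -1 := by omega
  simp only [Gen.odd, sgn, Bool.false_and, Bool.false_eq_true, if_false, one_smul, br, bsum_cons,
    bsum_nil, add_zero, Gen.deg, h]
  split_ifs <;> simp at *

/-- Moving a fermionic mode past one letter shifts its index by a bounded amount, or contracts it
only at one index. This makes the infinite sums of bilinears finite on each vector. -/
theorem exists_kill (v : Words) : ∃ N : ℤ, ∀ i, N ≤ i → t.grT Δ q c (.G i) v = 0 ∧ t.grT Δ q c (.Q i) v = 0 := by
  induction v using Finsupp.induction_linear with
  | zero => exact ⟨0, by simp⟩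
  | add f g hf hg =>
    obtain ⟨N, hN⟩ := hf
    obtain ⟨M, hM⟩ := hg
    refine ⟨max N M, fun i hi => ?_⟩
    have h1 := hN i (le_of_max_le_left hi)
    have h2 := hM i (le_of_max_le_right hi)
    simp [h1, h2]
  | single w a =>
    suffices h : ∃ N : ℤ, ∀ i, N ≤ i → t.grT Δ q c (.G i) (t.gw Δ q c w) = 0 ∧ t.grT Δ q c (.Q i) (t.gw Δ q c w) = 0 by
      obtain ⟨N, hN⟩ := h
      refine ⟨N, fun i hi => ?_⟩
      rw [← mul_one a, ← smul_eq_mul, ← Finsupp.smul_single, map_smul, map_smul, grT_single,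
        grT_single, ← grT_gw, ← grT_gw, (hN i hi).1, (hN i hi).2]
      simp
    induction w with
    | nil =>
      refine ⟨1, fun i hi => ⟨grT_vac ?_ (by simp [Gen.deg]), grT_vac hi (by simp [Gen.deg])⟩⟩
      change 0 ≤ i
      omega
    | cons x w ih =>
      obtain ⟨N, hN⟩ := ih
      simp only [← grT_gw x w]
      cases x with
      | L n =>
        refine ⟨N, fun i hi => ?_⟩
        rw [← L_comm n _ (by simp), ← L_comm n _ (by simp), (hN i hi).1, (hN i hi).2]
        simp
      | H n =>
        refine ⟨max N (N - n), fun i hi => ?_⟩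
        have h1 := hN i (by omega)
        have h2 := hN (n + i) (by omega)
        have e1 := H_G (t := t) (Δ := Δ) (q := q) (c := c) n i (t.gw Δ q c w)
        have e2 := H_Q (t := t) (Δ := Δ) (q := q) (c := c) n i (t.gw Δ q c w)
        rw [h1.1, h2.1, map_zero, smul_zero, add_zero] at e1
        rw [h1.2, h2.2, map_zero, smul_zero, sub_zero] at e2
        exact ⟨e1.symm, e2.symm⟩
      | G n =>
        refine ⟨max N (-n), fun i hi => ?_⟩
        have h1 := hN i (by omega)
        rw [G_G, Q_G, h1.1, h1.2, if_neg (by omega)]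
        simp
      | Q n =>
        refine ⟨max N (-n), fun i hi => ?_⟩
        have h1 := hN i (by omega)
        rw [Q_Q, G_Q, h1.1, h1.2, if_neg (by omega)]
        simp
      | C =>
        refine ⟨N, fun i hi => ?_⟩
        rw [← C_comm, ← C_comm, (hN i hi).1, (hN i hi).2]
        simp

theorem finsum_sub_shift_one {E : Type*} [AddCommGroup E] (f : ℤ → E) (a : E) (N : ℤ)
    (h0 : ∀ i < -N, f i = 0) (h1 : ∀ i, N ≤ i → f i = a) :
    (Function.support fun i => f i - f (i - 1)).Finite ∧ ∑ᶠ i, (f i - f (i - 1)) = a := by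
  have hs : (Function.support fun i => f i - f (i - 1)) ⊆
      ((Finset.range (2 * N.natAbs + 1)).image fun k : ℕ => (k : ℤ) - N.natAbs : Finset ℤ) := by
    intro i hi
    rw [Function.mem_support] at hi
    simp only [Finset.coe_image, Finset.coe_range, Set.mem_image, Set.mem_Iio]
    by_cases h2 : i < -N
    · rw [h0 i h2, h0 (i - 1) (by omega)] at hi; simp at hi
    by_cases h3 : N ≤ i - 1
    · rw [h1 i (by omega), h1 (i - 1) h3] at hi; simp at hi
    exact ⟨(i + N.natAbs).toNat, by omega, by omega⟩
  refine ⟨(Finset.finite_toSet _).subset hs, ?_⟩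
  rw [finsum_eq_sum_of_support_subset _ hs, Finset.sum_image (by intro a _ b _ h; simpa using h)]
  have h2 := Finset.sum_range_sub (fun k : ℕ => f ((k : ℤ) - N.natAbs - 1)) (2 * N.natAbs + 1)
  have h3 : ∀ k : ℕ, f ((k + 1 : ℕ) - N.natAbs - 1) = f ((k : ℤ) - N.natAbs) := fun k => by
    congr 1; push_cast; ring
  simp only [h3] at h2
  rw [h2, h1 _ (by omega), h0 _ (by omega), sub_zero]

/-- Telescoping: a sequence vanishing at -∞ and equal to `a` at +∞ does not cancel against its shift
by `j`, but leaves `j • a`. This is the source of the anomaly in `modeProd_H`. -/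
theorem finsum_sub_shift {E : Type*} [AddCommGroup E] (f : ℤ → E) (a : E) (N : ℤ)
    (h0 : ∀ i < -N, f i = 0) (h1 : ∀ i, N ≤ i → f i = a) (j : ℕ) :
    (Function.support fun i => f i - f (i - j)).Finite ∧ ∑ᶠ i, (f i - f (i - j)) = j • a := by
  induction j with
  | zero => simp
  | succ j ih =>
    have h2 := finsum_sub_shift_one (fun i => f (i - j)) a (max N 0 + j)
      (fun i hi => h0 _ (by omega)) (fun i hi => h1 _ (by omega))
    have e : (fun i => f i - f (i - (j + 1 : ℕ))) =
        fun i => (f i - f (i - j)) + (f (i - j) - f (i - 1 - j)) := by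
      funext i
      rw [show i - (j + 1 : ℕ) = i - 1 - j by push_cast; ring]
      abel
    simp only [e]
    refine ⟨(ih.1.union h2.1).subset (Function.support_add _ _), ?_⟩
    rw [finsum_add_distrib ih.1 h2.1, ih.2, h2.2, succ_nsmul]

variable (t Δ q c)

/-- The products of two modes of the fermionic fields. -/
def quad (p i : ℤ) : Words →ₗ[ℂ] Words := t.grT Δ q c (.G i) ∘ₗ t.grT Δ q c (.Q (p - 1 - i))

variable {t Δ q c}

theorem quad_eq (p i : ℤ) (v : Words) : t.quad Δ q c p i v =
    -t.grT Δ q c (.Q (p - 1 - i)) (t.grT Δ q c (.G i) v) + if p = 0 then (2 : ℂ) • t.lam Δ q c v else 0 := by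
  rw [quad, LinearMap.comp_apply, G_Q]
  congr 1
  exact if_congr (by omega) rfl rfl

/-- For very negative `i` the inner mode kills the vector. For large `i` the factors must first be
exchanged, and the contraction appears exactly when `p = 0`. -/
theorem quad_eventually (p : ℤ) (v : Words) : ∃ N : ℤ, (∀ i < -N, t.quad Δ q c p i v = 0) ∧
    ∀ i, N ≤ i → t.quad Δ q c p i v = if p = 0 then (2 : ℂ) • t.lam Δ q c v else 0 := by
  obtain ⟨N, hN⟩ := exists_kill (t := t) (Δ := Δ) (q := q) (c := c) v
  refine ⟨max N (N - p), fun i hi => ?_, fun i hi => ?_⟩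
  · rw [quad, LinearMap.comp_apply, (hN (p - 1 - i) (by omega)).2, map_zero]
  · rw [quad_eq, (hN i (by omega)).1, map_zero, neg_zero, zero_add]

theorem quad_finite {p : ℤ} (hp : 1 ≤ p) (v : Words) :
    (Function.support fun i => t.quad Δ q c p i v).Finite := by
  obtain ⟨N, h0, h1⟩ := quad_eventually (t := t) (Δ := Δ) (q := q) (c := c) p v
  refine (Set.finite_Icc (-N) N).subset fun i hi => ?_
  rw [Function.mem_support] at hi
  refine ⟨not_lt.1 fun h => hi (h0 i h), not_lt.1 fun h => hi ?_⟩
  rw [h1 i h.le, if_neg (by omega)]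

variable (t Δ q c)

/-- The modes of the product of the two fermionic fields. -/
def modeProd (p : ℤ) (hp : 1 ≤ p) : Words →ₗ[ℂ] Words where
  toFun v := ∑ᶠ i, t.quad Δ q c p i v
  map_add' v w := by
    simp only [map_add]
    exact finsum_add_distrib (quad_finite hp v) (quad_finite hp w)
  map_smul' a v := by
    simp only [map_smul, RingHom.id_apply]
    exact (smul_finsum' a (quad_finite hp v)).symm

/-- The modes of the part of the field `H` that commutes with the fermions. -/
def decoupled (p : ℤ) (hp : 1 ≤ p) : Words →ₗ[ℂ] Words :=
  t.lam Δ q c ∘ₗ t.grT Δ q c (.H p) - (t.sg / 2) • t.modeProd Δ q c p hp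

variable {t Δ q c} {p : ℤ} (hp : 1 ≤ p)

theorem modeProd_apply (v : Words) :
    t.modeProd Δ q c p hp v = ∑ᶠ i, t.quad Δ q c p i v := rfl

theorem map_modeProd (f : Words →ₗ[ℂ] Words) (v : Words) :
    ∑ᶠ i, f (t.quad Δ q c p i v) = f (t.modeProd Δ q c p hp v) :=
  (f.toAddMonoidHom.map_finsum (quad_finite hp v)).symm

theorem modeProd_add (f : Words →ₗ[ℂ] Words) (v : Words) (g : ℤ → Words)
    (hg : (Function.support g).Finite) :
    ∑ᶠ i, (f (t.quad Δ q c p i v) + g i) = f (t.modeProd Δ q c p hp v) + ∑ᶠ i, g i := by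
  have hf : (Function.support fun i => f (t.quad Δ q c p i v)).Finite :=
    Set.Finite.subset (quad_finite (t := t) (Δ := Δ) (q := q) (c := c) hp v) fun i hi => by
      rw [Function.mem_support] at hi ⊢
      exact fun h => hi (by rw [h, map_zero])
  rw [finsum_add_distrib hf hg, map_modeProd]

theorem modeProd_L (n : ℤ) (v : Words) :
    t.modeProd Δ q c p hp (t.grT Δ q c (.L n) v) = t.grT Δ q c (.L n) (t.modeProd Δ q c p hp v) := by
  rw [modeProd_apply, ← map_modeProd hp (t.grT Δ q c (.L n))]
  refine finsum_congr fun i => ?_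
  rw [quad, LinearMap.comp_apply, LinearMap.comp_apply, ← L_comm n _ (by simp),
    ← L_comm n _ (by simp)]

theorem modeProd_G (k : ℤ) (v : Words) :
    t.modeProd Δ q c p hp (t.grT Δ q c (.G k) v) = t.grT Δ q c (.G k) (t.modeProd Δ q c p hp v) +
      (2 : ℂ) • t.lam Δ q c (t.grT Δ q c (.G (p + k)) v) := by
  have h : ∀ i, t.quad Δ q c p i (t.grT Δ q c (.G k) v) = t.grT Δ q c (.G k) (t.quad Δ q c p i v) +
      if i = p + k then (2 : ℂ) • t.lam Δ q c (t.grT Δ q c (.G (p + k)) v) else 0 := by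
    intro i
    rw [quad, LinearMap.comp_apply, LinearMap.comp_apply, Q_G, map_add, map_neg, G_G i k, neg_neg]
    congr 1
    -- The only contraction of `G k` with the second factor `Q (p - 1 - i)`.
    by_cases h : i = p + k
    · subst h
      rw [if_pos (by ring), if_pos rfl, map_smul, lam_comm]
    · rw [if_neg (by omega), if_neg h, map_zero]
  rw [modeProd_apply]
  simp only [h]
  rw [modeProd_add hp, finsum_eq_single _ (p + k) (fun i hi => if_neg hi), if_pos rfl]
  exact (Set.finite_singleton (p + k)).subset fun i hi => by
    by_contra h; exact hi (if_neg h)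

theorem modeProd_Q (k : ℤ) (v : Words) :
    t.modeProd Δ q c p hp (t.grT Δ q c (.Q k) v) = t.grT Δ q c (.Q k) (t.modeProd Δ q c p hp v) -
      (2 : ℂ) • t.lam Δ q c (t.grT Δ q c (.Q (p + k)) v) := by
  have h : ∀ i, t.quad Δ q c p i (t.grT Δ q c (.Q k) v) = t.grT Δ q c (.Q k) (t.quad Δ q c p i v) +
      if i = -1 - k then -((2 : ℂ) • t.lam Δ q c (t.grT Δ q c (.Q (p + k)) v)) else 0 := by
    intro i
    rw [quad, LinearMap.comp_apply, LinearMap.comp_apply, Q_Q, map_neg, G_Q i k, neg_add, neg_neg]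
    congr 1
    -- The only contraction of `Q k` with the first factor `G i`.
    by_cases h : i = -1 - k
    · subst h
      rw [if_pos (by ring), if_pos rfl, show p - 1 - (-1 - k) = p + k by ring]
    · rw [if_neg (by omega), if_neg h, neg_zero]
  rw [modeProd_apply]
  simp only [h]
  rw [modeProd_add hp, finsum_eq_single _ (-1 - k) (fun i hi => if_neg hi), if_pos rfl,
    sub_eq_add_neg]
  exact (Set.finite_singleton (-1 - k)).subset fun i hi => by
    by_contra h; exact hi (if_neg h)

/-- The current of H shifts the two factors with opposite signs, so formally the commutator is a sum
minus its own shift. The telescoping boundary term is the Schwinger term. -/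
theorem modeProd_H (j : ℕ) (v : Words) :
    t.modeProd Δ q c p hp (t.grT Δ q c (.H (-j)) v) = t.grT Δ q c (.H (-j)) (t.modeProd Δ q c p hp v) +
      if p = j then (2 * p * t.sg) • t.lam Δ q c v else 0 := by
  have h : ∀ i, t.quad Δ q c p i (t.grT Δ q c (.H (-j)) v) = t.grT Δ q c (.H (-j)) (t.quad Δ q c p i v) +
      t.sg • (t.quad Δ q c (p - j) i v - t.quad Δ q c (p - j) (i - j) v) := by
    intro i
    have e1 := H_Q (t := t) (Δ := Δ) (q := q) (c := c) (-j) (p - 1 - i) v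
    have e2 := H_G (t := t) (Δ := Δ) (q := q) (c := c) (-j) i (t.grT Δ q c (.Q (p - 1 - i)) v)
    have e3 : t.grT Δ q c (.Q (p - 1 - i)) (t.grT Δ q c (.H (-j)) v) = t.grT Δ q c (.H (-j)) (t.grT Δ q c (.Q (p - 1 - i)) v) +
        t.sg • t.grT Δ q c (.Q (-j + (p - 1 - i))) v := by
      rw [e1, sub_add_cancel]
    simp only [quad, LinearMap.comp_apply]
    rw [e2, show p - j - 1 - (i - j) = p - 1 - i by ring, show i - (j : ℤ) = -j + i by ring,
      show p - j - 1 - i = -j + (p - 1 - i) by ring, e3, map_add, map_smul]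
    module
  obtain ⟨N, h0, h1⟩ := quad_eventually (t := t) (Δ := Δ) (q := q) (c := c) (p - j) v
  have h2 := finsum_sub_shift _ _ N h0 h1 j
  rw [modeProd_apply]
  simp only [h]
  rw [modeProd_add hp, ← smul_finsum' _ h2.1, h2.2]
  · congr 1
    by_cases hj : p = j
    · subst hj
      simp only [sub_self, if_true, Int.cast_natCast, ← Nat.cast_smul_eq_nsmul ℂ, smul_smul]
      congr 1
      ring
    · rw [if_neg hj, if_neg (by omega)]
      simp
  · exact h2.1.subset fun i hi h => hi (by simp only [h, smul_zero])

theorem decoupled_apply (v : Words) : t.decoupled Δ q c p hp v =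
    t.lam Δ q c (t.grT Δ q c (.H p) v) - (t.sg / 2) • t.modeProd Δ q c p hp v := rfl

theorem decoupled_L (n : ℤ) (v : Words) :
    t.decoupled Δ q c p hp (t.grT Δ q c (.L n) v) = t.grT Δ q c (.L n) (t.decoupled Δ q c p hp v) := by
  rw [decoupled_apply, decoupled_apply, modeProd_L, H_L, lam_comm, map_sub, map_smul]

/-- The shifts of `G k` produced by the current of H and by the fermion bilinear cancel, which fixes
the coefficient `t.sg / 2`. -/
theorem decoupled_G (k : ℤ) (v : Words) :
    t.decoupled Δ q c p hp (t.grT Δ q c (.G k) v) = t.grT Δ q c (.G k) (t.decoupled Δ q c p hp v) := by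
  rw [decoupled_apply, decoupled_apply, modeProd_G, H_G, map_add, lam_comm, map_sub, map_smul,
    map_smul]
  module

theorem decoupled_Q (k : ℤ) (v : Words) :
    t.decoupled Δ q c p hp (t.grT Δ q c (.Q k) v) = t.grT Δ q c (.Q k) (t.decoupled Δ q c p hp v) := by
  rw [decoupled_apply, decoupled_apply, modeProd_Q, H_Q, map_sub, lam_comm, map_sub, map_smul,
    map_smul]
  module

/-- The level of the decoupled current: `c / 3` comes from the bracket of the H modes and `-1` from
the anomaly of the bilinear. It vanishes precisely at c = 3. -/
theorem decoupled_H (j : ℕ) (w : List Gen) :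
    t.decoupled Δ q c p hp (t.gw Δ q c (.H (-j) :: w)) = t.grT Δ q c (.H (-j)) (t.decoupled Δ q c p hp (t.gw Δ q c w)) +
      if p = j then (p * (c / 3 - 1)) • t.lam Δ q c (t.gw Δ q c w) else 0 := by
  rw [← grT_gw, decoupled_apply, decoupled_apply, modeProd_H, H_H, map_add, lam_comm, map_sub,
    map_smul, map_smul, C_gw]
  by_cases h : p = j
  · rw [if_pos (by omega), if_pos h, if_pos h, smul_add, smul_smul, map_smul]
    have e : t.sg / 2 * (2 * p * t.sg) = p := by linear_combination (p : ℂ) * t.sg_mul_self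
    rw [e]
    module
  · rw [if_neg (by omega), if_neg h, if_neg h]
    module

theorem decoupled_nil : t.decoupled Δ q c p hp (t.gw Δ q c []) = 0 := by
  have h1 : t.grT Δ q c (.H p) (t.gw Δ q c []) = 0 := grT_vac (by change 0 ≤ p; omega) fun _ => by
    change (if p = 0 then q else 0) = 0
    rw [if_neg (by omega)]
  have h2 : ∀ i, t.quad Δ q c p i (t.gw Δ q c []) = 0 := by
    intro i
    -- For `i ≥ 0` the mode `G i` reaches the vacuum after an exchange without contraction, as `p ≥
    -- 1`; for `i < 0` the index `p - 1 - i` is positive.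
    by_cases hi : 0 ≤ i
    · rw [quad_eq, grT_vac (x := .G i) hi (by simp [Gen.deg]), if_neg (by omega)]
      simp
    · rw [quad, LinearMap.comp_apply, grT_vac (x := .Q (p - 1 - i)) (by change 1 ≤ _; omega)
        (by simp [Gen.deg]), map_zero]
  rw [decoupled_apply, h1, modeProd_apply]
  simp [h2]

/-- `decoupled` annihilates words without the conjugate letter. -/
theorem decoupled_free {w : List Gen} (hw : ∀ x ∈ w, ¬ x.hwt) (h : Gen.H (-p) ∉ w) :
    t.decoupled Δ q c p hp (t.gw Δ q c w) = 0 := by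
  induction w with
  | nil => exact decoupled_nil hp
  | cons x w ih =>
    have hw' := ih (fun z hz => hw z (by simp [hz])) (by simp at h; tauto)
    have hx := hw x (by simp)
    cases x with
    | L n => rw [← grT_gw, decoupled_L, hw', map_zero]
    | G n => rw [← grT_gw, decoupled_G, hw', map_zero]
    | Q n => rw [← grT_gw, decoupled_Q, hw', map_zero]
    | C => exact absurd trivial hx
    | H n =>
      have hn : ¬ 0 ≤ n := hx
      have e : n = -(n.natAbs : ℤ) := by omega
      have h2 : p ≠ n.natAbs := fun h2 => h (by rw [h2, ← e]; simp)
      rw [e, decoupled_H, hw', if_neg h2]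
      simp

end Kind
end TopN2
end

/-! ### Number operators for the letters of a word. -/

noncomputable section

namespace TopN2
namespace Kind

variable (t : Kind) (Δ q c : ℂ)

/-- Multiplication of the coefficients of a vector by a function of the words. -/
def diag (f : List Gen → ℂ) : Words →ₗ[ℂ] Words :=
  Finsupp.linearCombination ℂ fun w => f w • Finsupp.single w 1

variable {t Δ q c}

theorem diag_apply (f : List Gen → ℂ) (v : Words) (w : List Gen) : diag f v w = f w * v w := by
  induction v using Finsupp.induction_linear with
  | zero => simp
  | add a b ha hb => simp [ha, hb, mul_add]
  | single u a =>
    simp only [diag, Finsupp.linearCombination_single, Finsupp.smul_apply, Finsupp.single_apply,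
      smul_eq_mul]
    split_ifs with h
    · rw [h]; ring
    · simp

theorem mem_support_diag {f : List Gen → ℂ} {v : Words} {w : List Gen} :
    w ∈ (diag f v).support ↔ f w ≠ 0 ∧ w ∈ v.support := by
  simp [diag_apply]

theorem Normal.diag {v : Words} (hv : Normal v) (f : List Gen → ℂ) : Normal (diag f v) :=
  fun w hw => hv w (mem_support_diag.1 hw).2

theorem eq_of_words {M N : Words →ₗ[ℂ] Words} {v : Words}
    (h : ∀ w ∈ v.support, M (Finsupp.single w 1) = N (Finsupp.single w 1)) : M v = N v := by
  rw [← v.sum_single, Finsupp.sum, map_sum, map_sum]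
  refine Finset.sum_congr rfl fun w hw => ?_
  rw [← mul_one (v w), ← smul_eq_mul, ← Finsupp.smul_single, map_smul, map_smul, h w hw]

theorem eq_lam_diag {N : Words →ₗ[ℂ] Words} {v : Words} (hv : Normal v) (f : List Gen → ℂ)
    (h : ∀ w ∈ v.support, N (t.gw Δ q c w) = f w • t.lam Δ q c (t.gw Δ q c w)) : N v = t.lam Δ q c (diag f v) := by
  refine eq_of_words (N := t.lam Δ q c ∘ₗ diag f) fun w hw => ?_
  rw [← gw_good (t := t) (Δ := Δ) (q := q) (c := c) (hv w hw), h w hw, LinearMap.comp_apply,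
    gw_good (hv w hw), diag, Finsupp.linearCombination_single, one_smul, map_smul]

/-- A number operator whose value on a vector vanishes. -/
theorem not_mem_of_number {N : Words →ₗ[ℂ] Words} {v : Words} (hv : Normal v) {y : Gen} {a : ℂ}
    (ha : a ≠ 0) (h : ∀ w ∈ v.support, N (t.gw Δ q c w) = (a * w.count y) • t.lam Δ q c (t.gw Δ q c w)) (h0 : N v = 0) :
    ∀ w ∈ v.support, y ∉ w := by
  intro w hw hy
  have h1 := eq_zero_of_lam (hv.diag _) ((eq_lam_diag hv _ h).symm.trans h0)
  have h2 := DFunLike.congr_fun h1 w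
  rw [diag_apply, Finsupp.zero_apply, mul_eq_zero] at h2
  rcases h2 with h2 | h2
  · have h3 : w.count y ≠ 0 := by rwa [Ne, List.count_eq_zero, not_not]
    exact mul_ne_zero ha (by exact_mod_cast h3) h2
  · exact Finsupp.mem_support_iff.1 hw h2

/-- The criterion for a number operator. -/
theorem number_op {N : Words →ₗ[ℂ] Words} {y : Gen} {a : ℂ} {P : Gen → Prop} (h0 : N (t.gw Δ q c []) = 0)
    (h : ∀ x, P x → ∀ v, N (t.grT Δ q c x v) = t.grT Δ q c x (N v) + if x = y then a • t.lam Δ q c (t.grT Δ q c x v) else 0)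
    {w : List Gen} (hw : ∀ x ∈ w, P x) : N (t.gw Δ q c w) = (a * w.count y) • t.lam Δ q c (t.gw Δ q c w) := by
  induction w with
  | nil => simp [h0]
  | cons x w ih =>
    rw [← grT_gw, h x (hw x (by simp)), ih fun z hz => hw z (by simp [hz]), map_smul, lam_comm,
      List.count_cons]
    by_cases hx : x = y
    · simp only [hx, if_true, beq_self_eq_true, Nat.cast_add, Nat.cast_one]
      module
    · simp [hx]

theorem not_hwt_of_good {w : List Gen} (hw : Good w) : ∀ x ∈ w, ¬ x.hwt := hw.lower

/-- The mode `L (l - 1)` kills the vacuum and contracts only with `L (-l)`, each time giving 2 (l -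
1) + 1 times λ; the prefactor puts the removed letter back. -/
theorem L_number {l : ℤ} (hl : 2 ≤ l) {w : List Gen} (hw : ∀ x ∈ w, ¬ x.hwt) :
    (t.grT Δ q c (.L (-l)) ∘ₗ t.grT Δ q c (.L (l - 1))) (t.gw Δ q c w) = ((2 * l - 1 : ℂ) * w.count (.L (-l))) • t.lam Δ q c (t.gw Δ q c w) := by
  refine number_op (P := fun x => ¬ x.hwt) ?_ (fun x hx v => ?_) hw
  · rw [LinearMap.comp_apply, grT_vac (by change 0 ≤ l - 1; omega) (by
      have := Gen.deg_L_le (l - 1); omega), map_zero]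
  · simp only [LinearMap.comp_apply]
    by_cases hL : ∃ n, x = .L n
    · obtain ⟨n, rfl⟩ := hL
      have hn : ¬ 0 ≤ n := hx
      rw [L_L (l - 1) n (by omega) v, map_add, L_L_neg (p := -l) (n := n) (by omega) (by omega), lam_comm]
      congr 1
      rw [show -1 - (l - 1) = -l by ring]
      split_ifs with h
      · obtain rfl := Gen.L.inj h
        rw [map_smul]
        congr 1
        push_cast
        ring
      · simp
    · push Not at hL
      rw [L_comm _ _ hL, L_comm _ _ hL, if_neg (hL _), add_zero]

theorem H_number {p : ℤ} (hp : 1 ≤ p) {w : List Gen} (hw : Good w) :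
    (t.grT Δ q c (.H (-p)) ∘ₗ t.decoupled Δ q c p hp) (t.gw Δ q c w) =
      ((p * (c / 3 - 1)) * w.count (.H (-p))) • t.lam Δ q c (t.gw Δ q c w) := by
  simp only [LinearMap.comp_apply]
  have hfree : ∀ w, Good w → Gen.H (-p) ∉ w → t.grT Δ q c (.H (-p)) (t.decoupled Δ q c p hp (t.gw Δ q c w)) =
      ((p * (c / 3 - 1)) * w.count (.H (-p))) • t.lam Δ q c (t.gw Δ q c w) := by
    intro w hw h
    rw [decoupled_free hp (not_hwt_of_good hw) h, List.count_eq_zero_of_not_mem h]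
    simp
  induction w with
  | nil => exact hfree _ hw (by simp)
  | cons x w ih =>
    have ih' := ih (hw.sublist (List.sublist_cons_self x w))
    have hx := not_hwt_of_good hw x (by simp)
    have hs := (List.pairwise_cons.1 hw.sorted).1
    cases x with
    | L n =>
      rw [← grT_gw, decoupled_L, H_L, ih', map_smul, lam_comm]
      simp
    | G n =>
      -- In the sorted word all H's precede the fermions, so no `H (-p)` is left once a fermion is
      -- met. This avoids moving `H (-p)` past fermions, with which it does not commute.
      refine hfree _ hw fun h => ?_
      have h1 := Gen.cls_le_of_le (hs _ (by simpa using h))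
      simp only [Gen.cls, Gen.key] at h1
      split_ifs at h1 <;> simp at h1 <;> omega
    | Q n =>
      refine hfree _ hw fun h => ?_
      have h1 := Gen.cls_le_of_le (hs _ (by simpa using h))
      simp only [Gen.cls, Gen.key] at h1
      split_ifs at h1 <;> simp at h1 <;> omega
    | C => exact absurd trivial hx
    | H n =>
      have hn : ¬ 0 ≤ n := hx
      have e : n = -(n.natAbs : ℤ) := by omega
      have h1 := decoupled_H hp n.natAbs w (t := t) (Δ := Δ) (q := q) (c := c)
      rw [← e] at h1
      rw [h1, map_add, H_H, if_neg (by omega), ih', ← grT_gw, lam_comm, map_smul]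
      by_cases h2 : n = -p
      · rw [if_pos (by omega), h2, map_smul, List.count_cons_self]
        push_cast
        module
      · rw [if_neg (by omega), List.count_cons_of_ne (by simpa using h2)]
        simp

/-- Letters H are excluded because they do not commute with the fermions; they are dealt with
beforehand through the decoupled current. -/
theorem Q_number {p : ℤ} (hp : 0 ≤ p) {w : List Gen} (hw : ∀ x ∈ w, ¬ x.hwt)
    (hH : ∀ x ∈ w, ∀ n, x ≠ .H n) :
    (t.grT Δ q c (.Q (-p - 1)) ∘ₗ t.grT Δ q c (.G p)) (t.gw Δ q c w) = ((2 : ℂ) * w.count (.Q (-p - 1))) • t.lam Δ q c (t.gw Δ q c w) := by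
  refine number_op (P := fun x => ¬ x.hwt ∧ ∀ n, x ≠ .H n) ?_ (fun x hx v => ?_)
    fun x h => ⟨hw x h, hH x h⟩
  · rw [LinearMap.comp_apply, grT_vac (x := .G p) hp (by simp [Gen.deg]), map_zero]
  · simp only [LinearMap.comp_apply]
    cases x with
    | L n => rw [← L_comm n _ (by simp), ← L_comm n _ (by simp)]; simp
    | H n => exact absurd rfl (hx.2 n)
    | C => exact absurd trivial hx.1
    | G n =>
      have hn : ¬ 0 ≤ n := hx.1
      rw [G_G, map_neg, Q_G, if_neg (by omega)]
      simp
    | Q n =>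
      rw [G_Q, map_add, map_neg, Q_Q, neg_neg]
      congr 1
      by_cases h : n = -p - 1
      · subst h
        rw [if_pos (by ring), if_pos rfl, map_smul, lam_comm]
      · rw [if_neg (by omega), if_neg (by simpa using h), map_zero]

theorem G_number {p : ℤ} (hp : 1 ≤ p) {w : List Gen} (hw : ∀ x ∈ w, ¬ x.hwt)
    (hH : ∀ x ∈ w, ∀ n, x ≠ .H n) :
    (t.grT Δ q c (.G (-p - 1)) ∘ₗ t.grT Δ q c (.Q p)) (t.gw Δ q c w) = ((2 : ℂ) * w.count (.G (-p - 1))) • t.lam Δ q c (t.gw Δ q c w) := by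
  refine number_op (P := fun x => ¬ x.hwt ∧ ∀ n, x ≠ .H n) ?_ (fun x hx v => ?_)
    fun x h => ⟨hw x h, hH x h⟩
  · rw [LinearMap.comp_apply, grT_vac (x := .Q p) hp (by simp [Gen.deg]), map_zero]
  · simp only [LinearMap.comp_apply]
    cases x with
    | L n => rw [← L_comm n _ (by simp), ← L_comm n _ (by simp)]; simp
    | H n => exact absurd rfl (hx.2 n)
    | C => exact absurd trivial hx.1
    | Q n =>
      have hn : ¬ 1 ≤ n := hx.1
      rw [Q_Q, map_neg, G_Q, if_neg (by omega)]
      simp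
    | G n =>
      rw [Q_G, map_add, map_neg, G_G, neg_neg]
      congr 1
      by_cases h : n = -p - 1
      · subst h
        rw [if_pos (by ring), if_pos rfl, map_smul, lam_comm]
      · rw [if_neg (by omega), if_neg (by simpa using h), map_zero]

/-- The letters of the words in normal form that survive in the kernel of the positive modes. -/
def lowLetters : Set Gen := {.L (-1), .G (-1), .Q (-1), .Q 0}

/-- A number operator that ends in a positive mode kills `v`, so its letter is absent. The four low
letters escape: `L (-1)` is central, and the conjugates of `G (-1)`, `Q (-1)`, `Q 0` are `Q 0`, `G
0`, `G (-1)`, none of which is positive. -/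
theorem mem_lowLetters_of {v : Words} (hv : Normal v)
    (hL : ∀ p, 1 ≤ p → t.grT Δ q c (.L p) v = 0) (hG : ∀ p, 1 ≤ p → t.grT Δ q c (.G p) v = 0)
    (hQ : ∀ p, 1 ≤ p → t.grT Δ q c (.Q p) v = 0) (hH : ∀ w ∈ v.support, ∀ p, 1 ≤ p → Gen.H (-p) ∉ w) :
    ∀ w ∈ v.support, ∀ x ∈ w, x ∈ lowLetters := by
  have hH' : ∀ w ∈ v.support, ∀ x ∈ w, ∀ n, x ≠ .H n := by
    rintro w hw x hx n rfl
    have hn : ¬ 0 ≤ n := not_hwt_of_good (hv w hw) _ hx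
    exact hH w hw (-n) (by omega) (by simpa using hx)
  intro w hw x hx
  have hlow := not_hwt_of_good (hv w hw) x hx
  cases x with
  | L n =>
    have hn : ¬ 0 ≤ n := hlow
    by_cases h : n = -1
    · simp [lowLetters, h]
    · refine absurd hx ?_
      have h1 := not_mem_of_number (N := t.grT Δ q c (.L (-(-n))) ∘ₗ t.grT Δ q c (.L (-n - 1))) hv
        (y := .L (-(-n))) (a := 2 * (-n : ℤ) - 1) ?_ (fun w hw => L_number (by omega)
          (not_hwt_of_good (hv w hw))) ?_ w hw
      · simpa using h1
      · have : (2 * (-n) - 1 : ℤ) ≠ 0 := by omega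
        exact_mod_cast this
      · rw [LinearMap.comp_apply, hL _ (by omega), map_zero]
  | H n => exact absurd rfl (hH' w hw _ hx n)
  | C => exact absurd trivial hlow
  | G n =>
    have hn : ¬ 0 ≤ n := hlow
    by_cases h : n = -1
    · simp [lowLetters, h]
    · refine absurd hx ?_
      have h1 := not_mem_of_number hv two_ne_zero (fun w hw => G_number (t := t) (Δ := Δ)
        (q := q) (c := c) (p := -n - 1) (by omega) (not_hwt_of_good (hv w hw)) (hH' w hw)) ?_ w hw
      · simpa using h1
      · rw [LinearMap.comp_apply, hQ _ (by omega), map_zero]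
  | Q n =>
    have hn : ¬ 1 ≤ n := hlow
    by_cases h : n = -1
    · simp [lowLetters, h]
    by_cases h' : n = 0
    · simp [lowLetters, h']
    · refine absurd hx ?_
      have h1 := not_mem_of_number hv two_ne_zero (fun w hw => Q_number (t := t) (Δ := Δ)
        (q := q) (c := c) (p := -n - 1) (by omega) (not_hwt_of_good (hv w hw)) (hH' w hw)) ?_ w hw
      · simpa using h1
      · rw [LinearMap.comp_apply, hG _ (by omega), map_zero]

theorem sg_ne_zero : t.sg ≠ 0 := by cases t <;> simp [sg]

theorem decoupled_of_killed {p : ℤ} (hp : 1 ≤ p) {v : Words}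
    (hH : t.grT Δ q c (.H p) v = 0) (hG : ∀ p, 1 ≤ p → t.grT Δ q c (.G p) v = 0)
    (hQ : ∀ p, 1 ≤ p → t.grT Δ q c (.Q p) v = 0) : t.decoupled Δ q c p hp v =
      if p = 1 then (t.sg / 2) • t.grT Δ q c (.Q 0) (t.grT Δ q c (.G 0) v) else 0 := by
  have h : ∀ i, t.quad Δ q c p i v = if i = 0 then
      (if p = 1 then -t.grT Δ q c (.Q 0) (t.grT Δ q c (.G 0) v) else 0) else 0 := by
    intro i
    -- A bilinear survives only if neither factor can be made a positive mode acting first: `i ≤ 0`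
    -- and `p - 1 - i ≤ 0` force `p = 1` and `i = 0`.
    by_cases h1 : 1 ≤ p - 1 - i
    · rw [quad, LinearMap.comp_apply, hQ _ h1, map_zero]
      split_ifs <;> first | rfl | omega
    · rw [quad_eq, if_neg (by omega), add_zero]
      by_cases h2 : 1 ≤ i
      · rw [hG _ h2, if_neg (by omega)]; simp
      · obtain rfl : p = 1 := by omega
        obtain rfl : i = 0 := by omega
        simp
  rw [decoupled_apply, hH, modeProd_apply, finsum_congr h,
    finsum_eq_single _ 0 (fun i hi => if_neg hi), if_pos rfl]
  split_ifs <;> simp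

/-- Past the central letters the word starts with `G (-1)`. Moving `Q 0` through it leaves the
contraction 2 λ and a term with the square of `G (-1)`, which is zero. -/
theorem G_Q_zero_of_mem {w : List Gen} (hw : Good w) (hlow : ∀ x ∈ w, x ∈ lowLetters)
    (h : Gen.G (-1) ∈ w) : t.grT Δ q c (.G (-1)) (t.grT Δ q c (.Q 0) (t.gw Δ q c w)) = (2 : ℂ) • t.lam Δ q c (t.gw Δ q c w) := by
  induction w with
  | nil => simp at h
  | cons x w ih =>
    have ih' := ih (hw.sublist (List.sublist_cons_self x w)) fun z hz => hlow z (by simp [hz])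
    have hx := hlow x (by simp)
    by_cases hx1 : x = .L (-1)
    · subst hx1
      rw [← grT_gw, ← L_comm _ _ (by simp), ← L_comm _ _ (by simp), ih' (by simpa using h),
        map_smul]
    by_cases hx2 : x = .G (-1)
    · subst hx2
      rw [← grT_gw, Q_G, if_pos (by ring), map_add, map_neg, map_smul, lam_comm]
      have h1 := G_G (t := t) (Δ := Δ) (q := q) (c := c) (-1) (-1) (t.grT Δ q c (.Q 0) (t.gw Δ q c w))
      rw [eq_neg_iff_add_eq_zero, ← two_smul ℂ, smul_eq_zero] at h1
      rw [h1.resolve_left two_ne_zero]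
      simp
    · exfalso
      have h1 := Gen.cls_le_of_le ((List.pairwise_cons.1 hw.sorted).1 (.G (-1))
        (by simpa [Ne.symm hx2] using h))
      simp only [lowLetters, Set.mem_insert_iff, Set.mem_singleton_iff, hx1, hx2, false_or] at hx
      rcases hx with rfl | rfl <;> simp [Gen.cls, Gen.key] at h1

/-- The words in normal form that make up the ordering kernels. -/
def KernelShape (w : List Gen) : Prop :=
  ((∀ x ∈ w, x = .H (-1) ∨ x = .L (-1) ∨ x = .Q 0) ∧ w.count (.H (-1)) = 1) ∨
    ((∀ x ∈ w, x ∈ lowLetters) ∧ ¬ (Gen.G (-1) ∈ w ∧ Gen.Q (-1) ∈ w))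

end Kind
end TopN2
end

/-! ### The kernel of the positive modes in the graded module. -/

noncomputable section

namespace TopN2
namespace Kind

variable {t : Kind} {Δ q c : ℂ}

theorem Normal.smul {v : Words} (hv : Normal v) (a : ℂ) : Normal (a • v) :=
  fun w hw => hv w (Finsupp.support_smul hw)

theorem good_cons_H {w : List Gen} (hw : Good w)
    (h : ∀ x ∈ w, x ∈ lowLetters) : Good (.H (-1) :: w) := by
  refine Good.append (u := [.H (-1)]) ⟨by simp, ?_, ?_⟩ hw 2 ?_ ?_
  · intro x hx ho
    rw [List.mem_singleton] at hx
    subst hx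
    cases ho
  · intro x hx
    rw [List.mem_singleton] at hx
    subst hx
    change ¬ (0 ≤ (-1 : ℤ))
    omega
  · intro x hx
    rw [List.mem_singleton] at hx
    subst hx
    simp [Gen.cls, Gen.key]
  · intro x hx
    have h1 := h x hx
    simp only [lowLetters, Set.mem_insert_iff, Set.mem_singleton_iff] at h1
    rcases h1 with rfl | rfl | rfl | rfl <;> simp [Gen.cls, Gen.key]

/-- The letter `H (-1)` precedes all low letters in the ordering, so acting by it only prefixes the
word. -/
theorem H_apply {v : Words} (hv : Normal v) (h : ∀ w ∈ v.support, ∀ x ∈ w, x ∈ lowLetters)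
    (w : List Gen) : t.grT Δ q c (.H (-1)) v (.H (-1) :: w) = v w := by
  have h1 : t.grT Δ q c (.H (-1)) v = v.mapDomain (List.cons (.H (-1))) := by
    conv_lhs => rw [← v.sum_single]
    rw [Finsupp.mapDomain, Finsupp.sum, Finsupp.sum, map_sum]
    refine Finset.sum_congr rfl fun w hw => ?_
    rw [← mul_one (v w), ← smul_eq_mul, ← Finsupp.smul_single, map_smul, grT_single,
      gw_good (good_cons_H (hv w hw) (h w hw))]
    simp
  rw [h1, Finsupp.mapDomain_apply List.cons_injective]

/-- The vectors in the kernel of the positive modes of the associated graded module are determined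
by the coefficients of the words in the ordering kernels. -/
theorem gr_kernel (hc : c ≠ 3) {v : Words} (hv : Normal v)
    (hL : ∀ p, 1 ≤ p → t.grT Δ q c (.L p) v = 0) (hH : ∀ p, 1 ≤ p → t.grT Δ q c (.H p) v = 0)
    (hG : ∀ p, 1 ≤ p → t.grT Δ q c (.G p) v = 0) (hQ : ∀ p, 1 ≤ p → t.grT Δ q c (.Q p) v = 0)
    (hker : ∀ w ∈ v.support, ¬ KernelShape w) : v = 0 := by
  have hcoef : ∀ p : ℤ, 1 ≤ p → (p * (c / 3 - 1) : ℂ) ≠ 0 := by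
    intro p hp
    refine mul_ne_zero (by exact_mod_cast (by omega : p ≠ 0)) fun h => hc ?_
    linear_combination 3 * h
  -- The obstruction to `K_1 v = 0`. It inherits the positive-mode conditions for L and the
  -- fermions, and is also killed by `G 0` and `Q 0`.
  set u := t.grT Δ q c (.Q 0) (t.grT Δ q c (.G 0) v) with hu_def
  have hu : Normal u := normal_grT _ _
  have sqG : t.grT Δ q c (.G 0) (t.grT Δ q c (.G 0) v) = 0 := by
    have h1 := G_G (t := t) (Δ := Δ) (q := q) (c := c) 0 0 v
    rwa [eq_neg_iff_add_eq_zero, ← two_smul ℂ, smul_eq_zero, or_iff_right two_ne_zero] at h1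
  have sqQ : t.grT Δ q c (.Q 0) u = 0 := by
    have h1 := Q_Q (t := t) (Δ := Δ) (q := q) (c := c) 0 0 (t.grT Δ q c (.G 0) v)
    rwa [eq_neg_iff_add_eq_zero, ← two_smul ℂ, smul_eq_zero, or_iff_right two_ne_zero] at h1
  have uL : ∀ p, 1 ≤ p → t.grT Δ q c (.L p) u = 0 := by
    intro p hp
    rw [hu_def, L_comm _ _ (by simp), L_comm _ _ (by simp), hL p hp, map_zero, map_zero]
  have uG : ∀ p, 0 ≤ p → t.grT Δ q c (.G p) u = 0 := by
    intro p hp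
    rw [hu_def, G_Q, if_neg (by omega), G_G]
    rcases hp.eq_or_lt with rfl | hp
    · rw [sqG]; simp
    · rw [hG p hp]; simp
  have uQ : ∀ p, 1 ≤ p → t.grT Δ q c (.Q p) u = 0 := by
    intro p hp
    rw [hu_def, Q_Q, Q_G, if_neg (by omega), hQ p hp]
    simp
  have vK : ∀ p (hp : 1 ≤ p), t.decoupled Δ q c p hp v = if p = 1 then (t.sg / 2) • u else 0 :=
    fun p hp => decoupled_of_killed hp (hH p hp) hG hQ
  have uK : ∀ p (hp : 1 ≤ p), t.decoupled Δ q c p hp u = 0 := by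
    intro p hp
    rw [hu_def, decoupled_Q, decoupled_G, vK p hp]
    split_ifs with h
    · rw [map_smul, uG 0 le_rfl]; simp
    · simp
  have u_low : ∀ w ∈ u.support, ∀ x ∈ w, x ∈ lowLetters := by
    refine mem_lowLetters_of hu uL (fun p hp => uG p (by omega)) uQ fun w hw p hp => ?_
    refine not_mem_of_number hu (hcoef p hp) (fun w hw => H_number (t := t) (Δ := Δ)
      (q := q) (c := c) hp (hu w hw)) ?_ w hw
    rw [LinearMap.comp_apply, uK, map_zero]
  have u_Q : ∀ w ∈ u.support, Gen.Q (-1) ∉ w := by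
    intro w hw
    have h1 := not_mem_of_number hu two_ne_zero (fun w hw => Q_number (t := t) (Δ := Δ) (q := q)
      (c := c) (p := 0) le_rfl (not_hwt_of_good (hu w hw)) ?_) ?_ w hw
    · simpa using h1
    · rintro x hx n rfl
      simpa [lowLetters] using u_low w hw _ hx
    · rw [LinearMap.comp_apply, uG 0 le_rfl, map_zero]
  -- The number operator of `H (-1)`, evaluated on `v`, becomes `H (-1)` applied to a multiple of
  -- `u`; it compares the words of `u` with those of `v`.
  have hN : t.grT Δ q c (.H (-1)) ((t.sg / 2) • u) =
      t.lam Δ q c (diag (fun w => (((1 : ℤ) : ℂ) * (c / 3 - 1)) * w.count (.H (-1))) v) := by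
    rw [← eq_lam_diag hv _ fun w hw => H_number le_rfl (hv w hw), LinearMap.comp_apply,
      vK 1 le_rfl, if_pos rfl]
  -- A word of `u` without `G (-1)` consists of letters `L (-1)` and `Q 0`. Prefixed by `H (-1)` and
  -- with one `L (-1)` removed it would be a word of `v` of kernel shape.
  have u_G : ∀ w ∈ u.support, Gen.G (-1) ∈ w := by
    intro w hw
    by_contra hG1
    have h1 : t.grT Δ q c (.H (-1)) ((t.sg / 2) • u) (.H (-1) :: w) ≠ 0 := by
      rw [map_smul, Finsupp.smul_apply, H_apply hu u_low]
      exact smul_ne_zero (div_ne_zero sg_ne_zero two_ne_zero) (Finsupp.mem_support_iff.1 hw)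
    rw [hN] at h1
    obtain ⟨w', hw', h2⟩ := exists_of_lam_apply_ne (hv.diag _) h1
    have hp : (Gen.L (-1) :: w').Perm (.H (-1) :: w) := h2 ▸ (ins_perm w').symm
    have hlow : ∀ x ∈ w, x = .L (-1) ∨ x = .Q 0 := by
      intro x hx
      have h3 := u_low w hw x hx
      simp only [lowLetters, Set.mem_insert_iff, Set.mem_singleton_iff] at h3
      rcases h3 with rfl | rfl | rfl | rfl
      · simp
      · exact absurd hx hG1
      · exact absurd hx (u_Q w hw)
      · simp
    refine hker w' (mem_support_diag.1 hw').2 (Or.inl ⟨fun x hx => ?_, ?_⟩)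
    · have h3 : x ∈ Gen.H (-1) :: w := hp.mem_iff.1 (by simp [hx])
      rcases List.mem_cons.1 h3 with h3 | h3
      · exact Or.inl h3
      · exact Or.inr (hlow x h3)
    · have h3 := hp.count_eq (.H (-1))
      rw [List.count_cons_of_ne (by simp), List.count_cons_self,
        List.count_eq_zero_of_not_mem (l := w)] at h3
      · exact h3
      · intro h4
        simpa using hlow _ h4
  have hu0 : u = 0 := by
    have h1 : t.lam Δ q c ((2 : ℂ) • u) = 0 := by
      -- As every word of `u` contains `G (-1)`, the number operator gives 2 λ u; it also gives 0,
      -- because `Q 0` kills `u`.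
      have h2 : (t.grT Δ q c (.G (-1)) ∘ₗ t.grT Δ q c (.Q 0)) u = ((2 : ℂ) • t.lam Δ q c) u := by
        refine eq_of_words fun w hw => ?_
        rw [← gw_good (t := t) (Δ := Δ) (q := q) (c := c) (hu w hw)]
        exact G_Q_zero_of_mem (hu w hw) (u_low w hw) (u_G w hw)
      rw [map_smul, ← LinearMap.smul_apply, ← h2, LinearMap.comp_apply, sqQ, map_zero]
    exact (smul_eq_zero.1 (eq_zero_of_lam (hu.smul _) h1)).resolve_left two_ne_zero
  have v_low : ∀ w ∈ v.support, ∀ x ∈ w, x ∈ lowLetters := by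
    refine mem_lowLetters_of hv hL hG hQ fun w hw p hp => ?_
    refine not_mem_of_number hv (hcoef p hp) (fun w hw => H_number (t := t) (Δ := Δ)
      (q := q) (c := c) hp (hv w hw)) ?_ w hw
    rw [LinearMap.comp_apply, vK, hu0]
    simp
  have v_mem : ∀ w ∈ v.support, Gen.G (-1) ∈ w ∧ Gen.Q (-1) ∈ w := by
    intro w hw
    by_contra h
    exact hker w hw (Or.inr ⟨v_low w hw, h⟩)
  -- With `u = 0` no H is left in `v`, and every remaining word contains both `G (-1)` and `Q (-1)`.
  -- Each of the two corresponding number operators then acts on `v` as 2 λ.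
  have e1 : (t.grT Δ q c (.Q (-1)) ∘ₗ t.grT Δ q c (.G 0)) v = ((2 : ℂ) • t.lam Δ q c) v := by
    refine eq_of_words fun w hw => ?_
    rw [← gw_good (t := t) (Δ := Δ) (q := q) (c := c) (hv w hw)]
    have h1 := Q_number (t := t) (Δ := Δ) (q := q) (c := c) (p := 0) le_rfl
      (not_hwt_of_good (hv w hw)) (fun x hx n hn => by
        subst hn
        simpa [lowLetters] using v_low w hw _ hx)
    simp only [neg_zero, zero_sub] at h1
    have h2 : w.count (.Q (-1)) = 1 := le_antisymm ((hv w hw).nodup _ (v_mem w hw).2 rfl)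
      (List.one_le_count_iff.2 (v_mem w hw).2)
    rw [h1, h2, LinearMap.smul_apply]
    simp
  have e2 : (t.grT Δ q c (.G (-1)) ∘ₗ t.grT Δ q c (.Q 0)) v = ((2 : ℂ) • t.lam Δ q c) v := by
    refine eq_of_words fun w hw => ?_
    rw [← gw_good (t := t) (Δ := Δ) (q := q) (c := c) (hv w hw)]
    exact G_Q_zero_of_mem (hv w hw) (v_low w hw) (v_mem w hw).1
  -- Composing the two number operators gives 4 λ² v; reordering the fermions turns the composite
  -- into an operator applied to `u = 0`.
  have e3 : t.grT Δ q c (.Q (-1)) (t.grT Δ q c (.G (-1)) u) = t.lam Δ q c (t.lam Δ q c ((4 : ℂ) • v)) := by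
    have h1 : t.grT Δ q c (.G (-1)) (t.grT Δ q c (.Q 0) (t.grT Δ q c (.Q (-1)) (t.grT Δ q c (.G 0) v))) = t.lam Δ q c (t.lam Δ q c ((4 : ℂ) • v)) := by
      rw [← LinearMap.comp_apply (t.grT Δ q c (.Q (-1))), e1, LinearMap.smul_apply, map_smul, map_smul,
        ← lam_comm, ← lam_comm, ← LinearMap.comp_apply (t.grT Δ q c (.G (-1))), e2, LinearMap.smul_apply,
        map_smul, map_smul, map_smul, smul_smul]
      norm_num
    rw [← h1, hu_def, Q_G, if_neg (by omega), add_zero, Q_Q (-1) 0, map_neg, neg_neg]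
  rw [hu0, map_zero, map_zero] at e3
  have h4 := eq_zero_of_lam (hv.smul 4) (eq_zero_of_lam (normal_grT _ _) e3.symm)
  exact (smul_eq_zero.1 h4).resolve_left (by norm_num)

end Kind

namespace StdTerm

theorem mem_word_of_mem_block {X : StdTerm} {n : ℕ} (hn : n < 8) {x : Gen} (hx : x ∈ X.block n) :
    x ∈ X.word := by
  rw [← X.part_word n hn] at hx
  exact (mem_clsPart.1 hx).1

theorem level_low (k : ℕ) (r₁ r₂ r₃ : Bool) :
    level (low k r₁ r₂ r₃).word = k + r₁.toNat + r₂.toNat := by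
  cases r₁ <;> cases r₂ <;> cases r₃ <;>
    simp [level, word, concat8, block, low, Gen.mode] <;> ring

theorem charge_low (k : ℕ) (r₁ r₂ r₃ : Bool) :
    charge (low k r₁ r₂ r₃).word = r₁.toNat - r₂.toNat - r₃.toNat := by
  cases r₁ <;> cases r₂ <;> cases r₃ <;> simp [charge, word, concat8, block, low, Gen.charge]

theorem level_lowH (k : ℕ) (r₃ : Bool) : level (lowH k r₃).word = k + 1 := by
  cases r₃ <;> simp [level, word, concat8, block, lowH, low, Gen.mode]

theorem charge_lowH (k : ℕ) (r₃ : Bool) : charge (lowH k r₃).word = -r₃.toNat := by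
  cases r₃ <;> simp [charge, word, concat8, block, lowH, low, Gen.charge]

end StdTerm
end TopN2
end

/-! ### Ordering kernels, zero modes and the dimension bound. -/

noncomputable section

namespace TopN2
namespace Kind

variable {t : Kind} {Δ q c : ℂ}

theorem KernelShape.exists_word {w : List Gen} (hw : Good w) (h : KernelShape w) :
    (∃ k r₃, (StdTerm.lowH k r₃).word = w) ∨
      ∃ k r₁ r₂ r₃, (r₁ && r₂) = false ∧ (StdTerm.low k r₁ r₂ r₃).word = w := by
  obtain ⟨X, rfl⟩ := hw.exists_word
  have hl : ∀ j ∈ X.l, Gen.L (-(j : ℤ)) ∈ X.word := fun j hj =>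
    StdTerm.mem_word_of_mem_block (n := 0) (by omega) (List.mem_map.2 ⟨j, hj, rfl⟩)
  have hh : ∀ j ∈ X.h, Gen.H (-(j : ℤ)) ∈ X.word := fun j hj =>
    StdTerm.mem_word_of_mem_block (n := 1) (by omega) (List.mem_map.2 ⟨j, hj, rfl⟩)
  have ha : ∀ j ∈ X.a, Gen.G (-(j : ℤ)) ∈ X.word := fun j hj =>
    StdTerm.mem_word_of_mem_block (n := 2) (by omega) (List.mem_map.2 ⟨j, hj, rfl⟩)
  have hb : ∀ j ∈ X.b, Gen.Q (-(j : ℤ)) ∈ X.word := fun j hj =>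
    StdTerm.mem_word_of_mem_block (n := 3) (by omega) (List.mem_map.2 ⟨j, hj, rfl⟩)
  have h1 : X.r₁ = true → Gen.G (-1) ∈ X.word := fun h =>
    StdTerm.mem_word_of_mem_block (n := 5) (by omega) (by simp [StdTerm.block, h])
  have h2 : X.r₂ = true → Gen.Q (-1) ∈ X.word := fun h =>
    StdTerm.mem_word_of_mem_block (n := 6) (by omega) (by simp [StdTerm.block, h])
  rcases h with ⟨h, hcount⟩ | ⟨h, hnot⟩
  · left
    refine ⟨X.k, X.r₃, congrArg StdTerm.word ?_⟩
    have eh : ∀ j ∈ X.h, j = 1 := fun j hj => by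
      have := h _ (hh j hj)
      simpa using this
    have eh2 : X.h = [1] := by
      have h3 := List.eq_replicate_of_mem eh
      have h4 : (X.block 1).count (.H (-1)) = 1 := by
        rw [← X.part_word 1 (by omega), clsPart, List.count_filter (by simp [Gen.cls, Gen.key]),
          hcount]
      rw [StdTerm.block, h3] at h4
      simp at h4
      rw [h3, h4]
      rfl
    ext1
    · refine (List.eq_nil_iff_forall_not_mem.2 fun j hj => ?_).symm
      have h3 := h _ (hl j hj)
      have h4 := X.l_ge j hj
      simp at h3
      omega
    · exact eh2.symm
    · refine (List.eq_nil_iff_forall_not_mem.2 fun j hj => ?_).symm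
      simpa using h _ (ha j hj)
    · refine (List.eq_nil_iff_forall_not_mem.2 fun j hj => ?_).symm
      have h3 := h _ (hb j hj)
      have h4 := X.b_ge j hj
      simp at h3
      omega
    · rfl
    · by_contra h3
      have h4 := h _ (h1 (by simpa [StdTerm.lowH, StdTerm.low] using h3))
      simp at h4
    · by_contra h3
      have h4 := h _ (h2 (by simpa [StdTerm.lowH, StdTerm.low] using h3))
      simp at h4
    · rfl
  · right
    refine ⟨X.k, X.r₁, X.r₂, X.r₃, ?_, congrArg StdTerm.word ?_⟩
    · by_contra h3
      simp at h3
      exact hnot ⟨h1 h3.1, h2 h3.2⟩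
    simp only [lowLetters, Set.mem_insert_iff, Set.mem_singleton_iff] at h
    ext1
    · refine (List.eq_nil_iff_forall_not_mem.2 fun j hj => ?_).symm
      have h3 := h _ (hl j hj)
      have h4 := X.l_ge j hj
      simp at h3
      omega
    · refine (List.eq_nil_iff_forall_not_mem.2 fun j hj => ?_).symm
      simpa using h _ (hh j hj)
    · refine (List.eq_nil_iff_forall_not_mem.2 fun j hj => ?_).symm
      have h3 := h _ (ha j hj)
      have h4 := X.a_ge j hj
      simp at h3
      omega
    · refine (List.eq_nil_iff_forall_not_mem.2 fun j hj => ?_).symm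
      have h3 := h _ (hb j hj)
      have h4 := X.b_ge j hj
      simp at h3
      omega
    all_goals rfl

theorem KernelShape.exists_mem {w : List Gen} (hw : Good w) {m : ℕ} {n : ℤ} (hl : level w = m)
    (hn : charge w = t.sgi * n) (h : KernelShape w) :
    ∃ X ∈ orderingKernel t m n, X.word = w := by
  rcases h.exists_word hw with ⟨k, r₃, rfl⟩ | ⟨k, r₁, r₂, r₃, hr, rfl⟩
  · refine ⟨_, ?_, rfl⟩
    rw [StdTerm.level_lowH] at hl
    rw [StdTerm.charge_lowH] at hn
    obtain rfl : k + 1 = m := by omega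
    cases t <;> cases r₃ <;> simp only [sgi, one_mul, Bool.toNat_true, Bool.toNat_false] at hn
    · obtain rfl : n = 0 := by omega
      simp [orderingKernel]
    · obtain rfl : n = -1 := by omega
      simp [orderingKernel]
    · obtain rfl : n = 0 := by omega
      simp [orderingKernel]
    · obtain rfl : n = 1 := by omega
      simp [orderingKernel]
  · refine ⟨_, ?_, rfl⟩
    rw [StdTerm.level_low] at hl
    rw [StdTerm.charge_low] at hn
    have hn' : n = t.sgi * (r₁.toNat - r₂.toNat - r₃.toNat) := by
      rw [hn]; cases t <;> simp [sgi]
    obtain rfl : k + r₁.toNat + r₂.toNat = m := by omega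
    subst hn'
    cases t <;> cases r₁ <;> cases r₂ <;> cases r₃ <;>
      first | (simp at hr; done) | simp [orderingKernel, sgi]

theorem toWords_injective : Function.Injective (t.toWords Δ q c) := fun v w h => by
  rw [← eval_toWords t Δ q c v, h, eval_toWords]

theorem positive_gn {x : Gen} (hx : 0 < x.mode) : t.gn x ∈ positive := by
  cases x with
  | L p => exact ⟨p, hx, Or.inl (t.gn_L p)⟩
  | H p => exact ⟨p, hx, Or.inr (Or.inl (t.gn_H p))⟩
  | G p =>
    refine ⟨p, hx, Or.inr (Or.inr ?_)⟩
    cases t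
    · exact Or.inl rfl
    · exact Or.inr rfl
  | Q p =>
    refine ⟨p, hx, Or.inr (Or.inr ?_)⟩
    cases t
    · exact Or.inr rfl
    · exact Or.inl rfl
  | C => exact absurd hx (lt_irrefl _)

theorem exists_gn_of_positive {u : U} (hu : u ∈ positive) : ∃ x : Gen, 0 < x.mode ∧ u = t.gn x := by
  obtain ⟨k, hk, rfl | rfl | rfl | rfl⟩ := hu
  · exact ⟨.L k, hk, (t.gn_L k).symm⟩
  · exact ⟨.H k, hk, (t.gn_H k).symm⟩
  · cases t
    · exact ⟨.G k, hk, rfl⟩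
    · exact ⟨.Q k, hk, rfl⟩
  · cases t
    · exact ⟨.Q k, hk, rfl⟩
    · exact ⟨.G k, hk, rfl⟩

theorem toWords_gn_smul (x : Gen) (v : Verma t Δ q c) :
    t.toWords Δ q c (t.gn x • v) = (t.data Δ q c).T x (t.toWords Δ q c v) := by
  rw [toWords_smul, rho_gn]

theorem annihilated_iff {v : Verma t Δ q c} : (∀ x ∈ positive, x • v = 0) ↔
    ∀ x : Gen, 0 < x.mode → (t.data Δ q c).T x (t.toWords Δ q c v) = 0 := by
  constructor
  · intro h x hx
    rw [← toWords_gn_smul, h _ (positive_gn hx), map_zero]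
  · intro h u hu
    obtain ⟨x, hx, rfl⟩ := exists_gn_of_positive (t := t) hu
    refine toWords_injective ?_
    rw [toWords_gn_smul, h x hx, map_zero]

/-- A vector annihilated by the positive operators is determined by its coefficients in the ordering
kernel. -/
theorem exists_kernel_term (hc : c ≠ 3) {v : Verma t Δ q c} {m : ℕ} {n : ℤ}
    (hg : HasGrade v m n) (h : ∀ x ∈ positive, x • v = 0) (hv : v ≠ 0) :
    ∃ X ∈ orderingKernel t m n, t.toWords Δ q c v X.word ≠ 0 := by
  by_contra! hker
  set φ := t.toWords Δ q c v with hφ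
  have hφ0 : φ ≠ 0 := fun h0 => hv (toWords_injective (h0.trans (map_zero _).symm))
  set d := φ.support.sup fun w => (w.map Gen.deg).sum with hd
  have hle : ∀ w ∈ φ.support, (w.map Gen.deg).sum ≤ d := fun w hw =>
    Finset.le_sup (f := fun w => (w.map Gen.deg).sum) hw
  obtain ⟨w₀, hw₀, hw₀d⟩ := Finset.exists_mem_eq_sup φ.support
    (Finsupp.support_nonempty_iff.2 hφ0) fun w => (w.map Gen.deg).sum
  -- The leading term. It is supported on words of the same level and charge as `v`, so `gr_kernel`
  -- would force it to vanish, although it contains `w₀`.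
  set ψ := φ.filter fun w => (w.map Gen.deg).sum = d with hψ
  have hsupp : ∀ w ∈ ψ.support, w ∈ φ.support := fun w hw => by
    rw [hψ, Finsupp.support_filter] at hw
    exact (Finset.mem_filter.1 hw).1
  have hT : ∀ x : Gen, 0 < x.mode → t.grT Δ q c x ψ = 0 := by
    intro x hx
    refine ((t.data Δ q c).gr_T_filter (t.deg_br Δ q c) x φ d hle).trans ?_
    rw [annihilated_iff.1 h x hx]
    exact Finsupp.filter_zero _
  have hψ0 : ψ = 0 := by
    refine gr_kernel (t := t) (Δ := Δ) (q := q) hc (fun w hw => good_of_mem_support (hsupp w hw))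
      (fun p hp => hT (.L p) hp) (fun p hp => hT (.H p) hp) (fun p hp => hT (.G p) hp)
      (fun p hp => hT (.Q p) hp) fun w hw hs => ?_
    have hgr := grade_of_mem_support hg (hsupp w hw)
    obtain ⟨X, hX, rfl⟩ := hs.exists_mem (good_of_mem_support (hsupp w hw)) hgr.1 hgr.2
    exact Finsupp.mem_support_iff.1 (hsupp _ hw) (hker X hX)
  have h1 := DFunLike.congr_fun hψ0 w₀
  rw [hψ, Finsupp.filter_apply_pos _ _ (by rw [hd, hw₀d])] at h1
  exact Finsupp.mem_support_iff.1 hw₀ h1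

/-- The bracket of a positive mode with a zero mode consists of modes with the same positive index;
its central term is absent since the indices do not add up to zero. -/
theorem T_zero_mode {φ : Words} (h : ∀ x : Gen, 0 < x.mode → (t.data Δ q c).T x φ = 0) {y : Gen}
    (hy : y = .G 0 ∨ y = .Q 0) (x : Gen) (hx : 0 < x.mode) :
    (t.data Δ q c).T x ((t.data Δ q c).T y φ) = 0 := by
  rw [SuperData.T_comm, h x hx, map_zero, smul_zero, zero_add, data_br]
  cases x with
  | C => exact absurd hx (lt_irrefl _)
  | L p | H p | G p | Q p =>
    have hp : 0 < p := hx
    have h1 := h (.L p) hx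
    have h2 := h (.H p) hx
    have h3 := h (.G p) hx
    have h4 := h (.Q p) hx
    rcases hy with rfl | rfl <;> simp [br, h1, h2, h3, h4, hp.ne']

theorem annihilated_zero_mode {v : Verma t Δ q c} (h : ∀ x ∈ positive, x • v = 0) {y : Gen}
    (hy : y = .G 0 ∨ y = .Q 0) : ∀ x ∈ positive, x • (t.gn y • v) = 0 := by
  rw [annihilated_iff] at h ⊢
  intro x hx
  rw [toWords_gn_smul]
  exact T_zero_mode h hy x hx

theorem grade_zero_mode {v : Verma t Δ q c} {m : ℕ} {n : ℤ} (h : HasGrade v m n) {y : Gen}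
    (hy : y = .G 0 ∨ y = .Q 0) : HasGrade (t.gn y • v) m (n + t.sgi * y.charge) := by
  have h1 := congrArg (t.toWords Δ q c) h.1
  have h2 := congrArg (t.toWords Δ q c) h.2
  rw [← t.gn_L, toWords_gn_smul, map_smul] at h1
  rw [← t.gn_H, toWords_gn_smul, map_smul] at h2
  constructor <;> refine toWords_injective ?_
  · rw [← t.gn_L, toWords_gn_smul, LinearMap.map_smul, toWords_gn_smul, SuperData.T_comm, h1, map_smul]
    rcases hy with rfl | rfl <;> simp [data_br, data_odd, br, Gen.odd, sgn]
  · rw [← t.gn_H, toWords_gn_smul, LinearMap.map_smul, toWords_gn_smul, SuperData.T_comm, h2, map_smul,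
      Int.cast_add, Int.cast_mul, sgi_cast]
    rcases hy with rfl | rfl <;> simp [data_br, data_odd, br, Gen.odd, sgn, Gen.charge] <;> module

theorem zero_mode_ne_zero {v : Verma t Δ q c} {m : ℕ} {n : ℤ} (h : IsNoLabel v m n) {y : Gen}
    (hy : y = .G 0 ∨ y = .Q 0) : t.gn y • v ≠ 0 := by
  rcases hy with rfl | rfl <;> cases t
  · exact h.G_ne
  · exact h.Q_ne
  · exact h.Q_ne
  · exact h.G_ne

theorem exists_kernel_term_zero_mode (hc : c ≠ 3) {v : Verma t Δ q c} {m : ℕ} {n : ℤ}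
    (h : IsNoLabel v m n) {y : Gen} (hy : y = .G 0 ∨ y = .Q 0) :
    ∃ X ∈ orderingKernel t m (n + t.sgi * y.charge),
      t.toWords Δ q c (t.gn y • v) X.word ≠ 0 :=
  exists_kernel_term hc (grade_zero_mode h.grade hy) (annihilated_zero_mode h.annihilated hy)
    (zero_mode_ne_zero h hy)

theorem charge_of_mem_orderingKernel {X : StdTerm} {m : ℕ} {n : ℤ} (h : X ∈ orderingKernel t m n) :
    -2 ≤ t.sgi * n ∧ t.sgi * n ≤ 1 := by
  cases t <;> simp only [orderingKernel, Set.mem_ofPred_eq] at h <;>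
    rcases h with ⟨rfl, -⟩ | ⟨rfl, -⟩ | ⟨rfl, -⟩ | ⟨rfl, -⟩ <;> simp [sgi]

theorem mem_allowedCharges (hc : c ≠ 3) {v : Verma t Δ q c} {m : ℕ} {n : ℤ}
    (h : IsNoLabel v m n) : n ∈ allowedCharges t := by
  obtain ⟨X, hX, -⟩ := exists_kernel_term_zero_mode hc h (Or.inl rfl)
  obtain ⟨Y, hY, -⟩ := exists_kernel_term_zero_mode hc h (Or.inr rfl)
  have h1 := charge_of_mem_orderingKernel hX
  have h2 := charge_of_mem_orderingKernel hY
  -- In units of the closed field's charge, both n + 1 and n - 1 lie between -2 and 1.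
  cases t <;> simp [sgi, Gen.charge, allowedCharges] at * <;> omega

/-- From an allowed charge, one of the two zero modes leads to an end of the charge range. At the
ends only one kernel term exists, with `L (-1)` to the power m - 1. -/
theorem exists_unique_term {m : ℕ} {n : ℤ} (hn : n ∈ allowedCharges t) :
    ∃ y : Gen, (y = .G 0 ∨ y = .Q 0) ∧
      ∃ X, ∀ Y ∈ orderingKernel t m (n + t.sgi * y.charge), Y = X := by
  cases t <;> simp only [allowedCharges, Finset.mem_insert, Finset.mem_singleton] at hn <;>
    rcases hn with rfl | rfl
  · refine ⟨.Q 0, Or.inr rfl, .low (m - 1) false true true, fun Y hY => ?_⟩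
    simp [orderingKernel, sgi, Gen.charge] at hY
    obtain ⟨k, rfl, rfl⟩ := hY
    rfl
  · refine ⟨.G 0, Or.inl rfl, .low (m - 1) true false false, fun Y hY => ?_⟩
    simp [orderingKernel, sgi, Gen.charge] at hY
    obtain ⟨k, rfl, rfl⟩ := hY
    rfl
  · refine ⟨.G 0, Or.inl rfl, .low (m - 1) true false false, fun Y hY => ?_⟩
    simp [orderingKernel, sgi, Gen.charge] at hY
    obtain ⟨k, rfl, rfl⟩ := hY
    rfl
  · refine ⟨.Q 0, Or.inr rfl, .low (m - 1) false true true, fun Y hY => ?_⟩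
    simp [orderingKernel, sgi, Gen.charge] at hY
    obtain ⟨k, rfl, rfl⟩ := hY
    rfl

theorem rank_noLabelSpace (hc : c ≠ 3) {m : ℕ} {n : ℤ} {N : Submodule ℂ (Verma t Δ q c)}
    (hN : IsNoLabelSpace N m n) : Module.rank ℂ N ≤ (noLabelBound t n : Cardinal) := by
  rw [noLabelBound]
  split_ifs with hn
  · obtain ⟨y, hy, X, hX⟩ := exists_unique_term (m := m) hn
    -- A vector in the kernel of this functional has a zero-mode image with vanishing coefficient on
    -- the only available kernel term, so it is not a no-label singular vector and must be zero.
    let f : N →ₗ[ℂ] ℂ := Finsupp.lapply X.word ∘ₗ (t.data Δ q c).T y ∘ₗ t.toWords Δ q c ∘ₗ N.subtype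
    have hf : Function.Injective f := by
      rw [← LinearMap.ker_eq_bot, LinearMap.ker_eq_bot']
      intro v hv
      by_contra hv0
      obtain ⟨Y, hY, hY0⟩ := exists_kernel_term_zero_mode hc
        (hN.2 v v.2 fun h => hv0 (Subtype.ext h)) hy
      rw [hX Y hY, toWords_gn_smul] at hY0
      exact hY0 hv
    simpa using f.rank_le_of_injective hf
  · have h : N = ⊥ := by
      rw [Submodule.eq_bot_iff]
      intro v hv
      by_contra hv0
      exact hn (mem_allowedCharges hc (hN.2 v hv hv0))
    subst h
    simp

end Kind
end TopN2
end

theorem mainTheorem6 (t : TopN2.Kind) (Δ q c : ℂ) (hc : c ≠ 3) (m : ℕ) (hm : 1 ≤ m) (n : ℤ) :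
    (∀ N : Submodule ℂ (TopN2.Verma t Δ q c), TopN2.IsNoLabelSpace N m n →
      Module.rank ℂ N ≤ (TopN2.noLabelBound t n : Cardinal)) ∧
    (∀ ψ : TopN2.Verma t Δ q c, TopN2.IsNoLabel ψ m n →
      Δ = -(m : ℂ) ∧ n ∈ TopN2.allowedCharges t ∧
      (∃! f : TopN2.StdTerm →₀ ℂ, TopN2.IsNormalForm f ψ) ∧
      ∀ f : TopN2.StdTerm →₀ ℂ, TopN2.IsNormalForm f ψ →
        ∃ X ∈ TopN2.orderingKernel t m n, f X ≠ 0) := by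
  refine ⟨fun N hN => TopN2.Kind.rank_noLabelSpace hc hN, fun ψ hψ =>
    ⟨?_, TopN2.Kind.mem_allowedCharges hc hψ, TopN2.Kind.existsUnique_normalForm ψ,
      fun f hf => ?_⟩⟩
  · linear_combination hψ.weight_zero
  · have h0 : ψ ≠ 0 := fun h => hψ.not_prop (h ▸ Submodule.zero_mem _)
    obtain ⟨X, hX, hX0⟩ := TopN2.Kind.exists_kernel_term hc hψ.grade hψ.annihilated h0
    exact ⟨X, hX, by rwa [TopN2.Kind.normalForm_apply hf]⟩
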